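/- Let $G\subset SU(n)$ be a finite subgroup acting freely on $\mathbb{C}^n\setminus\{0\}$ and let $\pi: X\to \mathbb{C}^n/G$ be a crepant resolution, i.e. $X$ is a (connected) complex manifold, $\pi$ is holomorphic, proper and bimeromorphic, and the pull-back $\pi^*\Omega$ of the form $\Omega$ on $\mathbb{C}^n/G$ induced by $dz_1\wedge\cdots\wedge dz_n$ is a nowhere vanishing holomorphic $n$-form on $X$. Let $f\in\mathbb{C}[z_1,\dots,z_n]$ be a $G$-invariant polynomial with an isolated critical point at the origin that is quasi-homogeneous with all weights at most $\tfrac12$: there are rational numbers $0<q_i\le \tfrac12$ such that $f(\lambda^{q_1}z_1,\dots,\lambda^{q_n}z_n)=\lambda f(z_1,\dots,z_n)$. Write $f_X=\pi^*f$ for the induced function on $X$. Let $g$ be any ALE Kähler metric on $X$, i.e. a Kähler metric such that for some $R>0$ and for all $k\ge 0$ $$\nabla^k(\pi_*g-g_0)=O(r^{-2n-k})\quad\text{on } \{z\in\mathbb{C}^n/G : r(z)>R\},$$ where $g_0$ is the Euclidean metric, $\nabla$ its Levi-Civita connection and $r(z)=(\sum_i|z_i|^2)^{1/2}$. Then: 1.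 $(X,g)$ has bounded geometry: it is complete, it has positive injectivity radius, and for each $k\ge0$ the $k$-th covariant derivative of its Riemann curvature tensor is uniformly bounded. 2. $f_X$ is strongly elliptic: it is holomorphic, and for all $\epsilon>0$ and all integers $k\ge2$ $$\epsilon\,|\nabla f_X(z)|^k-|\nabla^k f_X(z)|\to+\infty\quad\text{as } d(z,z_0)\to\infty \tag{T}$$ for any fixed $z_0\in X$, where $\nabla$, $|\cdot|$ and $d$ are the Levi-Civita connection, the tensor norms and the distance of $g$. -/

import Mathlib

open Set Filter Topology Manifold Bundle
open scoped ContDiff ENNReal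

noncomputable section

/-! ### Tensor calculus in an open subset of a vector space

A metric is a map `h : E → E →L[ℝ] E →L[ℝ] ℝ`, and a covariant tensor field of rank `m` with
values in `F` is a map `T : E → (Fin m → E) → F`, `T u` being evaluated on `m` tangent vectors. -/

section LocalTensors

variable {E : Type*} [NormedAddCommGroup E] [NormedSpace ℝ E]
  {F : Type*} [NormedAddCommGroup F] [NormedSpace ℝ F]

/-- The Christoffel symbol `Γ_u(v, w)` of `h`: the vector with
`h(Γ(v, w), z) = (1/2) (∂_v h(w, z) + ∂_w h(v, z) - ∂_z h(v, w))` for all `z`. -/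
def christoffel (h : E → E →L[ℝ] E →L[ℝ] ℝ) (u v w : E) : E :=
  (h u).inverse ((1 / 2 : ℝ) •
    (fderiv ℝ h u v w + fderiv ℝ h u w v - ((fderiv ℝ h u).flip v).flip w))

/-- The covariant derivative of `T` for the Levi-Civita connection of `h`:
`(∇T)(v₀, v₁, …, v_m) = ∂_{v₀} (T(v₁, …, v_m)) - ∑ i, T(v₁, …, Γ(v₀, v_i), …, v_m)`. -/
def covDeriv (h : E → E →L[ℝ] E →L[ℝ] ℝ) {m : ℕ} (T : E → (Fin m → E) → F) :
    E → (Fin (m + 1) → E) → F := fun u v =>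
  fderiv ℝ (fun y => T y (fun i => v i.succ)) u (v 0) -
    ∑ i : Fin m, T u (Function.update (fun j => v j.succ) i (christoffel h u (v 0) (v i.succ)))

/-- The iterated covariant derivative `∇^k T`. -/
def iterCovDeriv (h : E → E →L[ℝ] E →L[ℝ] ℝ) {m : ℕ} (T : E → (Fin m → E) → F) :
    (k : ℕ) → E → (Fin (m + k) → E) → F
  | 0 => T
  | k + 1 => covDeriv h (iterCovDeriv h T k)

/-- The curvature `R(v, w) z = ∇_v ∇_w z - ∇_w ∇_v z - ∇_[v, w] z` of the Levi-Civita connection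
of `h`, in terms of the Christoffel symbols. -/
def curvature (h : E → E →L[ℝ] E →L[ℝ] ℝ) (u v w z : E) : E :=
  fderiv ℝ (fun y => christoffel h y w z) u v - fderiv ℝ (fun y => christoffel h y v z) u w
    + christoffel h u v (christoffel h u w z) - christoffel h u w (christoffel h u v z)

/-- The Riemann curvature tensor, as a covariant tensor field of rank `4`. -/
def curvatureTensor (h : E → E →L[ℝ] E →L[ℝ] ℝ) (u : E) (v : Fin 4 → E) : ℝ :=
  h u (curvature h u (v 0) (v 1) (v 2)) (v 3)

/-- `e` is an orthonormal basis for the inner product `B`. -/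
def IsOrthonormalFrame (B : E →L[ℝ] E →L[ℝ] ℝ) (e : Fin (Module.finrank ℝ E) → E) : Prop :=
  ∀ i j, B (e i) (e j) = if i = j then 1 else 0

/-- The norm of a covariant tensor `t` for the inner product `B`, that is `(∑ |t(e_I)|²)^{1/2}`, the
sum being over all multi-indices `I` and `e` being a `B`-orthonormal frame.  For a multilinear `t`
the sum is the same for all frames, so that the supremum is a supremum over equal values. -/
def tensorNorm (B : E →L[ℝ] E →L[ℝ] ℝ) {m : ℕ} (t : (Fin m → E) → F) : ℝ :=
  ⨆ e : {e : Fin (Module.finrank ℝ E) → E // IsOrthonormalFrame B e},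
    Real.sqrt (∑ I : Fin m → Fin (Module.finrank ℝ E), ‖t (fun a => e.1 (I a))‖ ^ 2)

/-- All derivatives of `T` satisfy `∇^k T = O(r^{-d-k})` on `{r > R}`. -/
def DecaysWithDerivatives (T : E → F) (R : ℝ) (d : ℕ) : Prop :=
  ∀ k : ℕ, ∃ C : ℝ, ∀ z : E, R < ‖z‖ → ‖iteratedFDeriv ℝ k T z‖ ≤ C * ‖z‖⁻¹ ^ (d + k)

end LocalTensors

/-! ### Riemannian manifolds -/

section Riemannian

variable {E : Type*} [NormedAddCommGroup E] [NormedSpace ℝ E]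
  {M : Type*} [TopologicalSpace M] [ChartedSpace E M] [IsManifold 𝓘(ℝ, E) ∞ M]

variable (E M) in
/-- Smooth Riemannian metrics on `M`. -/
abbrev SmoothMetric : Type _ :=
  ContMDiffRiemannianMetric 𝓘(ℝ, E) ∞ E (fun x : M => TangentSpace 𝓘(ℝ, E) x)

namespace SmoothMetric

/-- The pull-back `s^* g` of `g` by a map `s` from the model space to `M`. -/
def pullback (g : SmoothMetric E M) (s : E → M) (u : E) : E →L[ℝ] E →L[ℝ] ℝ :=
  let D : E →L[ℝ] E := mfderiv 𝓘(ℝ, E) 𝓘(ℝ, E) s u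
  let B : E →L[ℝ] E →L[ℝ] ℝ := g.inner (s u)
  B.bilinearComp D D

/-- The metric `g` read in the chart around `x`. -/
def inChart (g : SmoothMetric E M) (x : M) : E → E →L[ℝ] E →L[ℝ] ℝ :=
  g.pullback (chartAt E x).symm

/-- The distance of `g`: the infimum of the lengths of the `C^1` paths. -/
def edist (g : SmoothMetric E M) (x y : M) : ℝ≥0∞ :=
  letI : RiemannianBundle (fun x : M => TangentSpace 𝓘(ℝ, E) x) := ⟨g.toRiemannianMetric⟩
  riemannianEDist 𝓘(ℝ, E) x y

/-- `(M, g)` is complete: Cauchy sequences for the distance of `g` converge. -/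
def IsComplete (g : SmoothMetric E M) : Prop :=
  ∀ u : ℕ → M, (∀ ε : ℝ≥0∞, 0 < ε → ∃ N, ∀ m ≥ N, ∀ k ≥ N, g.edist (u m) (u k) < ε) →
    ∃ x, Tendsto u atTop (𝓝 x)

/-- `γ` is a geodesic with unit speed on `[0, ℓ]` (and smooth on a neighbourhood of it):
`c'' + Γ(c', c') = 0` and `|c'| = 1`, where `c` is `γ` read in a chart. -/
def IsUnitSpeedGeodesic (g : SmoothMetric E M) (γ : ℝ → M) (ℓ : ℝ) : Prop :=
  ∀ t ∈ Icc 0 ℓ, ContMDiffAt 𝓘(ℝ, ℝ) 𝓘(ℝ, E) ∞ γ t ∧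
    let h := g.inChart (γ t)
    let c : ℝ → E := fun τ => chartAt E (γ t) (γ τ)
    deriv (deriv c) t + christoffel h (c t) (deriv c t) (deriv c t) = 0 ∧
      h (c t) (deriv c t) (deriv c t) = 1

/-- The injectivity radius at `x`: the largest `r` such that all geodesics issuing from `x` of length
less than `r` are minimizing (and thus the largest `r` such that `exp_x` is a diffeomorphism from the
ball of radius `r` in the tangent space onto its image, when `(M, g)` is complete). -/
def injectivityRadiusAt (g : SmoothMetric E M) (x : M) : ℝ≥0∞ :=
  sSup {r : ℝ≥0∞ | ∀ (γ : ℝ → M) (ℓ : ℝ), 0 ≤ ℓ → γ 0 = x → g.IsUnitSpeedGeodesic γ ℓ →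
    ENNReal.ofReal ℓ < r → g.edist x (γ ℓ) = ENNReal.ofReal ℓ}

/-- The pointwise norm `|∇^k Rm|` at `x`. -/
def normCovDerivCurvature (g : SmoothMetric E M) (k : ℕ) (x : M) : ℝ :=
  tensorNorm (g.inChart x (chartAt E x x))
    (iterCovDeriv (g.inChart x) (curvatureTensor (g.inChart x)) k (chartAt E x x))

/-- The pointwise norm `|∇^k f|` at `x`, for a complex function `f`. -/
def normCovDeriv (g : SmoothMetric E M) (f : M → ℂ) (k : ℕ) (x : M) : ℝ :=
  tensorNorm (g.inChart x (chartAt E x x))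
    (iterCovDeriv (m := 0) (g.inChart x) (fun u _ => f ((chartAt E x).symm u)) k (chartAt E x x))

/-- `(M, g)` has bounded geometry: it is complete, its injectivity radius is positive, and each
covariant derivative of its curvature is bounded. -/
structure HasBoundedGeometry (g : SmoothMetric E M) : Prop where
  complete : g.IsComplete
  injectivityRadius_pos : 0 < ⨅ x : M, g.injectivityRadiusAt x
  curvature_bounded : ∀ k : ℕ, ∃ C : ℝ, ∀ x : M, g.normCovDerivCurvature k x ≤ C

/-- Condition (T): for all `ε > 0` and `k ≥ 2`, `ε |∇f(z)|^k - |∇^k f(z)| → +∞` as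
`d(z, z₀) → ∞`. -/
def ConditionT (g : SmoothMetric E M) (f : M → ℂ) : Prop :=
  ∀ ε : ℝ, 0 < ε → ∀ k : ℕ, 2 ≤ k → ∀ z₀ : M, ∀ C : ℝ, ∃ D : ℝ, ∀ z : M,
    ENNReal.ofReal D < g.edist z z₀ → C < ε * g.normCovDeriv f 1 z ^ k - g.normCovDeriv f k z

end SmoothMetric

end Riemannian

/-! ### Complex manifolds -/

/-- The space `ℂ^n` with its Hermitian norm. -/
abbrev CSpace (n : ℕ) : Type := EuclideanSpace ℂ (Fin n)

/-- A complex manifold is a smooth real manifold. -/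
instance isManifold_real_of_complex {n : ℕ} {X : Type*} [TopologicalSpace X]
    [ChartedSpace (CSpace n) X] [IsManifold 𝓘(ℂ, CSpace n) ω X] :
    IsManifold 𝓘(ℝ, CSpace n) ∞ X := by
  refine isManifold_of_contDiffOn _ _ _ fun e e' he he' => ?_
  have h := (contDiffGroupoid ω 𝓘(ℂ, CSpace n)).compatible he he'
  have h' := (mem_groupoid_of_pregroupoid.1 h).1
  exact (ContDiffOn.restrict_scalars ℝ h').of_le le_top

section Complex

variable {n : ℕ} {X : Type*} [TopologicalSpace X] [ChartedSpace (CSpace n) X]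
  [IsManifold 𝓘(ℂ, CSpace n) ω X]

/-- `g` is Kähler: in the holomorphic charts of `X`, `g(iv, iw) = g(v, w)` and the two-form
`ω(v, w) = g(iv, w)` is closed. -/
structure SmoothMetric.IsKaehler (g : SmoothMetric (CSpace n) X) : Prop where
  hermitian : ∀ x : X, ∀ u ∈ (chartAt (CSpace n) x).target, ∀ v w : CSpace n,
    g.inChart x u (Complex.I • v) (Complex.I • w) = g.inChart x u v w
  closed : ∀ x : X, ∀ u ∈ (chartAt (CSpace n) x).target, ∀ a b c : CSpace n,
    fderiv ℝ (g.inChart x) u a (Complex.I • b) c + fderiv ℝ (g.inChart x) u b (Complex.I • c) a +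
      fderiv ℝ (g.inChart x) u c (Complex.I • a) b = 0

/-- `f` is strongly elliptic with respect to `g`: it is holomorphic and satisfies condition (T). -/
structure SmoothMetric.IsStronglyElliptic (g : SmoothMetric (CSpace n) X) (f : X → ℂ) : Prop where
  holomorphic : ContMDiff 𝓘(ℂ, CSpace n) 𝓘(ℂ, ℂ) ω f
  conditionT : g.ConditionT f

/-- A holomorphic volume form on `X`: a nowhere vanishing holomorphic `n`-form. -/
structure HolomorphicVolumeForm (n : ℕ) (X : Type*) [TopologicalSpace X]
    [ChartedSpace (CSpace n) X] where
  /-- The value of the form at `x`. It is holomorphic if its coefficients in charts are so. -/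
  form (x : X) : TangentSpace 𝓘(ℂ, CSpace n) x [⋀^Fin n]→L[ℂ] ℂ
  ne_zero (x : X) : form x ≠ 0
  holomorphic (x : X) (v : Fin n → CSpace n) : AnalyticOnNhd ℂ
    (fun u : CSpace n => form ((chartAt (CSpace n) x).symm u) (fun i =>
      mfderiv 𝓘(ℂ, CSpace n) 𝓘(ℂ, CSpace n) (chartAt (CSpace n) x).symm u (v i)))
    (chartAt (CSpace n) x).target

end Complex

/-! ### Quotient singularities and their resolutions -/

section Quotient

variable {n : ℕ}

/-- The orbit relation of `G ⊂ SU(n)` on `ℂ^n`. -/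
def orbitSetoid (G : Subgroup (Matrix.specialUnitaryGroup (Fin n) ℂ)) : Setoid (CSpace n) where
  r z w := ∃ A ∈ G, Matrix.toEuclideanLin (A : Matrix (Fin n) (Fin n) ℂ) z = w
  iseqv := by
    refine ⟨fun z => ⟨1, G.one_mem, by simp⟩, ?_, ?_⟩
    · rintro z _ ⟨A, hA, rfl⟩
      refine ⟨A⁻¹, G.inv_mem hA, ?_⟩
      have h : ((A⁻¹ * A : Matrix.specialUnitaryGroup (Fin n) ℂ) : Matrix (Fin n) (Fin n) ℂ) = 1 := by
        simp
      rw [Submonoid.coe_mul] at h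
      ext i
      simp [Matrix.toLpLin_apply, h]
    · rintro z _ _ ⟨A, hA, rfl⟩ ⟨B, hB, rfl⟩
      refine ⟨B * A, G.mul_mem hB hA, ?_⟩
      ext i
      simp [Matrix.toLpLin_apply]

/-- The quotient `ℂ^n / G`, with the quotient topology. -/
abbrev OrbitSpace (G : Subgroup (Matrix.specialUnitaryGroup (Fin n) ℂ)) : Type :=
  Quotient (orbitSetoid G)

/-- The quotient map `ℂ^n → ℂ^n / G`. -/
def orbitMap (G : Subgroup (Matrix.specialUnitaryGroup (Fin n) ℂ)) (z : CSpace n) : OrbitSpace G :=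
  Quotient.mk (orbitSetoid G) z

/-- `G` acts freely on `ℂ^n ∖ {0}`. -/
def ActsFreelyOffZero (G : Subgroup (Matrix.specialUnitaryGroup (Fin n) ℂ)) : Prop :=
  ∀ A ∈ G, ∀ z : CSpace n, z ≠ 0 →
    Matrix.toEuclideanLin (A : Matrix (Fin n) (Fin n) ℂ) z = z → A = 1

/-- `f` is a `G`-invariant polynomial. -/
def IsInvariantPolynomial (G : Subgroup (Matrix.specialUnitaryGroup (Fin n) ℂ))
    (f : MvPolynomial (Fin n) ℂ) : Prop :=
  ∀ A ∈ G, ∀ z : CSpace n,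
    f.eval (Matrix.toEuclideanLin (A : Matrix (Fin n) (Fin n) ℂ) z).ofLp = f.eval z.ofLp

/-- The function on `ℂ^n / G` induced by a `G`-invariant polynomial. -/
def IsInvariantPolynomial.descend {G : Subgroup (Matrix.specialUnitaryGroup (Fin n) ℂ)}
    {f : MvPolynomial (Fin n) ℂ} (hf : IsInvariantPolynomial G f) : OrbitSpace G → ℂ :=
  Quotient.lift (fun z : CSpace n => f.eval z.ofLp) (by
    rintro z _ ⟨A, hA, rfl⟩
    exact (hf A hA z).symm)

/-- `f` is quasi-homogeneous of total weight `1` for some weights in `(0, 1/2]`. -/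
def IsQuasiHomogeneousWeightsLeHalf (f : MvPolynomial (Fin n) ℂ) : Prop :=
  ∃ q : Fin n → ℚ, (∀ i, 0 < q i ∧ q i ≤ 1 / 2) ∧ f.IsWeightedHomogeneous q 1

/-- The origin is an isolated critical point of `f`. -/
def HasIsolatedCriticalPointAtZero (f : MvPolynomial (Fin n) ℂ) : Prop :=
  (∀ i, (f.pderiv i).eval 0 = 0) ∧
    ∀ᶠ z : CSpace n in 𝓝[≠] 0, ∃ i, (f.pderiv i).eval z.ofLp ≠ 0

variable (G : Subgroup (Matrix.specialUnitaryGroup (Fin n) ℂ))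
  {X : Type*} [TopologicalSpace X] [ChartedSpace (CSpace n) X]

/-- `p : X → ℂ^n / G` is holomorphic: it is continuous, and it pulls local holomorphic functions back
to holomorphic functions, where a function on an open subset of `ℂ^n / G` is holomorphic if it is so
on the preimage in `ℂ^n`. -/
def IsHolomorphicToOrbitSpace (p : X → OrbitSpace G) : Prop :=
  Continuous p ∧ ∀ (U : Set (OrbitSpace G)) (h : OrbitSpace G → ℂ), IsOpen U →
    AnalyticOnNhd ℂ (h ∘ orbitMap G) (orbitMap G ⁻¹' U) →
      ContMDiffOn 𝓘(ℂ, CSpace n) 𝓘(ℂ, ℂ) ω (h ∘ p) (p ⁻¹' U)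

/-- `s` is a holomorphic lift over the open set `V ⊂ ℂ^n` of the quotient map through `p`. -/
def IsHolomorphicLift (p : X → OrbitSpace G) (V : Set (CSpace n)) (s : CSpace n → X) : Prop :=
  ContMDiffOn 𝓘(ℂ, CSpace n) 𝓘(ℂ, CSpace n) ω s V ∧ ∀ z ∈ V, p (s z) = orbitMap G z

/-- `p : X → ℂ^n / G` is a resolution of singularities (of the quotient, by the complex manifold
`X`): it is holomorphic, proper, and biholomorphic over a dense open set `U` with dense preimage. The
inverse over `U` is given by a holomorphic `G`-invariant map `s` on the preimage of `U` in `ℂ^n`. -/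
structure IsResolution (p : X → OrbitSpace G) : Prop where
  holomorphic : IsHolomorphicToOrbitSpace G p
  proper : IsProperMap p
  bimeromorphic : ∃ U : Set (OrbitSpace G), IsOpen U ∧ Dense U ∧ Dense (p ⁻¹' U) ∧
    ∃ s : CSpace n → X, IsHolomorphicLift G p (orbitMap G ⁻¹' U) s ∧
      ∀ x : X, ∀ z : CSpace n, p x ∈ U → orbitMap G z = p x → s z = x

/-- A resolution `p : X → ℂ^n / G` is crepant: `K_X = p^* K_{ℂ^n/G}`. The canonical sheaf of the
quotient is trivialized by the form `Ω` induced by `dz₁ ∧ … ∧ dz_n`, and so this means that `p^* Ω` is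
a nowhere vanishing holomorphic form on `X`. A form on `X` is `p^* Ω` if its pull-back by any
holomorphic lift `s` of the quotient map is `s^* p^* Ω = dz₁ ∧ … ∧ dz_n`. -/
structure IsCrepantResolution (p : X → OrbitSpace G) : Prop extends IsResolution G p where
  crepant : ∃ Θ : HolomorphicVolumeForm n X, ∀ (V : Set (CSpace n)) (s : CSpace n → X),
    IsOpen V → IsHolomorphicLift G p V s → ∀ z ∈ V, ∀ v : Fin n → CSpace n,
      Θ.form (s z) (fun i => mfderiv 𝓘(ℂ, CSpace n) 𝓘(ℂ, CSpace n) s z (v i)) =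
        Matrix.det (Matrix.of fun i j => v j i)

/-- The Euclidean metric `∑ (dx_i² + dy_i²)` on `ℂ^n`. -/
def euclideanMetric (n : ℕ) : CSpace n →L[ℝ] CSpace n →L[ℝ] ℝ :=
  (innerSL ℝ : CSpace n →L[ℝ] CSpace n →L[ℝ] ℝ)

/-- `g` is an ALE Kähler metric on the resolution `X` of `ℂ^n / G`: it is Kähler, and for some
`R > 0`, `∇^k (p_* g - g₀) = O(r^{-2n-k})` on `{r > R}` for all `k`. Here `s` is the inverse of `p`
over `{r > R}`, read on `ℂ^n`, and `s^* g` is the lift of `p_* g` to `ℂ^n`. -/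
structure IsALEKaehlerMetric [IsManifold 𝓘(ℂ, CSpace n) ω X] (p : X → OrbitSpace G)
    (g : SmoothMetric (CSpace n) X) : Prop where
  kaehler : g.IsKaehler
  asymptotics : ∃ R : ℝ, 0 < R ∧ ∃ s : CSpace n → X,
    IsHolomorphicLift G p {z | R < ‖z‖} s ∧
    DecaysWithDerivatives (fun z => g.pullback s z - euclideanMetric n) R (2 * n)

end Quotient

end

open Set Filter Topology Manifold Bundle
open scoped ContDiff ENNReal

noncomputable section

set_option maxSynthPendingDepth 3
set_option synthInstance.maxHeartbeats 200000

/-! Outside a compact set, `X` is parametrized by the lift `s : {|z| > R} → X` of the quotient map.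
There `s^* g` is the Euclidean metric plus a term that is small, with all derivatives bounded. So
`s^* g` is uniformly coercive, its derivatives are uniformly bounded, and so are those of its
inverse and of its Christoffel symbols. Since `G` is finite and acts freely, distinct points of the
orbit of `z` are at distance at least `δ|z|`; hence `s` is injective on balls of a fixed radius.
These properties are collected in `IsUniformPatch`. By properness the rest of `X` is compact, and
finitely many coordinate balls with the same properties cover it.

Bounded geometry follows from such a finite cover. Each `∇^k Rm` is a universal expression in the
metric, its inverse and its derivatives, hence is bounded. Metric balls of a fixed radius lie in
compact sets, which gives completeness. For the injectivity radius no exponential map is used: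
`IsMetricOn.length_ge_of_geodesic` compares a short geodesic directly with any competing path. The
first variation integrates to zero, and coercivity makes the quadratic term dominate the Taylor
errors.

For condition (T), let `N(z) = ∑ |z_i|^{1/q_i}`, which scales like `f` under `z ↦ (t^{q_i} z_i)`.
Rescaling to the compact set `{N = 1}` gives two bounds for `N > 1`: every Euclidean derivative of
`f` of order at least one is `O(N^{1-a})`, where `0 < a ≤ q_i` for all `i`
(`IsQuasiHomogeneous.norm_iteratedFDeriv_le`), and `|df| ≥ c N^{1/2}`, because `q_i ≤ 1/2` and `df`
vanishes only at the origin (`IsQuasiHomogeneous.le_norm_fderiv`). The Christoffel symbols being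
bounded, `|∇^k f| = O(N^{1-a})` as well, whereas `|∇f|^k ≥ c' N^{k/2} ≥ c' N` for `k ≥ 2`. The
difference in (T) is thus at least a positive multiple of `N` minus `O(N^{1-a})`, and `N → ∞` at
infinity.

The norms in the statement are read in the preferred chart at each point, with no uniformity from
point to point. Naturality of `∇` and of the curvature (`IsPullbackOn.iterNabla`,
`IsPullbackOn.curvatureTensorL`) transports them to the patches. -/

/-! ### Maps with bounded derivatives -/

section BoundedDerivatives

variable {E F F₁ F₂ : Type*} [NormedAddCommGroup E] [NormedSpace ℝ E]
  [NormedAddCommGroup F] [NormedSpace ℝ F] [NormedAddCommGroup F₁] [NormedSpace ℝ F₁]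
  [NormedAddCommGroup F₂] [NormedSpace ℝ F₂]

/-- The `k`-th derivative of `T` is `O(w)` on `S`. -/
def DerivBoundedOn (S : Set E) (w : E → ℝ) (T : E → F) (k : ℕ) : Prop :=
  ∃ C : ℝ, ∀ u ∈ S, ‖iteratedFDeriv ℝ k T u‖ ≤ C * w u

/-- `T` is smooth on `S` and all its derivatives are `O(w)` there. -/
structure HasBoundedDerivs (S : Set E) (w : E → ℝ) (T : E → F) : Prop where
  contDiffOn : ContDiffOn ℝ ∞ T S
  bound (k : ℕ) : DerivBoundedOn S w T k

variable {S : Set E} {w : E → ℝ} {T : E → F}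

theorem DerivBoundedOn.congr {T' : E → F} {k : ℕ} (hS : IsOpen S) (h : DerivBoundedOn S w T k)
    (hT : EqOn T' T S) : DerivBoundedOn S w T' k := by
  obtain ⟨C, hC⟩ := h
  refine ⟨C, fun u hu => ?_⟩
  have h1 : T' =ᶠ[𝓝 u] T := hT.eventuallyEq_of_mem (hS.mem_nhds hu)
  rw [(h1.iteratedFDeriv ℝ k).self_of_nhds]
  exact hC u hu

theorem contDiffOn_bilinear (B : F →L[ℝ] F₁ →L[ℝ] F₂) {f : E → F} {f' : E → F₁}
    (hf : ContDiffOn ℝ ∞ f S) (hf' : ContDiffOn ℝ ∞ f' S) :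
    ContDiffOn ℝ ∞ (fun u => B (f u) (f' u)) S :=
  B.isBoundedBilinearMap.contDiff.comp₂_contDiffOn hf hf'

/-- Leibniz rule: order `k` of the product involves only orders up to `k` of the factors. Keeping
track of a single order is what allows the induction in `HasBoundedDerivs.inverse`. One factor is
bounded and the other carries the weight `w`. -/
theorem DerivBoundedOn.bilinear (hS : IsOpen S) (B : F →L[ℝ] F₁ →L[ℝ] F₂) {f : E → F}
    {f' : E → F₁} (hf : ContDiffOn ℝ ∞ f S) (hf' : ContDiffOn ℝ ∞ f' S) {k : ℕ}
    (h : ∀ j ≤ k, DerivBoundedOn S (fun _ => 1) f j) (h' : ∀ j ≤ k, DerivBoundedOn S w f' j) :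
    DerivBoundedOn S w (fun u => B (f u) (f' u)) k := by
  choose! C hC using h
  choose! C' hC' using h'
  refine ⟨‖B‖ * ∑ i ∈ Finset.range (k + 1), (k.choose i : ℝ) * |C i| * C' (k - i),
    fun u hu => ?_⟩
  have key := B.norm_iteratedFDerivWithin_le_of_bilinear hf hf' hS.uniqueDiffOn hu (n := k)
    (by exact_mod_cast le_top)
  simp only [iteratedFDerivWithin_of_isOpen _ hS hu] at key
  refine key.trans ?_
  rw [mul_assoc, Finset.sum_mul]
  refine mul_le_mul_of_nonneg_left (Finset.sum_le_sum fun i hi => ?_) B.opNorm_nonneg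
  have hi' : i ≤ k := Nat.lt_succ_iff.1 (Finset.mem_range.1 hi)
  have h1 : ‖iteratedFDeriv ℝ i f u‖ ≤ |C i| := by
    simpa using (hC i hi' u hu).trans (mul_le_mul_of_nonneg_right (le_abs_self _) zero_le_one)
  have h2 := hC' (k - i) (Nat.sub_le _ _) u hu
  rw [mul_assoc (_ * _)]
  exact mul_le_mul (mul_le_mul_of_nonneg_left h1 (by positivity)) h2 (norm_nonneg _)
    (by positivity)

theorem DerivBoundedOn.neg {k : ℕ} (h : DerivBoundedOn S w T k) :
    DerivBoundedOn S w (fun u => -T u) k := by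
  simpa only [DerivBoundedOn, ← Pi.neg_def, iteratedFDeriv_neg_apply, norm_neg] using h

theorem DerivBoundedOn.fderiv {k : ℕ} (h : DerivBoundedOn S w T (k + 1)) :
    DerivBoundedOn S w (fderiv ℝ T) k := by
  simpa only [DerivBoundedOn, norm_iteratedFDeriv_fderiv] using h

theorem DerivBoundedOn.of_fderiv {k : ℕ} (h : DerivBoundedOn S w (_root_.fderiv ℝ T) k) :
    DerivBoundedOn S w T (k + 1) := by
  simpa only [DerivBoundedOn, norm_iteratedFDeriv_fderiv] using h

namespace HasBoundedDerivs

theorem congr {T' : E → F} (hS : IsOpen S) (h : HasBoundedDerivs S w T) (hT : EqOn T' T S) :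
    HasBoundedDerivs S w T' :=
  ⟨h.contDiffOn.congr hT, fun k => (h.bound k).congr hS hT⟩

theorem mono {S' : Set E} (h : HasBoundedDerivs S w T) (hS : S' ⊆ S) :
    HasBoundedDerivs S' w T :=
  ⟨h.contDiffOn.mono hS, fun k => (h.bound k).imp fun _ hC u hu => hC u (hS hu)⟩

theorem const (c : F) : HasBoundedDerivs S (fun _ => 1) (fun _ => c) := by
  refine ⟨contDiffOn_const, fun k => ⟨‖c‖, fun u _ => ?_⟩⟩
  rcases k with _ | k
  · simp
  · simp [iteratedFDeriv_const_of_ne (Nat.succ_ne_zero k)]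

theorem bilinear (hS : IsOpen S) (B : F →L[ℝ] F₁ →L[ℝ] F₂) {f : E → F} {f' : E → F₁}
    (hf : HasBoundedDerivs S (fun _ => 1) f) (hf' : HasBoundedDerivs S w f') :
    HasBoundedDerivs S w (fun u => B (f u) (f' u)) :=
  ⟨contDiffOn_bilinear B hf.contDiffOn hf'.contDiffOn, fun _ =>
    .bilinear hS B hf.contDiffOn hf'.contDiffOn (fun j _ => hf.bound j) (fun j _ => hf'.bound j)⟩

theorem clm_comp (hS : IsOpen S) (L : F →L[ℝ] F₁) (h : HasBoundedDerivs S w T) :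
    HasBoundedDerivs S w (fun u => L (T u)) :=
  bilinear hS (ContinuousLinearMap.id ℝ (F →L[ℝ] F₁)) (const L) h

theorem fderiv (hS : IsOpen S) (h : HasBoundedDerivs S w T) :
    HasBoundedDerivs S w (fderiv ℝ T) :=
  ⟨h.contDiffOn.fderiv_of_isOpen hS (by simp), fun k => (h.bound (k + 1)).fderiv⟩

theorem add (hS : IsOpen S) {T' : E → F} (h : HasBoundedDerivs S w T)
    (h' : HasBoundedDerivs S w T') : HasBoundedDerivs S w (fun u => T u + T' u) := by
  refine ⟨h.contDiffOn.add h'.contDiffOn, fun k => ?_⟩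
  obtain ⟨C, hC⟩ := h.bound k
  obtain ⟨C', hC'⟩ := h'.bound k
  refine ⟨C + C', fun u hu => ?_⟩
  have h1 := (h.contDiffOn.contDiffAt (hS.mem_nhds hu)).of_le (m := k) (by exact_mod_cast le_top)
  have h2 := (h'.contDiffOn.contDiffAt (hS.mem_nhds hu)).of_le (m := k) (by exact_mod_cast le_top)
  have h3 := iteratedFDeriv_add_apply h1 h2
  rw [show (fun u => T u + T' u) = T + T' from rfl, h3, add_mul]
  exact (norm_add_le _ _).trans (add_le_add (hC u hu) (hC' u hu))

theorem sub (hS : IsOpen S) {T' : E → F} (h : HasBoundedDerivs S w T)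
    (h' : HasBoundedDerivs S w T') : HasBoundedDerivs S w (fun u => T u - T' u) := by
  have := h.add hS (h'.clm_comp hS (-ContinuousLinearMap.id ℝ F))
  simpa [sub_eq_add_neg] using this

end HasBoundedDerivs

/-- A map that is smooth near a compact set has bounded derivatives on it. -/
theorem HasBoundedDerivs.of_compact {K U : Set E} (hU : IsOpen U) (hK : IsCompact K) (hKU : K ⊆ U)
    (hT : ContDiffOn ℝ ∞ T U) (hSK : S ⊆ K) : HasBoundedDerivs S (fun _ => 1) T := by
  refine ⟨hT.mono (hSK.trans hKU), fun k => ?_⟩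
  have hc : ContinuousOn (iteratedFDeriv ℝ k T) K := by
    have := hT.continuousOn_iteratedFDerivWithin (m := k) (by exact_mod_cast le_top)
      hU.uniqueDiffOn
    exact (this.congr fun u hu => (iteratedFDerivWithin_of_isOpen k hU hu).symm).mono hKU
  obtain ⟨C, hC⟩ := hK.exists_bound_of_continuousOn hc
  exact ⟨C, fun u hu => by simpa using hC u (hSK hu)⟩

variable (E F F₁ F₂) in
/-- The bilinear map `(A, D) ↦ (v ↦ A ∘ D v)`. -/
def postcompL : (F₁ →L[ℝ] F₂) →L[ℝ] (E →L[ℝ] F →L[ℝ] F₁) →L[ℝ] (E →L[ℝ] F →L[ℝ] F₂) :=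
  (ContinuousLinearMap.compL ℝ E (F →L[ℝ] F₁) (F →L[ℝ] F₂)) ∘L
    (ContinuousLinearMap.compL ℝ F F₁ F₂)

variable (E F F₁ F₂) in
/-- The bilinear map `(A, D) ↦ (v ↦ D v ∘ A)`. -/
def leftPostcompL : (F →L[ℝ] F₁) →L[ℝ] (E →L[ℝ] F₁ →L[ℝ] F₂) →L[ℝ] (E →L[ℝ] F →L[ℝ] F₂) :=
  (ContinuousLinearMap.compL ℝ E (F₁ →L[ℝ] F₂) (F →L[ℝ] F₂)) ∘L
    (ContinuousLinearMap.compL ℝ F F₁ F₂).flip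

@[simp] theorem postcompL_apply (A : F₁ →L[ℝ] F₂) (D : E →L[ℝ] F →L[ℝ] F₁) (v : E) (x : F) :
    postcompL E F F₁ F₂ A D v x = A (D v x) := rfl

@[simp] theorem leftPostcompL_apply (A : F →L[ℝ] F₁) (D : E →L[ℝ] F₁ →L[ℝ] F₂) (v : E) (x : F) :
    leftPostcompL E F F₁ F₂ A D v x = D v (A x) := rfl

/-- Meant for `A = h⁻¹` and `D = Dh`: the product `v ↦ A ∘ D v ∘ A` is then minus the derivative of
`h⁻¹`. -/
theorem DerivBoundedOn.sandwich (hS : IsOpen S) {A : E → F₁ →L[ℝ] F} {D : E → E →L[ℝ] F →L[ℝ] F₁}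
    (hA : ContDiffOn ℝ ∞ A S) (hD : ContDiffOn ℝ ∞ D S) {k : ℕ}
    (bA : ∀ j ≤ k, DerivBoundedOn S (fun _ => 1) A j)
    (bD : ∀ j ≤ k, DerivBoundedOn S w D j) :
    DerivBoundedOn S w
      (fun u => postcompL E F₁ F₁ F (A u) (leftPostcompL E F₁ F F₁ (A u) (D u))) k := by
  have h1 : ∀ j ≤ k, DerivBoundedOn S w (fun u => leftPostcompL E F₁ F F₁ (A u) (D u)) j :=
    fun j hj => DerivBoundedOn.bilinear (F := F₁ →L[ℝ] F) (F₁ := E →L[ℝ] F →L[ℝ] F₁)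
      (F₂ := E →L[ℝ] F₁ →L[ℝ] F₁) hS (leftPostcompL E F₁ F F₁) (f := A) (f' := D) hA hD
      (fun i hi => bA i (hi.trans hj)) fun i hi => bD i (hi.trans hj)
  have h2 : ContDiffOn ℝ ∞ (fun u => leftPostcompL E F₁ F F₁ (A u) (D u)) S :=
    contDiffOn_bilinear (F := F₁ →L[ℝ] F) (F₁ := E →L[ℝ] F →L[ℝ] F₁)
      (F₂ := E →L[ℝ] F₁ →L[ℝ] F₁) (leftPostcompL E F₁ F F₁) hA hD
  exact DerivBoundedOn.bilinear (F := F₁ →L[ℝ] F) (F₁ := E →L[ℝ] F₁ →L[ℝ] F₁)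
      (F₂ := E →L[ℝ] F₁ →L[ℝ] F) hS (postcompL E F₁ F₁ F) (f := A)
    (f' := fun u => leftPostcompL E F₁ F F₁ (A u) (D u)) hA h2 bA h1

end BoundedDerivatives

/-! ### Nondegenerate metrics in a vector space -/

section Metrics

variable {E : Type*} [NormedAddCommGroup E] [NormedSpace ℝ E] [FiniteDimensional ℝ E]

/-- `h` is a smooth metric on the open set `S`. -/
structure IsMetricOn (h : E → E →L[ℝ] E →L[ℝ] ℝ) (S : Set E) : Prop where
  isOpen : IsOpen S
  contDiffOn : ContDiffOn ℝ ∞ h S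
  symm : ∀ u ∈ S, ∀ v w, h u v w = h u w v
  pos : ∀ u ∈ S, ∀ v, v ≠ 0 → 0 < h u v v

theorem isInvertible_of_pos {B : E →L[ℝ] E →L[ℝ] ℝ} (hB : ∀ v, v ≠ 0 → 0 < B v v) :
    B.IsInvertible := by
  have hinj : Function.Injective (B : E →ₗ[ℝ] (E →L[ℝ] ℝ)) := by
    rw [injective_iff_map_eq_zero]
    intro v hv
    by_contra hne
    have h1 := hB v hne
    have h2 : B v = 0 := hv
    simp [h2] at h1
  have hdim : Module.finrank ℝ E = Module.finrank ℝ (E →L[ℝ] ℝ) := by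
    rw [← (LinearMap.toContinuousLinearMap (𝕜 := ℝ) (E := E) (F' := ℝ)).finrank_eq]
    exact (Subspace.dual_finrank_eq (K := ℝ) (V := E)).symm
  let e := LinearEquiv.ofInjectiveOfFinrankEq (B : E →ₗ[ℝ] (E →L[ℝ] ℝ)) hinj hdim
  refine ⟨e.toContinuousLinearEquiv, ?_⟩
  ext v w
  rfl

variable {h : E → E →L[ℝ] E →L[ℝ] ℝ} {S : Set E}

theorem IsMetricOn.isInvertible (hh : IsMetricOn h S) {u : E} (hu : u ∈ S) :
    (h u).IsInvertible :=
  isInvertible_of_pos (hh.pos u hu)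

theorem IsMetricOn.contDiffOn_inverse (hh : IsMetricOn h S) :
    ContDiffOn ℝ ∞ (fun u => (h u).inverse) S := fun u hu =>
  ((hh.isInvertible hu).contDiffAt_map_inverse).comp_contDiffWithinAt u (hh.contDiffOn u hu)

theorem IsMetricOn.apply_inverse (hh : IsMetricOn h S) {u : E} (hu : u ∈ S) (ξ : E →L[ℝ] ℝ) :
    h u ((h u).inverse ξ) = ξ := by
  obtain ⟨e, he⟩ := hh.isInvertible hu
  rw [← he]
  simp

theorem IsMetricOn.inverse_apply (hh : IsMetricOn h S) {u : E} (hu : u ∈ S) (v : E) :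
    (h u).inverse (h u v) = v := by
  obtain ⟨e, he⟩ := hh.isInvertible hu
  rw [← he]
  simp

theorem IsMetricOn.eq_of_forall (hh : IsMetricOn h S) {u : E} (hu : u ∈ S) {v w : E}
    (hvw : ∀ z, h u v z = h u w z) : v = w := by
  rw [← hh.inverse_apply hu v, ← hh.inverse_apply hu w, ContinuousLinearMap.ext hvw]

omit [FiniteDimensional ℝ E] in
theorem IsMetricOn.mono (hh : IsMetricOn h S) {S' : Set E} (hS' : IsOpen S') (hs : S' ⊆ S) :
    IsMetricOn h S' :=
  ⟨hS', hh.contDiffOn.mono hs, fun u hu => hh.symm u (hs hu), fun u hu => hh.pos u (hs hu)⟩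

/-- `D(h⁻¹) = - h⁻¹ ∘ Dh ∘ h⁻¹`. -/
theorem IsMetricOn.fderiv_inverse (hh : IsMetricOn h S) {u : E} (hu : u ∈ S) (v : E) :
    fderiv ℝ (fun y => (h y).inverse) u v =
      -((h u).inverse ∘L (fderiv ℝ h u v) ∘L (h u).inverse) := by
  have hn := hh.isOpen.mem_nhds hu
  have d1 := (hh.contDiffOn_inverse.contDiffAt hn).differentiableAt (by simp)
  have d2 := (hh.contDiffOn.contDiffAt hn).differentiableAt (by simp)
  have h1 : (fun y => (h y) ∘L (h y).inverse) =ᶠ[𝓝 u]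
      fun _ => ContinuousLinearMap.id ℝ (E →L[ℝ] ℝ) := by
    filter_upwards [hn] with y hy
    ext1 ξ
    exact hh.apply_inverse hy ξ
  have h2 := h1.fderiv_eq (𝕜 := ℝ)
  rw [fderiv_clm_comp d2 d1, fderiv_fun_const] at h2
  have h3 := fun ξ => congrArg (h u).inverse (DFunLike.congr_fun (DFunLike.congr_fun h2 v) ξ)
  ext1 ξ
  have h4 := h3 ξ
  simp [hh.inverse_apply hu] at h4
  simpa using eq_neg_of_add_eq_zero_left h4

/-- The inverse of a coercive metric with bounded derivatives has bounded derivatives. -/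
theorem HasBoundedDerivs.inverse (hh : IsMetricOn h S) (hb : HasBoundedDerivs S (fun _ => 1) h)
    {c : ℝ} (hc : 0 < c) (hcoer : ∀ u ∈ S, ∀ v, c * ‖v‖ ^ 2 ≤ h u v v) :
    HasBoundedDerivs S (fun _ => 1) (fun u => (h u).inverse) := by
  refine ⟨hh.contDiffOn_inverse, fun k => ?_⟩
  induction k using Nat.strong_induction_on with
  | _ k ih =>
  rcases k with _ | k
  -- With `v = h⁻¹ ξ`, coercivity gives `c‖v‖² ≤ h(v, v) = ξ v ≤ ‖ξ‖‖v‖`.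
  · refine ⟨c⁻¹, fun u hu => ?_⟩
    rw [norm_iteratedFDeriv_zero, mul_one]
    refine ContinuousLinearMap.opNorm_le_bound _ (by positivity) fun ξ => ?_
    set v := (h u).inverse ξ with hv
    have h1 : h u v v = ξ v := by rw [hv, hh.apply_inverse hu]
    have h2 := hcoer u hu v
    have h3 : ξ v ≤ ‖ξ‖ * ‖v‖ := (le_abs_self _).trans (ξ.le_opNorm v)
    rcases (norm_nonneg v).eq_or_lt with h0 | h0
    · rw [← h0]; positivity
    · rw [← div_eq_inv_mul, le_div_iff₀ hc]
      nlinarith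
  -- `D(h⁻¹) = -h⁻¹ ∘ Dh ∘ h⁻¹`, so order `k + 1` of `h⁻¹` is controlled by its orders up to `k` and
  -- the derivatives of `h`.
  · refine DerivBoundedOn.of_fderiv ?_
    have hinv : ∀ j ≤ k, DerivBoundedOn S (fun _ => 1) (fun u => (h u).inverse) j :=
      fun j hj => ih j (Nat.lt_succ_of_le hj)
    have hdh := hb.fderiv hh.isOpen
    refine (DerivBoundedOn.sandwich hh.isOpen hh.contDiffOn_inverse hdh.contDiffOn hinv
      fun j _ => hdh.bound j).neg.congr hh.isOpen fun u hu => ?_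
    ext1 v
    rw [hh.fderiv_inverse hu]
    rfl

end Metrics

/-! ### Covariant derivatives of smooth tensor fields -/

section CovariantDerivative

variable {E : Type*} [NormedAddCommGroup E] [NormedSpace ℝ E]
  {F : Type*} [NormedAddCommGroup F] [NormedSpace ℝ F]

variable (E) in
/-- The cyclic combination `(1/2) (A v w z + A w v z - A z v w)` of a trilinear form. -/
def koszulL : (E →L[ℝ] E →L[ℝ] E →L[ℝ] ℝ) →L[ℝ] (E →L[ℝ] E →L[ℝ] E →L[ℝ] ℝ) :=
  let fl : (E →L[ℝ] E →L[ℝ] (E →L[ℝ] ℝ)) →L[ℝ] (E →L[ℝ] E →L[ℝ] (E →L[ℝ] ℝ)) :=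
    (ContinuousLinearMap.flipₗᵢ ℝ E E (E →L[ℝ] ℝ)).toContinuousLinearEquiv
  let fl' : (E →L[ℝ] E →L[ℝ] ℝ) →L[ℝ] (E →L[ℝ] E →L[ℝ] ℝ) :=
    (ContinuousLinearMap.flipₗᵢ ℝ E E ℝ).toContinuousLinearEquiv
  (1 / 2 : ℝ) • (ContinuousLinearMap.id ℝ _ + fl -
    (ContinuousLinearMap.compL ℝ E (E →L[ℝ] E →L[ℝ] ℝ) (E →L[ℝ] E →L[ℝ] ℝ) fl') ∘L fl)

/-- The Christoffel symbols as bilinear maps. -/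
def christoffelL (h : E → E →L[ℝ] E →L[ℝ] ℝ) (u : E) : E →L[ℝ] E →L[ℝ] E :=
  postcompL E E (E →L[ℝ] ℝ) E (h u).inverse (koszulL E (fderiv ℝ h u))

theorem christoffelL_apply (h : E → E →L[ℝ] E →L[ℝ] ℝ) (u v w : E) :
    christoffelL h u v w = christoffel h u v w := rfl

variable (E F) in
/-- The derivation of tensors `(A, T) ↦ ∑ i, T(v₁, …, A v_i, …, v_m)`. -/
def derivationL (m : ℕ) : (E →L[ℝ] E) →L[ℝ] (E [×m]→L[ℝ] F) →L[ℝ] (E [×m]→L[ℝ] F) :=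
  ((ContinuousMultilinearMap.compContinuousLinearMapContinuousMultilinear ℝ
    (fun _ : Fin m => E) (fun _ : Fin m => E) F).linearDeriv
      (fun _ => ContinuousLinearMap.id ℝ E)) ∘L
    (ContinuousLinearMap.pi fun _ : Fin m => ContinuousLinearMap.id ℝ (E →L[ℝ] E))

/-- Precomposition in the `m` slots is multilinear in the `m` linear maps; `derivationL` is its
differential at `(id, …, id)` in the direction `(A, …, A)`, which produces one term for each slot.
-/
theorem derivationL_apply (m : ℕ) (A : E →L[ℝ] E) (T : E [×m]→L[ℝ] F) (v : Fin m → E) :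
    derivationL E F m A T v = ∑ i, T (Function.update v i (A (v i))) := by
  have h1 : derivationL E F m A = ∑ i : Fin m,
      ContinuousMultilinearMap.compContinuousLinearMapL (F := F)
        (Function.update (fun _ : Fin m => ContinuousLinearMap.id ℝ E) i A) := by
    rw [derivationL, ContinuousLinearMap.comp_apply, ContinuousMultilinearMap.linearDeriv_apply]
    rfl
  rw [h1, _root_.sum_apply, _root_.sum_apply]
  refine Finset.sum_congr rfl fun i _ => ?_
  rw [ContinuousMultilinearMap.compContinuousLinearMapL_apply,
    ContinuousMultilinearMap.compContinuousLinearMap_apply]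
  congr 1
  ext j
  rcases eq_or_ne j i with rfl | hj
  · simp
  · simp [Function.update_of_ne hj]

variable (E F) in
/-- Uncurrying of tensors, as a continuous linear map. -/
def uncurryL (m : ℕ) : (E →L[ℝ] (E [×m]→L[ℝ] F)) →L[ℝ] (E [×(m + 1)]→L[ℝ] F) :=
  ((continuousMultilinearCurryLeftEquiv ℝ (fun _ : Fin (m + 1) => E) F).symm :
    (E →L[ℝ] (E [×m]→L[ℝ] F)) ≃L[ℝ] (E [×(m + 1)]→L[ℝ] F))

theorem uncurryL_apply (m : ℕ) (A : E →L[ℝ] (E [×m]→L[ℝ] F)) (v : Fin (m + 1) → E) :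
    uncurryL E F m A v = A (v 0) (fun i => v i.succ) := rfl

/-- The covariant derivative of a smooth tensor field. -/
def nabla (h : E → E →L[ℝ] E →L[ℝ] ℝ) {m : ℕ} (T : E → E [×m]→L[ℝ] F) (u : E) :
    E [×(m + 1)]→L[ℝ] F :=
  uncurryL E F m (fderiv ℝ T u) -
    uncurryL E F m (((derivationL E F m) ∘L (christoffelL h u)).flip (T u))

theorem nabla_apply (h : E → E →L[ℝ] E →L[ℝ] ℝ) {m : ℕ} (T : E → E [×m]→L[ℝ] F) (u : E)
    (v : Fin (m + 1) → E) :
    nabla h T u v = fderiv ℝ T u (v 0) (fun i => v i.succ) - ∑ i : Fin m,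
      T u (Function.update (fun j => v j.succ) i (christoffel h u (v 0) (v i.succ))) := by
  rw [nabla, _root_.sub_apply, uncurryL_apply, uncurryL_apply,
    ContinuousLinearMap.flip_apply, ContinuousLinearMap.comp_apply, derivationL_apply]
  rfl

/-- Iterated covariant derivatives of smooth tensor fields. -/
def iterNabla (h : E → E →L[ℝ] E →L[ℝ] ℝ) {m : ℕ} (T : E → E [×m]→L[ℝ] F) :
    (k : ℕ) → E → E [×(m + k)]→L[ℝ] F
  | 0 => T
  | k + 1 => nabla h (iterNabla h T k)

variable [FiniteDimensional ℝ E] {h : E → E →L[ℝ] E →L[ℝ] ℝ} {S : Set E} {w : E → ℝ}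

theorem IsMetricOn.christoffelL_contDiffOn (hh : IsMetricOn h S) :
    ContDiffOn ℝ ∞ (christoffelL h) S := by
  have h1 : ContDiffOn ℝ ∞ (fun u => koszulL E (fderiv ℝ h u)) S :=
    (koszulL E).contDiff.comp_contDiffOn (hh.contDiffOn.fderiv_of_isOpen hh.isOpen (by simp))
  exact contDiffOn_bilinear (postcompL E E (E →L[ℝ] ℝ) E) hh.contDiffOn_inverse h1

theorem HasBoundedDerivs.christoffelL (hh : IsMetricOn h S)
    (hb : HasBoundedDerivs S (fun _ => 1) h) {c : ℝ} (hc : 0 < c)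
    (hcoer : ∀ u ∈ S, ∀ v, c * ‖v‖ ^ 2 ≤ h u v v) :
    HasBoundedDerivs S (fun _ => 1) (christoffelL h) := by
  have h1 : HasBoundedDerivs S (fun _ => 1) (fun u => koszulL E (_root_.fderiv ℝ h u)) :=
    (hb.fderiv hh.isOpen).clm_comp hh.isOpen (koszulL E)
  exact HasBoundedDerivs.bilinear hh.isOpen (postcompL E E (E →L[ℝ] ℝ) E)
    (HasBoundedDerivs.inverse hh hb hc hcoer) h1

variable (E F) in
/-- The bilinear map giving the zeroth order part of the covariant derivative. -/
def connectionL (m : ℕ) :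
    (E →L[ℝ] E →L[ℝ] E) →L[ℝ] (E [×m]→L[ℝ] F) →L[ℝ] (E [×(m + 1)]→L[ℝ] F) :=
  let fl : (E →L[ℝ] (E [×m]→L[ℝ] F) →L[ℝ] (E [×m]→L[ℝ] F)) →L[ℝ]
      ((E [×m]→L[ℝ] F) →L[ℝ] E →L[ℝ] (E [×m]→L[ℝ] F)) :=
    (ContinuousLinearMap.flipₗᵢ ℝ E (E [×m]→L[ℝ] F) (E [×m]→L[ℝ] F)).toContinuousLinearEquiv
  (ContinuousLinearMap.compL ℝ (E [×m]→L[ℝ] F) (E →L[ℝ] (E [×m]→L[ℝ] F)) (E [×(m + 1)]→L[ℝ] F)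
      (uncurryL E F m)) ∘L fl ∘L
    (ContinuousLinearMap.compL ℝ E (E →L[ℝ] E) ((E [×m]→L[ℝ] F) →L[ℝ] (E [×m]→L[ℝ] F))
      (derivationL E F m))

theorem IsMetricOn.nabla_contDiffOn (hh : IsMetricOn h S) {m : ℕ} {T : E → E [×m]→L[ℝ] F}
    (hT : ContDiffOn ℝ ∞ T S) : ContDiffOn ℝ ∞ (nabla h T) S := by
  have h1 : ContDiffOn ℝ ∞ (fun u => uncurryL E F m (fderiv ℝ T u)) S :=
    (uncurryL E F m).contDiff.comp_contDiffOn (hT.fderiv_of_isOpen hh.isOpen (by simp))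
  exact h1.sub (contDiffOn_bilinear (connectionL E F m) hh.christoffelL_contDiffOn hT)

/-- The weight `w` is preserved, because the Christoffel symbols have weight `1`. -/
theorem HasBoundedDerivs.nabla (hh : IsMetricOn h S)
    (hb : HasBoundedDerivs S (fun _ => 1) h) {c : ℝ} (hc : 0 < c)
    (hcoer : ∀ u ∈ S, ∀ v, c * ‖v‖ ^ 2 ≤ h u v v) {m : ℕ} {T : E → E [×m]→L[ℝ] F}
    (hT : HasBoundedDerivs S w T) : HasBoundedDerivs S w (nabla h T) :=
  ((hT.fderiv hh.isOpen).clm_comp hh.isOpen (uncurryL E F m)).sub hh.isOpen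
    (HasBoundedDerivs.bilinear hh.isOpen (connectionL E F m)
      (HasBoundedDerivs.christoffelL hh hb hc hcoer) hT)

theorem IsMetricOn.iterNabla_contDiffOn (hh : IsMetricOn h S) {m : ℕ} {T : E → E [×m]→L[ℝ] F}
    (hT : ContDiffOn ℝ ∞ T S) (k : ℕ) : ContDiffOn ℝ ∞ (iterNabla h T k) S := by
  induction k with
  | zero => exact hT
  | succ k ih => exact hh.nabla_contDiffOn ih

theorem HasBoundedDerivs.iterNabla (hh : IsMetricOn h S)
    (hb : HasBoundedDerivs S (fun _ => 1) h) {c : ℝ} (hc : 0 < c)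
    (hcoer : ∀ u ∈ S, ∀ v, c * ‖v‖ ^ 2 ≤ h u v v) {m : ℕ} {T : E → E [×m]→L[ℝ] F}
    (hT : HasBoundedDerivs S w T) (k : ℕ) : HasBoundedDerivs S w (iterNabla h T k) := by
  induction k with
  | zero => exact hT
  | succ k ih => exact HasBoundedDerivs.nabla hh hb hc hcoer ih

omit [FiniteDimensional ℝ E] in
theorem covDeriv_eq_nabla (hS : IsOpen S) {m : ℕ} {T : E → E [×m]→L[ℝ] F}
    (hT : ContDiffOn ℝ ∞ T S) {T' : E → (Fin m → E) → F} (hTT' : ∀ u ∈ S, T' u = T u) {u : E}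
    (hu : u ∈ S) : covDeriv h T' u = nabla h T u := by
  ext v
  have d := (hT.contDiffAt (hS.mem_nhds hu)).differentiableAt (by simp)
  have h1 : (fun y => T' y (fun i => v i.succ)) =ᶠ[𝓝 u] fun y => T y (fun i => v i.succ) := by
    filter_upwards [hS.mem_nhds hu] with y hy
    rw [hTT' y hy]
  rw [nabla_apply, covDeriv, h1.fderiv_eq, hTT' u hu,
    (d.hasFDerivAt.continuousMultilinear_apply_const _).fderiv]
  rfl

/-- Passage from the bare functions of vectors in the definitions to bundled multilinear maps, for
which operator norms and smoothness make sense. Agreement is needed on an open set, since each step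
differentiates. -/
theorem IsMetricOn.iterCovDeriv_eq (hh : IsMetricOn h S) {m : ℕ} {T : E → E [×m]→L[ℝ] F}
    (hT : ContDiffOn ℝ ∞ T S) {T' : E → (Fin m → E) → F} (hTT' : ∀ u ∈ S, T' u = T u) (k : ℕ)
    {u : E} (hu : u ∈ S) : iterCovDeriv h T' k u = iterNabla h T k u := by
  induction k generalizing u with
  | zero => exact hTT' u hu
  | succ k ih =>
    exact covDeriv_eq_nabla hh.isOpen (hh.iterNabla_contDiffOn hT k) (fun u hu => ih hu) hu

/-! ### The curvature tensor -/

/-- The part of the curvature that is not antisymmetrized: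
`(v, w, z) ↦ (D_v Γ)(w, z) + Γ(v, Γ(w, z))`. -/
def preCurvatureL (h : E → E →L[ℝ] E →L[ℝ] ℝ) (u : E) : E →L[ℝ] E →L[ℝ] E →L[ℝ] E :=
  fderiv ℝ (christoffelL h) u + leftPostcompL E E (E →L[ℝ] E) (E →L[ℝ] E) (christoffelL h u)
    ((ContinuousLinearMap.compL ℝ E E E) ∘L (christoffelL h u))

variable (E) in
/-- Turning trilinear maps with values in linear forms into tensors. -/
def uncurry₄L : (E →L[ℝ] E →L[ℝ] E →L[ℝ] E →L[ℝ] ℝ) →L[ℝ] (E [×4]→L[ℝ] ℝ) :=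
  let U1 : (E →L[ℝ] ℝ) →L[ℝ] (E [×1]→L[ℝ] ℝ) :=
    ((continuousMultilinearCurryFin1 ℝ E ℝ).symm : (E →L[ℝ] ℝ) ≃L[ℝ] (E [×1]→L[ℝ] ℝ))
  let U2 : (E →L[ℝ] E →L[ℝ] ℝ) →L[ℝ] (E [×2]→L[ℝ] ℝ) :=
    (uncurryL E ℝ 1) ∘L (ContinuousLinearMap.compL ℝ E (E →L[ℝ] ℝ) (E [×1]→L[ℝ] ℝ) U1)
  let U3 : (E →L[ℝ] E →L[ℝ] E →L[ℝ] ℝ) →L[ℝ] (E [×3]→L[ℝ] ℝ) :=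
    (uncurryL E ℝ 2) ∘L (ContinuousLinearMap.compL ℝ E (E →L[ℝ] E →L[ℝ] ℝ) (E [×2]→L[ℝ] ℝ) U2)
  (uncurryL E ℝ 3) ∘L
    (ContinuousLinearMap.compL ℝ E (E →L[ℝ] E →L[ℝ] E →L[ℝ] ℝ) (E [×3]→L[ℝ] ℝ) U3)

end CovariantDerivative

section Curvature

variable {E : Type*} [NormedAddCommGroup E] [NormedSpace ℝ E] [FiniteDimensional ℝ E]
  {h : E → E →L[ℝ] E →L[ℝ] ℝ} {S : Set E}

omit [FiniteDimensional ℝ E] in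
theorem preCurvatureL_apply (h : E → E →L[ℝ] E →L[ℝ] ℝ) (u v w z : E) :
    preCurvatureL h u v w z = fderiv ℝ (christoffelL h) u v w z +
      christoffelL h u v (christoffelL h u w z) := rfl

/-- The curvature as a trilinear map. -/
def curvatureL (h : E → E →L[ℝ] E →L[ℝ] ℝ) (u : E) : E →L[ℝ] E →L[ℝ] E →L[ℝ] E :=
  preCurvatureL h u - (preCurvatureL h u).flip

omit [FiniteDimensional ℝ E] in
theorem curvatureL_apply (h : E → E →L[ℝ] E →L[ℝ] ℝ) (u v w z : E) :
    curvatureL h u v w z = preCurvatureL h u v w z - preCurvatureL h u w v z := rfl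

variable (E) in
/-- Lowering the index of a trilinear map. -/
def lowerL (F F₁ : Type*) [NormedAddCommGroup F] [NormedSpace ℝ F] [NormedAddCommGroup F₁]
    [NormedSpace ℝ F₁] : (F →L[ℝ] F₁) →L[ℝ] (E →L[ℝ] E →L[ℝ] E →L[ℝ] F) →L[ℝ]
    (E →L[ℝ] E →L[ℝ] E →L[ℝ] F₁) :=
  (postcompL E E (E →L[ℝ] F) (E →L[ℝ] F₁)) ∘L (ContinuousLinearMap.compL ℝ E F F₁)

/-- The Riemann curvature tensor as a multilinear map. -/
def curvatureTensorL (h : E → E →L[ℝ] E →L[ℝ] ℝ) (u : E) : E [×4]→L[ℝ] ℝ :=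
  uncurry₄L E (lowerL E E (E →L[ℝ] ℝ) (h u) (curvatureL h u))

omit [FiniteDimensional ℝ E] in
theorem curvatureTensorL_apply (h : E → E →L[ℝ] E →L[ℝ] ℝ) (u : E) (v : Fin 4 → E) :
    curvatureTensorL h u v = h u (curvatureL h u (v 0) (v 1) (v 2)) (v 3) := rfl

theorem IsMetricOn.curvature_eq (hh : IsMetricOn h S) {u : E} (hu : u ∈ S) (v w z : E) :
    curvature h u v w z = curvatureL h u v w z := by
  have d := (hh.christoffelL_contDiffOn.contDiffAt (hh.isOpen.mem_nhds hu)).differentiableAt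
    (by simp)
  have key : ∀ a b c : E, fderiv ℝ (fun y => christoffel h y b c) u a =
      fderiv ℝ (christoffelL h) u a b c := by
    intro a b c
    have h1 := (d.hasFDerivAt.clm_apply (hasFDerivAt_const b u)).clm_apply (hasFDerivAt_const c u)
    have h2 := h1.fderiv
    change fderiv ℝ (fun y => christoffel h y b c) u = _ at h2
    rw [h2]
    simp
  rw [curvature, key, key, curvatureL_apply, preCurvatureL_apply, preCurvatureL_apply]
  simp only [christoffelL_apply]
  abel

theorem IsMetricOn.curvatureTensor_eq (hh : IsMetricOn h S) {u : E} (hu : u ∈ S) :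
    curvatureTensor h u = curvatureTensorL h u := by
  ext v
  rw [curvatureTensor, hh.curvature_eq hu, curvatureTensorL_apply]

variable (E) in
/-- Antisymmetrization in the first two variables. -/
def antisymmL : (E →L[ℝ] E →L[ℝ] E →L[ℝ] E) →L[ℝ] (E →L[ℝ] E →L[ℝ] E →L[ℝ] E) :=
  let fl : (E →L[ℝ] E →L[ℝ] (E →L[ℝ] E)) →L[ℝ] (E →L[ℝ] E →L[ℝ] (E →L[ℝ] E)) :=
    (ContinuousLinearMap.flipₗᵢ ℝ E E (E →L[ℝ] E)).toContinuousLinearEquiv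
  ContinuousLinearMap.id ℝ _ - fl

set_option maxHeartbeats 1000000 in
theorem IsMetricOn.curvatureTensorL_contDiffOn (hh : IsMetricOn h S) :
    ContDiffOn ℝ ∞ (curvatureTensorL h) S := by
  have hΓ := hh.christoffelL_contDiffOn
  have h1 : ContDiffOn ℝ ∞ (fun u => (ContinuousLinearMap.compL ℝ E E E) ∘L (christoffelL h u)) S :=
    (ContinuousLinearMap.compL ℝ E (E →L[ℝ] E) ((E →L[ℝ] E) →L[ℝ] (E →L[ℝ] E))
      (ContinuousLinearMap.compL ℝ E E E)).contDiff.comp_contDiffOn hΓ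
  have h2 : ContDiffOn ℝ ∞ (preCurvatureL h) S :=
    (hΓ.fderiv_of_isOpen hh.isOpen (by simp)).add
      (contDiffOn_bilinear (leftPostcompL E E (E →L[ℝ] E) (E →L[ℝ] E)) hΓ h1)
  have h3 : ContDiffOn ℝ ∞ (curvatureL h) S := (antisymmL E).contDiff.comp_contDiffOn h2
  exact (uncurry₄L E).contDiff.comp_contDiffOn
    (contDiffOn_bilinear (lowerL E E (E →L[ℝ] ℝ)) hh.contDiffOn h3)

set_option maxHeartbeats 1000000 in
theorem HasBoundedDerivs.curvatureTensorL (hh : IsMetricOn h S)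
    (hb : HasBoundedDerivs S (fun _ => 1) h) {c : ℝ} (hc : 0 < c)
    (hcoer : ∀ u ∈ S, ∀ v, c * ‖v‖ ^ 2 ≤ h u v v) :
    HasBoundedDerivs S (fun _ => 1) (curvatureTensorL h) := by
  have hΓ := HasBoundedDerivs.christoffelL hh hb hc hcoer
  have h1 : HasBoundedDerivs S (fun _ => 1)
      (fun u => (ContinuousLinearMap.compL ℝ E E E) ∘L (_root_.christoffelL h u)) :=
    hΓ.clm_comp hh.isOpen
      (ContinuousLinearMap.compL ℝ E (E →L[ℝ] E) ((E →L[ℝ] E) →L[ℝ] (E →L[ℝ] E))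
        (ContinuousLinearMap.compL ℝ E E E))
  have h2 : HasBoundedDerivs S (fun _ => 1) (preCurvatureL h) :=
    (hΓ.fderiv hh.isOpen).add hh.isOpen
      (HasBoundedDerivs.bilinear hh.isOpen (leftPostcompL E E (E →L[ℝ] E) (E →L[ℝ] E)) hΓ h1)
  have h3 : HasBoundedDerivs S (fun _ => 1) (curvatureL h) := h2.clm_comp hh.isOpen (antisymmL E)
  exact (HasBoundedDerivs.bilinear hh.isOpen (lowerL E E (E →L[ℝ] ℝ)) hb h3).clm_comp hh.isOpen (uncurry₄L E)

end Curvature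

/-! ### Naturality under local isometries -/

section Naturality

variable {E : Type*} [NormedAddCommGroup E] [NormedSpace ℝ E]
  {F : Type*} [NormedAddCommGroup F] [NormedSpace ℝ F]

/-- `φ` is a smooth map from `S'` to `S` with `h' = φ^* h`. -/
structure IsPullbackOn (φ : E → E) (h' h : E → E →L[ℝ] E →L[ℝ] ℝ) (S' S : Set E) : Prop where
  contDiffOn : ContDiffOn ℝ ∞ φ S'
  mapsTo : MapsTo φ S' S
  eq : ∀ u ∈ S', ∀ v w, h' u v w = h (φ u) (fderiv ℝ φ u v) (fderiv ℝ φ u w)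

variable {φ : E → E} {h' h : E → E →L[ℝ] E →L[ℝ] ℝ} {S' S : Set E}

theorem IsPullbackOn.contDiffAt (hφ : IsPullbackOn φ h' h S' S) (hS' : IsOpen S') {u : E}
    (hu : u ∈ S') : ContDiffAt ℝ ∞ φ u :=
  hφ.contDiffOn.contDiffAt (hS'.mem_nhds hu)

theorem IsPullbackOn.hasFDerivAt (hφ : IsPullbackOn φ h' h S' S) (hS' : IsOpen S') {u : E}
    (hu : u ∈ S') : HasFDerivAt φ (fderiv ℝ φ u) u :=
  ((hφ.contDiffAt hS' hu).differentiableAt (by simp)).hasFDerivAt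

theorem IsPullbackOn.hasFDerivAt_fderiv (hφ : IsPullbackOn φ h' h S' S) (hS' : IsOpen S') {u : E}
    (hu : u ∈ S') : HasFDerivAt (fderiv ℝ φ) (fderiv ℝ (fderiv ℝ φ) u) u :=
  (((hφ.contDiffAt hS' hu).fderiv_right (m := 1) (by norm_cast)).differentiableAt
    (by simp)).hasFDerivAt

theorem IsPullbackOn.symm_fderiv (hφ : IsPullbackOn φ h' h S' S) (hS' : IsOpen S') {u : E}
    (hu : u ∈ S') (v w : E) :
    fderiv ℝ (fderiv ℝ φ) u v w = fderiv ℝ (fderiv ℝ φ) u w v :=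
  (hφ.contDiffAt hS' hu).isSymmSndFDerivAt (by simp; norm_cast) v w

variable [FiniteDimensional ℝ E]

/-- A vector killed by `Dφ` would be null for the positive definite `h' = φ^* h`; equal finite
dimensions do the rest. -/
theorem IsPullbackOn.bijective (hφ : IsPullbackOn φ h' h S' S) (hh' : IsMetricOn h' S')
    {u : E} (hu : u ∈ S') : Function.Bijective (fderiv ℝ φ u) := by
  have hinj : Function.Injective (fderiv ℝ φ u) := by
    rw [injective_iff_map_eq_zero]
    intro v hv
    by_contra hne
    have := hh'.pos u hu v hne
    rw [hφ.eq u hu, hv] at this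
    simp at this
  exact ⟨hinj, (LinearMap.injective_iff_surjective (f := (fderiv ℝ φ u : E →ₗ[ℝ] E))).1 hinj⟩

theorem IsMetricOn.apply_christoffel (hh : IsMetricOn h S) {u : E} (hu : u ∈ S) (v w z : E) :
    h u (christoffel h u v w) z =
      1 / 2 * (fderiv ℝ h u v w z + fderiv ℝ h u w v z - fderiv ℝ h u z v w) := by
  rw [christoffel, hh.apply_inverse hu]
  rfl

omit [FiniteDimensional ℝ E] in
theorem IsMetricOn.symm_fderiv (hh : IsMetricOn h S) {u : E} (hu : u ∈ S) (a b c : E) :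
    fderiv ℝ h u a b c = fderiv ℝ h u a c b := by
  have d := ((hh.contDiffOn.contDiffAt (hh.isOpen.mem_nhds hu)).differentiableAt
    (by simp)).hasFDerivAt
  have h1 := (d.clm_apply (hasFDerivAt_const b u)).clm_apply (hasFDerivAt_const c u)
  have h2 := (d.clm_apply (hasFDerivAt_const c u)).clm_apply (hasFDerivAt_const b u)
  have h3 : (fun y => h y b c) =ᶠ[𝓝 u] fun y => h y c b := by
    filter_upwards [hh.isOpen.mem_nhds hu] with y hy using hh.symm y hy b c
  have h4 := DFunLike.congr_fun ((h1.congr_of_eventuallyEq h3.symm).unique h2) a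
  simpa using h4

omit [FiniteDimensional ℝ E] in
theorem IsPullbackOn.fderiv_metric (hφ : IsPullbackOn φ h' h S' S) (hh : IsMetricOn h S)
    (hh' : IsMetricOn h' S') {u : E} (hu : u ∈ S') (a b c : E) :
    fderiv ℝ h' u a b c =
      fderiv ℝ h (φ u) (fderiv ℝ φ u a) (fderiv ℝ φ u b) (fderiv ℝ φ u c) +
      h (φ u) (fderiv ℝ (fderiv ℝ φ) u a b) (fderiv ℝ φ u c) +
      h (φ u) (fderiv ℝ φ u b) (fderiv ℝ (fderiv ℝ φ) u a c) := by
  have d := ((hh.contDiffOn.contDiffAt (hh.isOpen.mem_nhds (hφ.mapsTo hu))).differentiableAt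
    (by simp)).hasFDerivAt
  have d' := ((hh'.contDiffOn.contDiffAt (hh'.isOpen.mem_nhds hu)).differentiableAt
    (by simp)).hasFDerivAt
  have h1 := (d'.clm_apply (hasFDerivAt_const b u)).clm_apply (hasFDerivAt_const c u)
  have dφ := hφ.hasFDerivAt hh'.isOpen hu
  have dφ' := hφ.hasFDerivAt_fderiv hh'.isOpen hu
  have h2 := ((d.comp u dφ).clm_apply (dφ'.clm_apply (hasFDerivAt_const b u))).clm_apply
    (dφ'.clm_apply (hasFDerivAt_const c u))
  have h3 : (fun y => h' y b c) =ᶠ[𝓝 u]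
      fun y => h (φ y) (fderiv ℝ φ y b) (fderiv ℝ φ y c) := by
    filter_upwards [hh'.isOpen.mem_nhds hu] with y hy using hφ.eq y hy b c
  have h4 := DFunLike.congr_fun ((h1.congr_of_eventuallyEq h3.symm).unique h2) a
  simp at h4
  rw [h4]
  ring

/-- The transformation law of the Christoffel symbols. -/
theorem IsPullbackOn.christoffel (hφ : IsPullbackOn φ h' h S' S) (hh : IsMetricOn h S)
    (hh' : IsMetricOn h' S') {u : E} (hu : u ∈ S') (v w : E) :
    fderiv ℝ φ u (christoffel h' u v w) =
      christoffel h (φ u) (fderiv ℝ φ u v) (fderiv ℝ φ u w) +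
        fderiv ℝ (fderiv ℝ φ) u v w := by
  refine hh.eq_of_forall (hφ.mapsTo hu) fun z' => ?_
  -- As `Dφ` is onto, it is enough to test against vectors `Dφ z`, where `h' = φ^* h` and its
  -- differentiated form apply.
  obtain ⟨z, rfl⟩ := (hφ.bijective hh' hu).2 z'
  rw [← hφ.eq u hu, hh'.apply_christoffel hu, map_add, _root_.add_apply,
    hh.apply_christoffel (hφ.mapsTo hu), hφ.fderiv_metric hh hh' hu, hφ.fderiv_metric hh hh' hu,
    hφ.fderiv_metric hh hh' hu, hφ.symm_fderiv hh'.isOpen hu w v,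
    hφ.symm_fderiv hh'.isOpen hu z v, hφ.symm_fderiv hh'.isOpen hu z w,
    hh.symm _ (hφ.mapsTo hu) (fderiv ℝ φ u w) (fderiv ℝ (fderiv ℝ φ) u v z),
    hh.symm _ (hφ.mapsTo hu) (fderiv ℝ φ u v) (fderiv ℝ (fderiv ℝ φ) u w z)]
  ring

/-- Covariant derivatives are natural. -/
theorem IsPullbackOn.nabla (hφ : IsPullbackOn φ h' h S' S) (hh : IsMetricOn h S)
    (hh' : IsMetricOn h' S') {m : ℕ} {T T' : E → E [×m]→L[ℝ] F} (hT : ContDiffOn ℝ ∞ T S)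
    (hT' : ContDiffOn ℝ ∞ T' S')
    (hTT' : ∀ u ∈ S', T' u = (T (φ u)).compContinuousLinearMap fun _ => fderiv ℝ φ u) {u : E}
    (hu : u ∈ S') :
    nabla h' T' u = (nabla h T (φ u)).compContinuousLinearMap fun _ => fderiv ℝ φ u := by
  ext v
  have d := ((hT.contDiffAt (hh.isOpen.mem_nhds (hφ.mapsTo hu))).differentiableAt
    (by simp)).hasFDerivAt
  have d' := ((hT'.contDiffAt (hh'.isOpen.mem_nhds hu)).differentiableAt (by simp)).hasFDerivAt
  have dφ := hφ.hasFDerivAt hh'.isOpen hu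
  have dφ' := hφ.hasFDerivAt_fderiv hh'.isOpen hu
  have h1 := d'.continuousMultilinear_apply_const (fun i => v i.succ)
  have h2 := (d.comp u dφ).continuousMultilinearMap_apply
    (g := fun (i : Fin m) y => fderiv ℝ φ y (v i.succ))
    (fun i => dφ'.clm_apply (hasFDerivAt_const (v i.succ) u))
  have h3 : (fun y => T' y (fun i => v i.succ)) =ᶠ[𝓝 u]
      fun y => T (φ y) (fun i => fderiv ℝ φ y (v i.succ)) := by
    filter_upwards [hh'.isOpen.mem_nhds hu] with y hy
    rw [hTT' y hy]
    rfl
  have h4 := DFunLike.congr_fun ((h1.congr_of_eventuallyEq h3.symm).unique h2) (v 0)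
  have h5 : fderiv ℝ T' u (v 0) (fun i => v i.succ) =
      fderiv ℝ T (φ u) (fderiv ℝ φ u (v 0)) (fun i => fderiv ℝ φ u (v i.succ)) +
      ∑ i, T (φ u) (Function.update (fun i => fderiv ℝ φ u (v i.succ)) i
        (fderiv ℝ (fderiv ℝ φ) u (v 0) (v i.succ))) := by
    simpa [_root_.sum_apply] using h4
  rw [nabla_apply, ContinuousMultilinearMap.compContinuousLinearMap_apply, nabla_apply, h5]
  have h6 : ∀ i : Fin m,
      T' u (Function.update (fun j => v j.succ) i (_root_.christoffel h' u (v 0) (v i.succ))) =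
      T (φ u) (Function.update (fun j => fderiv ℝ φ u (v j.succ)) i
        (_root_.christoffel h (φ u) (fderiv ℝ φ u (v 0)) (fderiv ℝ φ u (v i.succ)))) +
      T (φ u) (Function.update (fun i => fderiv ℝ φ u (v i.succ)) i
        (fderiv ℝ (fderiv ℝ φ) u (v 0) (v i.succ))) := by
    intro i
    rw [hTT' u hu, ContinuousMultilinearMap.compContinuousLinearMap_apply,
      ← ContinuousMultilinearMap.map_update_add, ← hφ.christoffel hh hh' hu]
    congr 1
    ext j
    rcases eq_or_ne j i with rfl | hj
    · simp
    · simp [Function.update_of_ne hj]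
  rw [Finset.sum_congr rfl fun i _ => h6 i, Finset.sum_add_distrib]
  abel

theorem IsPullbackOn.iterNabla (hφ : IsPullbackOn φ h' h S' S) (hh : IsMetricOn h S)
    (hh' : IsMetricOn h' S') {m : ℕ} {T T' : E → E [×m]→L[ℝ] F} (hT : ContDiffOn ℝ ∞ T S)
    (hT' : ContDiffOn ℝ ∞ T' S')
    (hTT' : ∀ u ∈ S', T' u = (T (φ u)).compContinuousLinearMap fun _ => fderiv ℝ φ u) (k : ℕ)
    {u : E} (hu : u ∈ S') :
    iterNabla h' T' k u = (iterNabla h T k (φ u)).compContinuousLinearMap fun _ => fderiv ℝ φ u := by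
  induction k generalizing u with
  | zero => exact hTT' u hu
  | succ k ih =>
    exact hφ.nabla hh hh' (hh.iterNabla_contDiffOn hT k) (hh'.iterNabla_contDiffOn hT' k)
      (fun u hu => ih hu) hu

/-- The curvature is natural. -/
theorem IsPullbackOn.curvatureL (hφ : IsPullbackOn φ h' h S' S) (hh : IsMetricOn h S)
    (hh' : IsMetricOn h' S') {u : E} (hu : u ∈ S') (v w z : E) :
    fderiv ℝ φ u (curvatureL h' u v w z) =
      curvatureL h (φ u) (fderiv ℝ φ u v) (fderiv ℝ φ u w) (fderiv ℝ φ u z) := by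
  have dΓ := ((hh.christoffelL_contDiffOn.contDiffAt
    (hh.isOpen.mem_nhds (hφ.mapsTo hu))).differentiableAt (by simp)).hasFDerivAt
  have dΓ' := ((hh'.christoffelL_contDiffOn.contDiffAt
    (hh'.isOpen.mem_nhds hu)).differentiableAt (by simp)).hasFDerivAt
  have dφ := hφ.hasFDerivAt hh'.isOpen hu
  have dφ' := hφ.hasFDerivAt_fderiv hh'.isOpen hu
  have cφ' : ContDiffAt ℝ 2 (fderiv ℝ φ) u :=
    (hφ.contDiffAt hh'.isOpen hu).fderiv_right (by norm_cast)
  have dφ'' : HasFDerivAt (fderiv ℝ (fderiv ℝ φ)) (fderiv ℝ (fderiv ℝ (fderiv ℝ φ)) u) u :=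
    ((cφ'.fderiv_right (m := 1) (by norm_num)).differentiableAt (by simp)).hasFDerivAt
  -- The transformation law of the Christoffel symbols, differentiated in the direction `a`. After
  -- antisymmetrization the terms with `D³φ` and `D²φ(v, w)` drop out by symmetry, and the other
  -- terms with `D²φ` cancel against those produced by the quadratic part of the curvature.
  have key : ∀ a b : E, fderiv ℝ (fderiv ℝ φ) u a (christoffelL h' u b z) +
      fderiv ℝ φ u (fderiv ℝ (christoffelL h') u a b z) =
      fderiv ℝ (christoffelL h) (φ u) (fderiv ℝ φ u a) (fderiv ℝ φ u b) (fderiv ℝ φ u z) +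
      christoffelL h (φ u) (fderiv ℝ (fderiv ℝ φ) u a b) (fderiv ℝ φ u z) +
      christoffelL h (φ u) (fderiv ℝ φ u b) (fderiv ℝ (fderiv ℝ φ) u a z) +
      fderiv ℝ (fderiv ℝ (fderiv ℝ φ)) u a b z := by
    intro a b
    have h1 := dφ'.clm_apply ((dΓ'.clm_apply (hasFDerivAt_const b u)).clm_apply
      (hasFDerivAt_const z u))
    have h2 := (((dΓ.comp u dφ).clm_apply (dφ'.clm_apply (hasFDerivAt_const b u))).clm_apply
      (dφ'.clm_apply (hasFDerivAt_const z u))).add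
      ((dφ''.clm_apply (hasFDerivAt_const b u)).clm_apply (hasFDerivAt_const z u))
    have h3 : (fun y => fderiv ℝ φ y (christoffelL h' y b z)) =ᶠ[𝓝 u]
        fun y => christoffelL h (φ y) (fderiv ℝ φ y b) (fderiv ℝ φ y z) +
          fderiv ℝ (fderiv ℝ φ) y b z := by
      filter_upwards [hh'.isOpen.mem_nhds hu] with y hy using hφ.christoffel hh hh' hy b z
    have h4 := DFunLike.congr_fun ((h1.congr_of_eventuallyEq h3.symm).unique h2) a
    simp at h4
    rw [add_comm, h4]
    abel
  have hs : fderiv ℝ (fderiv ℝ (fderiv ℝ φ)) u v w z = fderiv ℝ (fderiv ℝ (fderiv ℝ φ)) u w v z := by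
    rw [cφ'.isSymmSndFDerivAt (by simp) v w]
  have hΓ : ∀ a b : E, fderiv ℝ φ u (christoffelL h' u a b) =
      christoffelL h (φ u) (fderiv ℝ φ u a) (fderiv ℝ φ u b) + fderiv ℝ (fderiv ℝ φ) u a b :=
    fun a b => hφ.christoffel hh hh' hu a b
  have k1 := key v w
  have k2 := key w v
  rw [hφ.symm_fderiv hh'.isOpen hu w v, ← hs] at k2
  simp only [curvatureL_apply, preCurvatureL_apply, map_sub, map_add, hΓ]
  rw [eq_sub_of_add_eq' k1, eq_sub_of_add_eq' k2]
  abel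

theorem IsPullbackOn.curvatureTensorL (hφ : IsPullbackOn φ h' h S' S) (hh : IsMetricOn h S)
    (hh' : IsMetricOn h' S') {u : E} (hu : u ∈ S') :
    curvatureTensorL h' u =
      (curvatureTensorL h (φ u)).compContinuousLinearMap fun _ => fderiv ℝ φ u := by
  ext v
  rw [curvatureTensorL_apply, ContinuousMultilinearMap.compContinuousLinearMap_apply,
    curvatureTensorL_apply, hφ.eq u hu, hφ.curvatureL hh hh' hu]

end Naturality

/-! ### Orthonormal frames and norms of tensors -/

section TensorNorm

variable {E : Type*} [NormedAddCommGroup E] [NormedSpace ℝ E]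
  {F : Type*} [NormedAddCommGroup F] [NormedSpace ℝ F]
  {B B' : E →L[ℝ] E →L[ℝ] ℝ} {e : Fin (Module.finrank ℝ E) → E}

theorem IsOrthonormalFrame.norm_le (he : IsOrthonormalFrame B e) {c : ℝ} (hc : 0 < c)
    (hcoer : ∀ v, c * ‖v‖ ^ 2 ≤ B v v) (i : Fin (Module.finrank ℝ E)) :
    ‖e i‖ ≤ √c⁻¹ := by
  refine Real.le_sqrt_of_sq_le ?_
  have h1 := hcoer (e i)
  rw [he i i, if_pos rfl] at h1
  rwa [← one_div, le_div_iff₀ hc, mul_comm]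

theorem IsOrthonormalFrame.sqrt_sum_le (he : IsOrthonormalFrame B e) {c : ℝ} (hc : 0 < c)
    (hcoer : ∀ v, c * ‖v‖ ^ 2 ≤ B v v) {m : ℕ} (t : E [×m]→L[ℝ] F) :
    √(∑ I : Fin m → Fin (Module.finrank ℝ E), ‖t (fun a => e (I a))‖ ^ 2) ≤
      √(Fintype.card (Fin m → Fin (Module.finrank ℝ E))) * √c⁻¹ ^ m * ‖t‖ := by
  have h1 : ∀ I : Fin m → Fin (Module.finrank ℝ E),
      ‖t (fun a => e (I a))‖ ^ 2 ≤ (√c⁻¹ ^ m * ‖t‖) ^ 2 := by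
    intro I
    gcongr
    refine (t.le_opNorm _).trans ?_
    rw [mul_comm]
    gcongr
    calc ∏ a, ‖e (I a)‖ ≤ ∏ _a : Fin m, √c⁻¹ :=
          Finset.prod_le_prod (fun _ _ => norm_nonneg _) fun a _ => he.norm_le hc hcoer (I a)
      _ = √c⁻¹ ^ m := by simp
  calc √(∑ I : Fin m → Fin (Module.finrank ℝ E), ‖t (fun a => e (I a))‖ ^ 2)
      ≤ √(∑ _I : Fin m → Fin (Module.finrank ℝ E), (√c⁻¹ ^ m * ‖t‖) ^ 2) :=
        Real.sqrt_le_sqrt (Finset.sum_le_sum fun I _ => h1 I)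
    _ = _ := by
        rw [Finset.sum_const, nsmul_eq_mul, Real.sqrt_mul (by positivity),
          Real.sqrt_sq (by positivity), Finset.card_univ, mul_assoc]

/-- By coercivity the vectors of an orthonormal frame have norm at most `c^{-1/2}`, so each
component is at most `c^{-m/2}‖t‖`. -/
theorem tensorNorm_le {c : ℝ} (hc : 0 < c) (hcoer : ∀ v, c * ‖v‖ ^ 2 ≤ B v v) {m : ℕ}
    (t : E [×m]→L[ℝ] F) : tensorNorm B t ≤
      √(Fintype.card (Fin m → Fin (Module.finrank ℝ E))) * √c⁻¹ ^ m * ‖t‖ :=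
  Real.iSup_le (fun e => e.2.sqrt_sum_le hc hcoer t) (by positivity)

/-- Coercivity serves to bound the family: a real supremum over an unbounded family would have the
default value `0`. -/
theorem IsOrthonormalFrame.le_tensorNorm (he : IsOrthonormalFrame B e) {c : ℝ} (hc : 0 < c)
    (hcoer : ∀ v, c * ‖v‖ ^ 2 ≤ B v v) {m : ℕ} (t : E [×m]→L[ℝ] F) :
    √(∑ I : Fin m → Fin (Module.finrank ℝ E), ‖t (fun a => e (I a))‖ ^ 2) ≤ tensorNorm B t :=
  le_ciSup (f := fun e : {e : Fin (Module.finrank ℝ E) → E // IsOrthonormalFrame B e} =>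
      √(∑ I : Fin m → Fin (Module.finrank ℝ E), ‖t (fun a => e.1 (I a))‖ ^ 2))
    ⟨_, by rintro _ ⟨e', rfl⟩; exact e'.2.sqrt_sum_le hc hcoer t⟩ ⟨e, he⟩

omit [NormedSpace ℝ F] in
/-- Norms of tensors are natural under linear isometries. -/
theorem tensorNorm_comp (D : E ≃ₗ[ℝ] E) (hD : ∀ v w, B' v w = B (D v) (D w)) {m : ℕ}
    {t t' : (Fin m → E) → F} (ht : ∀ v, t' v = t fun i => D (v i)) :
    tensorNorm B' t' = tensorNorm B t := by
  let φ : {e : Fin (Module.finrank ℝ E) → E // IsOrthonormalFrame B' e} ≃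
      {e : Fin (Module.finrank ℝ E) → E // IsOrthonormalFrame B e} :=
    (Equiv.piCongrRight fun _ => D.toEquiv).subtypeEquiv fun e => by
      simp [IsOrthonormalFrame, hD]
  refine Equiv.iSup_congr φ fun e => ?_
  simp only [ht]
  rfl

variable [FiniteDimensional ℝ E]

/-- Positive definite forms have orthonormal frames. -/
theorem exists_isOrthonormalFrame (hs : ∀ v w, B v w = B w v) (hB : ∀ v, v ≠ 0 → 0 < B v v) :
    ∃ e : Fin (Module.finrank ℝ E) → E, IsOrthonormalFrame B e := by
  let b : LinearMap.BilinForm ℝ E := LinearMap.mk₂ ℝ (fun v w => B v w) (by simp) (by simp)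
    (by simp) (by simp)
  have hb : LinearMap.IsSymm b := ⟨fun v w => hs v w⟩
  obtain ⟨v, hv⟩ := LinearMap.BilinForm.exists_orthogonal_basis hb
  have hpos : ∀ i, 0 < B (v i) (v i) := fun i => hB _ (v.ne_zero i)
  refine ⟨fun i => (√(B (v i) (v i)))⁻¹ • v i, fun i j => ?_⟩
  simp only [map_smul, _root_.smul_apply, smul_eq_mul]
  split_ifs with hij
  · subst hij
    have h1 := Real.mul_self_sqrt (hpos i).le
    have h2 : √(B (v i) (v i)) ≠ 0 := (Real.sqrt_pos.2 (hpos i)).ne'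
    field_simp
    nlinarith
  · have : B (v i) (v j) = 0 := hv hij
    simp [this]

omit [FiniteDimensional ℝ E] in
theorem IsOrthonormalFrame.linearIndependent (he : IsOrthonormalFrame B e) :
    LinearIndependent ℝ e := by
  rw [Fintype.linearIndependent_iff]
  intro a ha i
  have h1 : B (∑ j, a j • e j) (e i) = a i := by
    simp [map_sum, _root_.sum_apply, he _ _]
  rw [← h1, ha]
  simp

theorem IsOrthonormalFrame.exists_coords (he : IsOrthonormalFrame B e) (v : E) :
    ∃ a : Fin (Module.finrank ℝ E) → ℝ, v = ∑ i, a i • e i ∧ B v v = ∑ i, a i ^ 2 := by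
  have hspan := he.linearIndependent.span_eq_top_of_card_eq_finrank' (by simp)
  obtain ⟨a, ha⟩ := (Submodule.mem_span_range_iff_exists_fun ℝ).1
    (hspan ▸ Submodule.mem_top : v ∈ Submodule.span ℝ (range e))
  refine ⟨a, ha.symm, ?_⟩
  rw [← ha]
  simp [map_sum, _root_.sum_apply, he _ _, sq]

/-- The norm of a linear form is at least its values on unit vectors. -/
theorem norm_apply_le_tensorNorm (hs : ∀ v w, B v w = B w v) {c : ℝ} (hc : 0 < c)
    (hcoer : ∀ v, c * ‖v‖ ^ 2 ≤ B v v) (t : E [×1]→L[ℝ] F) (v : E) :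
    ‖t (fun _ => v)‖ ≤ tensorNorm B t * √(B v v) := by
  have hB : ∀ v, v ≠ 0 → 0 < B v v := fun v hv =>
    lt_of_lt_of_le (by have := norm_pos_iff.2 hv; positivity) (hcoer v)
  obtain ⟨e, he⟩ := exists_isOrthonormalFrame hs hB
  obtain ⟨a, ha, ha'⟩ := he.exists_coords v
  have h0 := he.le_tensorNorm hc hcoer t
  let L : E →ₗ[ℝ] F := (t.toMultilinearMap).toLinearMap (fun _ => 0) 0
  have hL : ∀ w, L w = t fun _ => w := by
    intro w
    change t (Function.update (fun _ => 0) 0 w) = _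
    congr 1
    ext i
    rw [Subsingleton.elim i 0]
    simp
  have h1 : ‖t (fun _ => v)‖ ≤ ∑ i, |a i| * ‖L (e i)‖ := by
    rw [← hL, ha, map_sum]
    refine (norm_sum_le _ _).trans_eq ?_
    simp [norm_smul]
  have h2 : ∑ i, |a i| * ‖L (e i)‖ ≤ √(∑ i, |a i| ^ 2) * √(∑ i, ‖L (e i)‖ ^ 2) :=
    Real.sum_mul_le_sqrt_mul_sqrt _ _ _
  have h3 : ∑ i, ‖L (e i)‖ ^ 2 =
      ∑ I : Fin 1 → Fin (Module.finrank ℝ E), ‖t (fun a => e (I a))‖ ^ 2 := by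
    refine (Fintype.sum_equiv (Equiv.funUnique (Fin 1) _) _ _ fun I => ?_).symm
    rw [hL]
    congr 3
    ext j
    rw [Subsingleton.elim j default]
    rfl
  rw [h3] at h2
  simp only [sq_abs] at h2
  rw [← ha', mul_comm] at h2
  exact (h1.trans h2).trans (mul_le_mul_of_nonneg_right h0 (Real.sqrt_nonneg _))

end TensorNorm

/-! ### Short geodesics are shortest -/

section ShortGeodesics

variable {E : Type*} [NormedAddCommGroup E] [NormedSpace ℝ E] [FiniteDimensional ℝ E]
  {h : E → E →L[ℝ] E →L[ℝ] ℝ} {U : Set E}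

omit [FiniteDimensional ℝ E] in
theorem IsMetricOn.norm_sub_le (hh : IsMetricOn h U) (hU : Convex ℝ U) {K : ℝ}
    (hK : ∀ u ∈ U, ‖fderiv ℝ h u‖ ≤ K) {p q : E} (hp : p ∈ U) (hq : q ∈ U) :
    ‖h q - h p‖ ≤ K * ‖q - p‖ :=
  hU.norm_image_sub_le_of_norm_fderiv_le
    (fun u hu => (hh.contDiffOn.contDiffAt (hh.isOpen.mem_nhds hu)).differentiableAt (by simp))
    hK hp hq

omit [FiniteDimensional ℝ E] in
-- Mean value inequality on the segment, where `Df` differs from `Df(p)` by at most `K‖q - p‖`. This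
-- gives `K` rather than Taylor's `K/2`, which is enough.
theorem Convex.norm_sub_sub_fderiv_le {F : Type*} [NormedAddCommGroup F] [NormedSpace ℝ F]
    {f : E → F} (hU : Convex ℝ U) (hd : ∀ u ∈ U, DifferentiableAt ℝ f u)
    (hd' : ∀ u ∈ U, DifferentiableAt ℝ (fderiv ℝ f) u) {K : ℝ}
    (hK : ∀ u ∈ U, ‖fderiv ℝ (fderiv ℝ f) u‖ ≤ K) {p q : E} (hp : p ∈ U) (hq : q ∈ U) :
    ‖f q - f p - fderiv ℝ f p (q - p)‖ ≤ K * ‖q - p‖ ^ 2 := by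
  have hseg : segment ℝ p q ⊆ U := hU.segment_subset hp hq
  have hK0 : 0 ≤ K := (norm_nonneg _).trans (hK p hp)
  rw [sq, ← mul_assoc]
  refine (convex_segment p q).norm_image_sub_le_of_norm_fderiv_le' (𝕜 := ℝ)
    (fun u hu => hd u (hseg hu)) (fun u hu => ?_) (left_mem_segment ℝ p q)
    (right_mem_segment ℝ p q)
  refine (hU.norm_image_sub_le_of_norm_fderiv_le hd' hK hp (hseg hu)).trans ?_
  gcongr
  obtain ⟨a, b, ha, hb, hab, rfl⟩ := hu
  have : a • p + b • q - p = b • (q - p) := by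
    rw [← eq_sub_iff_add_eq] at hab
    rw [hab]
    module
  rw [this, norm_smul, Real.norm_of_nonneg hb]
  exact mul_le_of_le_one_left (norm_nonneg _) (by linarith)

omit [FiniteDimensional ℝ E] in
theorem IsMetricOn.norm_sub_sub_le (hh : IsMetricOn h U) (hU : Convex ℝ U) {K : ℝ}
    (hK : ∀ u ∈ U, ‖fderiv ℝ (fderiv ℝ h) u‖ ≤ K) {p q : E} (hp : p ∈ U) (hq : q ∈ U) :
    ‖h q - h p - fderiv ℝ h p (q - p)‖ ≤ K * ‖q - p‖ ^ 2 :=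
  hU.norm_sub_sub_fderiv_le
    (fun u hu => (hh.contDiffOn.contDiffAt (hh.isOpen.mem_nhds hu)).differentiableAt (by simp))
    (fun u hu => ((hh.contDiffOn.fderiv_of_isOpen (m := 1) hh.isOpen (by norm_cast)).contDiffAt
      (hh.isOpen.mem_nhds hu)).differentiableAt (by simp)) hK hp hq

omit [FiniteDimensional ℝ E] in
/-- The pointwise comparison of a path with a geodesic: `q`, `c'` are the position and the velocity of
the path, `p`, `g` those of the geodesic, `s` is the speed of the parametrization. -/
theorem IsMetricOn.energy_density_ge (hh : IsMetricOn h U) (hU : Convex ℝ U) {K l : ℝ} (hl : 0 < l)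
    (hcoer : ∀ u ∈ U, ∀ v, l * ‖v‖ ^ 2 ≤ h u v v)
    (hK : ∀ u ∈ U, ‖fderiv ℝ h u‖ ≤ K) (hK' : ∀ u ∈ U, ‖fderiv ℝ (fderiv ℝ h) u‖ ≤ K)
    {p q g c' : E} (hp : p ∈ U) (hq : q ∈ U) (hg : h p g g = 1) {s A a : ℝ} (hs : 0 < s)
    (hA : ‖q - p‖ ≤ A) :
    (s * fderiv ℝ h p (q - p) g g + 2 * h p g (c' - s • g)) + s
      + l * (2 * a * ‖c' - s • g‖ - a ^ 2 * s) - 2 * K * A * √l⁻¹ * ‖c' - s • g‖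
      - s * (K * A ^ 2 * l⁻¹) ≤ h q c' c' / s := by
  set e' := c' - s • g with he'
  have hc' : c' = e' + s • g := by rw [he']; abel
  have hK0 : 0 ≤ K := (norm_nonneg _).trans (hK p hp)
  have hA0 : 0 ≤ A := (norm_nonneg _).trans hA
  have hgn : ‖g‖ ^ 2 ≤ l⁻¹ := by
    have := hcoer p hp g
    rw [hg] at this
    rwa [← one_div, le_div_iff₀ hl, mul_comm]
  have hgn' : ‖g‖ ≤ √l⁻¹ := Real.le_sqrt_of_sq_le hgn
  have e1 : h q c' c' / s = h q e' e' / s + 2 * h q g e' + s * h q g g := by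
    rw [hc']
    simp only [map_add, _root_.add_apply, map_smul, _root_.smul_apply, smul_eq_mul]
    rw [hh.symm q hq e' g]
    field_simp
    ring
  -- The square is replaced by its tangent line, `‖e'‖² ≥ 2as‖e'‖ - a²s²`. Division by `s` leaves
  -- only terms linear in `‖e'‖` and `s`, whose integrals are known.
  have e2 : l * (2 * a * ‖e'‖ - a ^ 2 * s) ≤ h q e' e' / s := by
    rw [le_div_iff₀ hs]
    refine le_trans ?_ (hcoer q hq e')
    nlinarith [mul_nonneg hl.le (sq_nonneg (‖e'‖ - a * s))]
  have e3 : h p g e' - K * A * √l⁻¹ * ‖e'‖ ≤ h q g e' := by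
    have h1 : |(h q - h p) g e'| ≤ ‖h q - h p‖ * ‖g‖ * ‖e'‖ := (h q - h p).le_opNorm₂ g e'
    have h2 : ‖h q - h p‖ * ‖g‖ * ‖e'‖ ≤ K * A * √l⁻¹ * ‖e'‖ := by
      gcongr
      exact (hh.norm_sub_le hU hK hp hq).trans (by gcongr)
    have h3 := (abs_le.1 (h1.trans h2)).1
    simp only [_root_.sub_apply] at h3
    linarith
  have e4 : 1 + fderiv ℝ h p (q - p) g g - K * A ^ 2 * l⁻¹ ≤ h q g g := by
    have h1 : |(h q - h p - fderiv ℝ h p (q - p)) g g| ≤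
      ‖h q - h p - fderiv ℝ h p (q - p)‖ * ‖g‖ * ‖g‖ := (h q - h p - fderiv ℝ h p (q - p)).le_opNorm₂ g g
    have h2 : ‖h q - h p - fderiv ℝ h p (q - p)‖ * ‖g‖ * ‖g‖ ≤ K * A ^ 2 * l⁻¹ := by
      rw [mul_assoc, ← sq ‖g‖]
      gcongr
      exact (hh.norm_sub_sub_le hU hK' hp hq).trans (by gcongr)
    have h3 := (abs_le.1 (h1.trans h2)).1
    simp only [_root_.sub_apply] at h3
    linarith
  have e5 := mul_le_mul_of_nonneg_left e4 hs.le
  rw [e1]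
  linarith

/-- A geodesic of length `ℓ` that is short compared to bounds for the metric is no longer than any
path with the same end points. -/
theorem IsMetricOn.length_ge_of_geodesic (hh : IsMetricOn h U) (hU : Convex ℝ U) {K l : ℝ}
    (hl : 0 < l) (hcoer : ∀ u ∈ U, ∀ v, l * ‖v‖ ^ 2 ≤ h u v v)
    (hK : ∀ u ∈ U, ‖fderiv ℝ h u‖ ≤ K) (hK' : ∀ u ∈ U, ‖fderiv ℝ (fderiv ℝ h) u‖ ≤ K)
    {ℓ : ℝ} (hℓ : 0 < ℓ) (hsmall : 2 * K * √l⁻¹ * ℓ + K * l⁻¹ * ℓ ^ 2 ≤ l)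
    {γ γ' γ'' : ℝ → E} (hγU : ∀ t ∈ Icc 0 ℓ, γ t ∈ U)
    (hγ : ∀ t ∈ Icc 0 ℓ, HasDerivAt γ (γ' t) t) (hγ' : ∀ t ∈ Icc 0 ℓ, HasDerivAt γ' (γ'' t) t)
    (hgeo : ∀ t ∈ Icc 0 ℓ, γ'' t + christoffel h (γ t) (γ' t) (γ' t) = 0)
    (hunit : ∀ t ∈ Icc 0 ℓ, h (γ t) (γ' t) (γ' t) = 1)
    {c c' : ℝ → E} (hcU : ∀ t ∈ Icc 0 1, c t ∈ U)
    (hc : ∀ t ∈ Icc (0 : ℝ) 1, HasDerivAt c (c' t) t) (hc' : ContinuousOn c' (Icc 0 1))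
    (h0 : c 0 = γ 0) (h1 : c 1 = γ ℓ) :
    ℓ ≤ ∫ t in (0 : ℝ)..1, √(h (c t) (c' t) (c' t)) := by
  by_contra! hlt
  have ccont : ContinuousOn c (Icc 0 1) := fun t ht => (hc t ht).continuousAt.continuousWithinAt
  have hcont : ContinuousOn h U := hh.contDiffOn.continuousOn
  have hdcont : ContinuousOn (fderiv ℝ h) U := hh.contDiffOn.continuousOn_fderiv_of_isOpen hh.isOpen (by simp)
  set sp : ℝ → ℝ := fun t => √(h (c t) (c' t) (c' t)) with hsp
  have spcont : ContinuousOn sp (Icc 0 1) :=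
    (((hcont.comp ccont hcU).clm_apply hc').clm_apply hc').sqrt
  set L := ∫ t in (0 : ℝ)..1, sp t with hL
  set ε := ℓ - L with hε
  have hεpos : 0 < ε := by linarith
  -- The geodesic is run with the speed of `c` plus the deficit `ε`, so that it reaches its end
  -- point at time `1`. Adding `ε` keeps `s` positive where `c` stops; the constant extension makes
  -- it continuous on `ℝ`.
  let s : ℝ → ℝ := fun t => IccExtend zero_le_one ((Icc (0 : ℝ) 1).domRestrict sp) t + ε
  have scont : Continuous s := (continuousOn_iff_continuous_domRestrict.1 spcont).Icc_extend'.add continuous_const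
  have hs_eq : ∀ t ∈ Icc (0 : ℝ) 1, s t = sp t + ε := fun t ht => by
    simp only [s, IccExtend_of_mem _ _ ht, domRestrict_apply]
  have hspnn : ∀ t, 0 ≤ sp t := fun t => Real.sqrt_nonneg _
  have hspos : ∀ t, 0 < s t := fun t =>
    add_pos_of_nonneg_of_pos (Real.sqrt_nonneg _) hεpos
  let σ : ℝ → ℝ := fun t => ∫ τ in (0 : ℝ)..t, s τ
  have hσ : ∀ t, HasDerivAt σ (s t) t := fun t => scont.integral_hasStrictDerivAt 0 t |>.hasDerivAt
  have hσ0 : σ 0 = 0 := intervalIntegral.integral_same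
  have hσ1 : σ 1 = ℓ := by
    have e1 : σ 1 = ∫ t in (0 : ℝ)..1, (sp t + ε) :=
      intervalIntegral.integral_congr fun t ht => hs_eq t (by rwa [uIcc_of_le zero_le_one] at ht)
    rw [e1, intervalIntegral.integral_add (spcont.intervalIntegrable_of_Icc zero_le_one)
      intervalIntegrable_const]
    simp [hε, hL]
  have hσmono : Monotone σ := monotone_of_hasDerivAt_nonneg hσ fun t => (hspos t).le
  have hσmem : ∀ t ∈ Icc (0 : ℝ) 1, σ t ∈ Icc 0 ℓ := fun t ht =>
    ⟨hσ0 ▸ hσmono ht.1, hσ1 ▸ hσmono ht.2⟩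
  have σcont : Continuous σ := continuous_iff_continuousAt.2 fun t => (hσ t).continuousAt
  let p : ℝ → E := fun t => γ (σ t)
  let g : ℝ → E := fun t => γ' (σ t)
  have hp : ∀ t ∈ Icc (0 : ℝ) 1, HasDerivAt p (s t • g t) t := fun t ht =>
    (hγ _ (hσmem t ht)).scomp t (hσ t)
  have hg : ∀ t ∈ Icc (0 : ℝ) 1, HasDerivAt g (s t • γ'' (σ t)) t := fun t ht =>
    (hγ' _ (hσmem t ht)).scomp t (hσ t)
  have hpU : ∀ t ∈ Icc (0 : ℝ) 1, p t ∈ U := fun t ht => hγU _ (hσmem t ht)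
  have pcont : ContinuousOn p (Icc 0 1) := fun t ht => (hp t ht).continuousAt.continuousWithinAt
  have gcont : ContinuousOn g (Icc 0 1) := fun t ht => (hg t ht).continuousAt.continuousWithinAt
  have scont' : ContinuousOn s (Icc 0 1) := scont.continuousOn
  let e : ℝ → E := fun t => c t - p t
  let e' : ℝ → E := fun t => c' t - s t • g t
  have he : ∀ t ∈ Icc (0 : ℝ) 1, HasDerivAt e (e' t) t := fun t ht => (hc t ht).sub (hp t ht)
  have e'cont : ContinuousOn e' (Icc 0 1) := hc'.sub (scont'.smul gcont)
  have econt : ContinuousOn e (Icc 0 1) := ccont.sub pcont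
  have he0 : e 0 = 0 := by simp [e, p, hσ0, h0]
  have he1 : e 1 = 0 := by simp [e, p, hσ1, h1]
  set A := ∫ t in (0 : ℝ)..1, ‖e' t‖ with hA
  have e'int := e'cont.norm.intervalIntegrable_of_Icc (μ := MeasureTheory.volume) zero_le_one
  have heA : ∀ t ∈ Icc (0 : ℝ) 1, ‖e t‖ ≤ A := by
    intro t ht
    have hsub : Icc 0 t ⊆ Icc (0 : ℝ) 1 := Icc_subset_Icc_right ht.2
    have i1 : ∫ τ in (0 : ℝ)..t, e' τ = e t - e 0 :=
      intervalIntegral.integral_eq_sub_of_hasDerivAt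
        (fun τ hτ => he τ (hsub (by rwa [uIcc_of_le ht.1] at hτ)))
        ((e'cont.mono hsub).intervalIntegrable_of_Icc ht.1)
    rw [he0, sub_zero] at i1
    rw [← i1]
    refine (intervalIntegral.norm_integral_le_integral_norm ht.1).trans ?_
    exact intervalIntegral.integral_mono_interval le_rfl ht.1 ht.2
      (Filter.Eventually.of_forall fun _ => norm_nonneg _) e'int
  have hA0 : 0 ≤ A := (norm_nonneg _).trans (heA 0 (by simp))
  -- The first variation. By the geodesic equation it is the derivative of `2 h(g, e)`, and it
  -- integrates to zero because `e` vanishes at both ends.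
  let Q' : ℝ → ℝ := fun t => s t * fderiv ℝ h (p t) (e t) (g t) (g t) + 2 * h (p t) (g t) (e' t)
  have hQ : ∀ t ∈ Icc (0 : ℝ) 1, HasDerivAt (fun t => 2 * h (p t) (g t) (e t)) (Q' t) t := by
    intro t ht
    have d := ((hh.contDiffOn.contDiffAt (hh.isOpen.mem_nhds (hpU t ht))).differentiableAt
      (by simp)).hasFDerivAt
    have d1 := ((d.comp_hasDerivAt t (hp t ht)).clm_apply (hg t ht)).clm_apply (he t ht)
    refine (d1.const_mul 2).congr_deriv ?_
    have e1 : γ'' (σ t) = -christoffel h (p t) (g t) (g t) :=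
      eq_neg_of_add_eq_zero_left (hgeo _ (hσmem t ht))
    have e2 := hh.apply_christoffel (hpU t ht) (g t) (g t) (e t)
    simp only [Q', Function.comp_apply, map_smul, _root_.add_apply, _root_.smul_apply, e1, map_neg, smul_eq_mul,
      _root_.neg_apply, e2]
    ring
  have Q'cont : ContinuousOn Q' (Icc 0 1) := by
    have k1 := (((hdcont.comp pcont hpU).clm_apply econt).clm_apply gcont).clm_apply gcont
    have k2 := ((hcont.comp pcont hpU).clm_apply gcont).clm_apply e'cont
    exact (scont'.mul k1).add (continuousOn_const.mul k2)
  have Q'int : ∫ t in (0 : ℝ)..1, Q' t = 0 := by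
    rw [intervalIntegral.integral_eq_sub_of_hasDerivAt
      (fun t ht => hQ t (by rwa [uIcc_of_le zero_le_one] at ht))
      (Q'cont.intervalIntegrable_of_Icc zero_le_one)]
    simp [he0, he1]
  -- The right-hand side comes from `h(c', c') / s = (s - ε)² / s ≤ s - ε`. The slope `a = A / ℓ` is
  -- the one that maximizes the integrated quadratic term `l (2aA - a²ℓ)`, with maximum `l A² / ℓ`.
  have key : ∀ t ∈ Icc (0 : ℝ) 1,
      Q' t + (1 - l * (A / ℓ) ^ 2 - K * A ^ 2 * l⁻¹) * s t
        + (l * (2 * (A / ℓ)) - 2 * K * A * √l⁻¹) * ‖e' t‖ ≤ s t - ε := by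
    intro t ht
    have k1 := hh.energy_density_ge hU hl hcoer hK hK' (hpU t ht) (hcU t ht)
      (hunit _ (hσmem t ht)) (c' := c' t) (a := A / ℓ) (hspos t) (heA t ht)
    have k2 : h (c t) (c' t) (c' t) / s t ≤ s t - ε := by
      rw [div_le_iff₀ (hspos t), hs_eq t ht]
      have k3 : h (c t) (c' t) (c' t) = sp t ^ 2 := by
        rw [hsp, Real.sq_sqrt]
        exact le_trans (by positivity) (hcoer _ (hcU t ht) (c' t))
      rw [k3]
      nlinarith [hspnn t]
    refine le_trans (le_of_eq ?_) (k1.trans k2)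
    simp only [Q', e, e', p, g]
    ring
  have i1 := intervalIntegral.integral_mono_on (μ := MeasureTheory.volume)
    (f := fun t => Q' t + (1 - l * (A / ℓ) ^ 2 - K * A ^ 2 * l⁻¹) * s t
        + (l * (2 * (A / ℓ)) - 2 * K * A * √l⁻¹) * ‖e' t‖) (g := fun t => s t - ε) zero_le_one
    (((Q'cont.add (continuousOn_const.mul scont')).add
      (continuousOn_const.mul e'cont.norm)).intervalIntegrable_of_Icc zero_le_one)
    ((scont'.sub continuousOn_const).intervalIntegrable_of_Icc zero_le_one) key
  have sint := scont'.intervalIntegrable_of_Icc (μ := MeasureTheory.volume) zero_le_one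
  have Qint := Q'cont.intervalIntegrable_of_Icc (μ := MeasureTheory.volume) zero_le_one
  have hs1 : ∫ t in (0 : ℝ)..1, s t = ℓ := hσ1
  rw [intervalIntegral.integral_add (Qint.add (sint.const_mul _)) (e'int.const_mul _),
    intervalIntegral.integral_add Qint (sint.const_mul _), intervalIntegral.integral_const_mul,
    intervalIntegral.integral_const_mul, Q'int, hs1, ← hA,
    intervalIntegral.integral_sub sint intervalIntegrable_const, hs1] at i1
  simp only [intervalIntegral.integral_const, sub_zero, one_smul] at i1
  -- By `hsmall` the gain `l A² / ℓ` absorbs both Taylor errors, and what remains is `ℓ ≤ ℓ - ε`.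
  have i2 : 0 ≤ A ^ 2 * (l - (2 * K * √l⁻¹ * ℓ + K * l⁻¹ * ℓ ^ 2)) / ℓ := by
    have := sub_nonneg.2 hsmall
    positivity
  have i3 : A ^ 2 * (l - (2 * K * √l⁻¹ * ℓ + K * l⁻¹ * ℓ ^ 2)) / ℓ =
      (-l * (A / ℓ) ^ 2 - K * A ^ 2 * l⁻¹) * ℓ + (l * (2 * (A / ℓ)) - 2 * K * A * √l⁻¹) * A := by
    field_simp
    ring
  linarith

end ShortGeodesics

/-! ### Parametrized patches of a Riemannian manifold -/

section Patches

variable {E : Type*} [NormedAddCommGroup E] [NormedSpace ℝ E]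
  {M : Type*} [TopologicalSpace M] [ChartedSpace E M] [IsManifold 𝓘(ℝ, E) ∞ M]

namespace SmoothMetric

theorem contMDiffAt_inner (g : SmoothMetric E M) {N : Type*} [TopologicalSpace N]
    {E' : Type*} [NormedAddCommGroup E'] [NormedSpace ℝ E'] [ChartedSpace E' N]
    {b : N → M} {v w : ∀ x, TangentSpace 𝓘(ℝ, E) (b x)} {x : N} {k : ℕ∞}
    (hv : ContMDiffAt 𝓘(ℝ, E') 𝓘(ℝ, E).tangent k (fun m => (⟨b m, v m⟩ : TangentBundle 𝓘(ℝ, E) M)) x)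
    (hw : ContMDiffAt 𝓘(ℝ, E') 𝓘(ℝ, E).tangent k (fun m => (⟨b m, w m⟩ : TangentBundle 𝓘(ℝ, E) M)) x) :
    ContMDiffAt 𝓘(ℝ, E') 𝓘(ℝ) k (fun m => g.inner (b m) (v m) (w m)) x := by
  have hb : ContMDiffAt 𝓘(ℝ, E') 𝓘(ℝ, E) k b x := by
    simp only [contMDiffAt_totalSpace] at hv
    exact hv.1
  have h2 : ContMDiffAt 𝓘(ℝ, E') (𝓘(ℝ, E).prod 𝓘(ℝ, E →L[ℝ] E →L[ℝ] ℝ)) k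
    (fun m => TotalSpace.mk' (E →L[ℝ] E →L[ℝ] ℝ) (E := fun x : M => TangentSpace 𝓘(ℝ, E) x →L[ℝ] TangentSpace 𝓘(ℝ, E) x →L[ℝ] ℝ) (b m) (g.inner (b m))) x :=
    ((g.contMDiff (b x)).of_le (by exact_mod_cast le_top)).comp x hb
  have h1 : ContMDiffAt 𝓘(ℝ, E') (𝓘(ℝ, E).prod 𝓘(ℝ)) k
      (fun m => TotalSpace.mk' ℝ (E := Bundle.Trivial M ℝ) (b m) (g.inner (b m) (v m) (w m))) x := by
    apply ContMDiffAt.clm_bundle_apply₂ (F₁ := E) (F₂ := E)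
    · exact h2
    · exact hv
    · exact hw
  simp only [contMDiffAt_totalSpace] at h1
  exact h1.2

/-- In finite dimension, a form is smooth once its values on fixed vectors `v`, `w` are. These are
values of `g` on the fields `ds(v)`, `ds(w)` along `s`, smooth as parts of the tangent map. -/
theorem contDiffOn_pullback [FiniteDimensional ℝ E] (g : SmoothMetric E M) {s : E → M} {S : Set E}
    (hS : IsOpen S) (hs : ContMDiffOn 𝓘(ℝ, E) 𝓘(ℝ, E) ∞ s S) :
    ContDiffOn ℝ ∞ (g.pullback s) S := by
  have key : ∀ v : E, ContMDiffOn 𝓘(ℝ, E) 𝓘(ℝ, E).tangent ∞ (fun u => (⟨s u, mfderiv 𝓘(ℝ, E) 𝓘(ℝ, E) s u v⟩ : TangentBundle 𝓘(ℝ, E) M)) S := by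
    intro v
    have h1 := hs.contMDiffOn_tangentMapWithin (m := ∞) (by norm_cast) hS.uniqueMDiffOn
    have h2 : ContMDiff 𝓘(ℝ, E) 𝓘(ℝ, E).tangent ∞ (fun u : E => (⟨u, v⟩ : TangentBundle 𝓘(ℝ, E) E)) :=
      contMDiff_vectorSpace_iff_contDiff.2 (contDiff_const (c := v))
    refine (h1.comp h2.contMDiffOn fun u hu => hu).congr fun u hu => ?_
    simp [tangentMapWithin, mfderivWithin_of_isOpen hS hu]
  rw [contDiffOn_clm_apply]
  intro v
  rw [contDiffOn_clm_apply]
  intro w u hu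
  refine ContDiffAt.contDiffWithinAt ?_
  rw [← contMDiffAt_iff_contDiffAt]
  exact g.contMDiffAt_inner ((key v).contMDiffAt (hS.mem_nhds hu)) ((key w).contMDiffAt (hS.mem_nhds hu))

end SmoothMetric

end Patches

section Patches

open MeasureTheory

variable {E : Type*} [NormedAddCommGroup E] [NormedSpace ℝ E]
  {M : Type*} [TopologicalSpace M] [ChartedSpace E M] [IsManifold 𝓘(ℝ, E) ∞ M]

namespace SmoothMetric

/-! ### Lengths of paths -/

/-- The speed of a path. -/
def speed (g : SmoothMetric E M) (c : ℝ → M) (t : ℝ) : ℝ :=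
  √(g.inner (c t) (mfderiv 𝓘(ℝ, ℝ) 𝓘(ℝ, E) c t (1 : ℝ)) (mfderiv 𝓘(ℝ, ℝ) 𝓘(ℝ, E) c t (1 : ℝ)))

/-- The length of a path on an interval. -/
def length (g : SmoothMetric E M) (c : ℝ → M) (a b : ℝ) : ℝ≥0∞ :=
  ∫⁻ t in Icc a b, ENNReal.ofReal (g.speed c t)

/-- `pathELength` depends on a bundle instance built from `g`; `length` keeps that instance out of
later statements. -/
theorem length_eq_pathELength (g : SmoothMetric E M) (c : ℝ → M) (a b : ℝ) :
    letI : RiemannianBundle (fun x : M => TangentSpace 𝓘(ℝ, E) x) := ⟨g.toRiemannianMetric⟩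
    pathELength 𝓘(ℝ, E) c a b = g.length c a b := by
  let _ : RiemannianBundle (fun x : M => TangentSpace 𝓘(ℝ, E) x) := ⟨g.toRiemannianMetric⟩
  rw [pathELength_eq_lintegral_mfderiv_Icc, length]
  congr 1
  ext t
  rw [← ofReal_norm]
  congr 1

theorem edist_le_length (g : SmoothMetric E M) {c : ℝ → M} {a b : ℝ} (hab : a ≤ b)
    (hc : ContMDiffOn 𝓘(ℝ, ℝ) 𝓘(ℝ, E) 1 c (Icc a b)) : g.edist (c a) (c b) ≤ g.length c a b := by
  let _ : RiemannianBundle (fun x : M => TangentSpace 𝓘(ℝ, E) x) := ⟨g.toRiemannianMetric⟩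
  rw [← length_eq_pathELength]
  exact riemannianEDist_le_pathELength hc rfl rfl hab

theorem exists_length_lt (g : SmoothMetric E M) {x y : M} {r : ℝ≥0∞} (h : g.edist x y < r) :
    ∃ c : ℝ → M, c 0 = x ∧ c 1 = y ∧ ContMDiff 𝓘(ℝ, ℝ) 𝓘(ℝ, E) 1 c ∧ g.length c 0 1 < r := by
  let _ : RiemannianBundle (fun x : M => TangentSpace 𝓘(ℝ, E) x) := ⟨g.toRiemannianMetric⟩
  obtain ⟨c, h0, h1, hc, hl, -⟩ := exists_lt_locally_constant_of_riemannianEDist_lt h zero_lt_one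
  exact ⟨c, h0, h1, hc, (length_eq_pathELength g c 0 1) ▸ hl⟩

theorem edist_self (g : SmoothMetric E M) (x : M) : g.edist x x = 0 := by
  let _ : RiemannianBundle (fun x : M => TangentSpace 𝓘(ℝ, E) x) := ⟨g.toRiemannianMetric⟩
  exact riemannianEDist_self

theorem edist_comm (g : SmoothMetric E M) (x y : M) : g.edist x y = g.edist y x := by
  let _ : RiemannianBundle (fun x : M => TangentSpace 𝓘(ℝ, E) x) := ⟨g.toRiemannianMetric⟩
  exact riemannianEDist_comm

theorem edist_triangle (g : SmoothMetric E M) (x y z : M) :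
    g.edist x z ≤ g.edist x y + g.edist y z := by
  let _ : RiemannianBundle (fun x : M => TangentSpace 𝓘(ℝ, E) x) := ⟨g.toRiemannianMetric⟩
  exact riemannianEDist_triangle

theorem length_mono (g : SmoothMetric E M) (c : ℝ → M) {a b a' b' : ℝ} (ha : a' ≤ a) (hb : b ≤ b') :
    g.length c a b ≤ g.length c a' b' :=
  lintegral_mono_set (Icc_subset_Icc ha hb)

/-! ### Patches -/

/-- `s` is an immersion of the open set `S`. -/
structure IsPatch (g : SmoothMetric E M) (s : E → M) (S : Set E) : Prop where
  isOpen : IsOpen S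
  contMDiffOn : ContMDiffOn 𝓘(ℝ, E) 𝓘(ℝ, E) ∞ s S
  pos : ∀ u ∈ S, ∀ v, v ≠ 0 → 0 < g.pullback s u v v

variable {g : SmoothMetric E M} {s : E → M} {S : Set E}

theorem IsPatch.mono (hs : g.IsPatch s S) {S' : Set E} (hS' : IsOpen S') (h : S' ⊆ S) :
    g.IsPatch s S' :=
  ⟨hS', hs.contMDiffOn.mono h, fun u hu => hs.pos u (h hu)⟩

theorem IsPatch.contMDiffAt (hs : g.IsPatch s S) {u : E} (hu : u ∈ S) :
    ContMDiffAt 𝓘(ℝ, E) 𝓘(ℝ, E) ∞ s u :=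
  hs.contMDiffOn.contMDiffAt (hs.isOpen.mem_nhds hu)

theorem IsPatch.mdifferentiableAt (hs : g.IsPatch s S) {u : E} (hu : u ∈ S) :
    MDifferentiableAt 𝓘(ℝ, E) 𝓘(ℝ, E) s u :=
  (hs.contMDiffAt hu).mdifferentiableAt (by simp)

theorem IsPatch.isMetricOn [FiniteDimensional ℝ E] (hs : g.IsPatch s S) :
    IsMetricOn (g.pullback s) S :=
  ⟨hs.isOpen, g.contDiffOn_pullback hs.isOpen hs.contMDiffOn, fun u _ _ _ => g.symm (s u) _ _,
    hs.pos⟩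

variable (g) in
theorem isPatch_chart (x : M) : g.IsPatch (chartAt E x).symm (chartAt E x).target := by
  refine ⟨(chartAt E x).open_target, contMDiffOn_chart_symm, fun u hu v hv => ?_⟩
  refine g.pos _ _ fun h0 => hv ?_
  have h1 := (mdifferentiable_chart (I := 𝓘(ℝ, E)) x).comp_symm_deriv hu
  have h2 : (mfderiv 𝓘(ℝ, E) 𝓘(ℝ, E) (chartAt E x) ((chartAt E x).symm u) : E →L[ℝ] E)
      ((mfderiv 𝓘(ℝ, E) 𝓘(ℝ, E) (chartAt E x).symm u : E →L[ℝ] E) v) = v := DFunLike.congr_fun h1 v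
  have h3 : (mfderiv 𝓘(ℝ, E) 𝓘(ℝ, E) (chartAt E x).symm u : E →L[ℝ] E) v = 0 := h0
  rw [h3, map_zero] at h2
  exact h2.symm

theorem pullback_comp {t : E → M} {φ : E → E} {u : E}
    (ht : MDifferentiableAt 𝓘(ℝ, E) 𝓘(ℝ, E) t (φ u)) (hφ : DifferentiableAt ℝ φ u)
    (hst : s =ᶠ[𝓝 u] t ∘ φ) (v w : E) :
    g.pullback s u v w = g.pullback t (φ u) (fderiv ℝ φ u v) (fderiv ℝ φ u w) := by
  have h1 : mfderiv 𝓘(ℝ, E) 𝓘(ℝ, E) s u =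
      (mfderiv 𝓘(ℝ, E) 𝓘(ℝ, E) t (φ u) : E →L[ℝ] E) ∘L (fderiv ℝ φ u) := by
    rw [hst.mfderiv_eq, mfderiv_comp u ht hφ.mdifferentiableAt, mfderiv_eq_fderiv]
    rfl
  have h2 : s u = t (φ u) := hst.self_of_nhds
  let B : M → E →L[ℝ] E →L[ℝ] ℝ := fun x => g.inner x
  let D : E →L[ℝ] E := mfderiv 𝓘(ℝ, E) 𝓘(ℝ, E) s u
  change B (s u) (D v) (D w) = B (t (φ u)) _ _
  rw [h2, show D = _ from h1]
  rfl

theorem IsPatch.isPullbackOn (hs : g.IsPatch s S) {t : E → M} {T : Set E} (ht : g.IsPatch t T)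
    {φ : E → E} (hφ : ContDiffOn ℝ ∞ φ S) (hφT : MapsTo φ S T) (hst : EqOn s (t ∘ φ) S) :
    IsPullbackOn φ (g.pullback s) (g.pullback t) S T :=
  ⟨hφ, hφT, fun _ hu => pullback_comp (ht.mdifferentiableAt (hφT hu))
    ((hφ.contDiffAt (hs.isOpen.mem_nhds hu)).differentiableAt (by simp))
    (hst.eventuallyEq_of_mem (hs.isOpen.mem_nhds hu))⟩

/-- The part of a patch that is mapped to the domain of the chart at `x`. -/
theorem IsPatch.inter_chart (hs : g.IsPatch s S) (x : M) :
    g.IsPatch s (S ∩ s ⁻¹' (chartAt E x).source) :=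
  hs.mono (hs.contMDiffOn.continuousOn.isOpen_inter_preimage hs.isOpen (chartAt E x).open_source)
    inter_subset_left

theorem IsPatch.isPullbackOn_chart (hs : g.IsPatch s S) (x : M) :
    IsPullbackOn (chartAt E x ∘ s) (g.pullback s) (g.inChart x)
      (S ∩ s ⁻¹' (chartAt E x).source) (chartAt E x).target := by
  refine (hs.inter_chart x).isPullbackOn (g.isPatch_chart x) ?_ (fun u hu => (chartAt E x).map_source hu.2)
    fun u hu => ((chartAt E x).left_inv hu.2).symm
  rw [← contMDiffOn_iff_contDiffOn]
  exact (contMDiffOn_chart (I := 𝓘(ℝ, E)) (n := ∞)).comp (hs.inter_chart x).contMDiffOn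
    fun u hu => hu.2

variable [FiniteDimensional ℝ E]

/-- The left side refers to the preferred chart at `x`, which varies with `x` without control. The
transition map from the patch is a local isometry, so the norm may be computed in the fixed patch.
-/
theorem IsPatch.tensorNorm_chart (hs : g.IsPatch s S) {F : Type*} [NormedAddCommGroup F]
    [NormedSpace ℝ F] {x : M} {u : E} (hu : u ∈ S) (hx : s u = x) {m : ℕ}
    {T T' : E → E [×m]→L[ℝ] F} (hT : ContDiffOn ℝ ∞ T (chartAt E x).target)
    (hT' : ContDiffOn ℝ ∞ T' S)
    (hTT' : ∀ u ∈ S ∩ s ⁻¹' (chartAt E x).source, T' u = (T (chartAt E x (s u))).compContinuousLinearMap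
      fun _ => fderiv ℝ (chartAt E x ∘ s) u) (k : ℕ) :
    tensorNorm (g.inChart x (chartAt E x x)) (iterNabla (g.inChart x) T k (chartAt E x x)) =
      tensorNorm (g.pullback s u) (iterNabla (g.pullback s) T' k u) := by
  have hu' : u ∈ S ∩ s ⁻¹' (chartAt E x).source := ⟨hu, by simp [hx]⟩
  have hφ := hs.isPullbackOn_chart x
  have hm := (g.isPatch_chart x).isMetricOn
  have hm' := (hs.inter_chart x).isMetricOn
  have h1 := hφ.iterNabla hm hm' hT (hT'.mono inter_subset_left) hTT' k hu'
  have h2 : (chartAt E x ∘ s) u = chartAt E x x := by simp [hx]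
  refine (tensorNorm_comp (LinearEquiv.ofBijective (fderiv ℝ (chartAt E x ∘ s) u : E →ₗ[ℝ] E) (hφ.bijective hm' hu')) ?_ ?_).symm
  · intro v w
    rw [hφ.eq u hu', h2]
    rfl
  · intro v
    rw [h1, h2]
    rfl

theorem IsPatch.normCovDerivCurvature_eq (hs : g.IsPatch s S) {u : E} (hu : u ∈ S) (k : ℕ) :
    g.normCovDerivCurvature k (s u) =
      tensorNorm (g.pullback s u) (iterNabla (g.pullback s) (curvatureTensorL (g.pullback s)) k u) := by
  have hm : IsMetricOn (g.inChart (s u)) _ := (g.isPatch_chart (s u)).isMetricOn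
  rw [← hs.tensorNorm_chart hu rfl hm.curvatureTensorL_contDiffOn
    hs.isMetricOn.curvatureTensorL_contDiffOn fun v hv =>
      (hs.isPullbackOn_chart (s u)).curvatureTensorL hm (hs.inter_chart (s u)).isMetricOn hv]
  rw [normCovDerivCurvature, hm.iterCovDeriv_eq hm.curvatureTensorL_contDiffOn
    (fun v hv => hm.curvatureTensor_eq hv) k (mem_chart_target E (s u))]

theorem IsPatch.normCovDeriv_eq (hs : g.IsPatch s S) {f : M → ℂ}
    (hf : ContMDiff 𝓘(ℝ, E) 𝓘(ℝ, ℂ) ∞ f) {u : E} (hu : u ∈ S) (k : ℕ) :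
    g.normCovDeriv f k (s u) =
      tensorNorm (g.pullback s u) (iterNabla (g.pullback s)
        (fun y => ContinuousMultilinearMap.uncurry0 ℝ E (f (s y))) k u) := by
  have hm : IsMetricOn (g.inChart (s u)) _ := (g.isPatch_chart (s u)).isMetricOn
  have hc : ∀ {t : E → M} {T : Set E}, g.IsPatch t T → 
      ContDiffOn ℝ ∞ (fun y => ContinuousMultilinearMap.uncurry0 ℝ E (f (t y))) T := by
    intro t T ht
    have h1 : ContDiffOn ℝ ∞ (f ∘ t) T :=
      contMDiffOn_iff_contDiffOn.1 (hf.comp_contMDiffOn ht.contMDiffOn)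
    exact (continuousMultilinearCurryFin0 ℝ E ℂ).symm.toContinuousLinearEquiv.contDiff.comp_contDiffOn h1
  rw [← hs.tensorNorm_chart hu rfl (hc (g.isPatch_chart (s u))) (hc hs)]
  · have h1 := hm.iterCovDeriv_eq (m := 0) (hc (g.isPatch_chart (s u)))
      (T' := fun y _ => f ((chartAt E (s u)).symm y)) (fun _ _ => rfl) k (mem_chart_target E (s u))
    rw [normCovDeriv, h1]
  · intro v hv
    ext w
    change f (s v) = f ((chartAt E (s u)).symm (chartAt E (s u) (s v)))
    rw [(chartAt E (s u)).left_inv hv.2]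

end SmoothMetric

end Patches

/-! ### Lifting paths to injective patches; metric balls and coordinate balls -/

section Lifts

open MeasureTheory

variable {E : Type*} [NormedAddCommGroup E] [NormedSpace ℝ E] [FiniteDimensional ℝ E]
  {M : Type*} [TopologicalSpace M] [ChartedSpace E M] [IsManifold 𝓘(ℝ, E) ∞ M]

namespace SmoothMetric

variable {g : SmoothMetric E M} {s : E → M} {S : Set E}

omit [FiniteDimensional ℝ E] in
theorem IsPatch.contDiffAt_chart_comp (hs : g.IsPatch s S) {x : M} {u : E} (hu : u ∈ S)
    (hx : s u ∈ (chartAt E x).source) : ContDiffAt ℝ ∞ (chartAt E x ∘ s) u :=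
  (hs.isPullbackOn_chart x).contDiffAt (hs.inter_chart x).isOpen ⟨hu, hx⟩

/-- The differential of a patch read in a chart, as an equivalence. -/
theorem IsPatch.exists_hasFDerivAt_equiv (hs : g.IsPatch s S) {x : M} {u : E} (hu : u ∈ S)
    (hx : s u ∈ (chartAt E x).source) :
    ∃ D : E ≃L[ℝ] E, HasFDerivAt (chartAt E x ∘ s) (D : E →L[ℝ] E) u := by
  have h := hs.isPullbackOn_chart x
  have hb := h.bijective (hs.inter_chart x).isMetricOn ⟨hu, hx⟩
  refine ⟨(LinearEquiv.ofBijective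
    (fderiv ℝ (chartAt E x ∘ s) u : E →ₗ[ℝ] E) hb).toContinuousLinearEquiv, ?_⟩
  exact h.hasFDerivAt (hs.inter_chart x).isOpen ⟨hu, hx⟩

/-- The inverse function theorem, read in a chart. -/
theorem IsPatch.map_nhds (hs : g.IsPatch s S) {u : E} (hu : u ∈ S) : map s (𝓝 u) = 𝓝 (s u) := by
  obtain ⟨D, hD⟩ := hs.exists_hasFDerivAt_equiv hu (mem_chart_source E (s u))
  have h1 : map (chartAt E (s u) ∘ s) (𝓝 u) = 𝓝 (chartAt E (s u) (s u)) :=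
    ((hs.contDiffAt_chart_comp hu (mem_chart_source E (s u))).hasStrictFDerivAt' hD (by simp)).map_nhds_eq_of_equiv
  have h2 : s =ᶠ[𝓝 u] (chartAt E (s u)).symm ∘ (chartAt E (s u) ∘ s) := by
    filter_upwards [(hs.inter_chart (s u)).isOpen.mem_nhds ⟨hu, mem_chart_source E (s u)⟩] with v hv
    exact ((chartAt E (s u)).left_inv hv.2).symm
  rw [Filter.map_congr h2, ← Filter.map_map, h1,
    (chartAt E (s u)).symm.map_nhds_eq (mem_chart_target E (s u)),
    (chartAt E (s u)).left_inv (mem_chart_source E (s u))]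

theorem IsPatch.isOpen_image (hs : g.IsPatch s S) {W : Set E} (hW : IsOpen W) (hWS : W ⊆ S) :
    IsOpen (s '' W) := by
  rw [isOpen_iff_mem_nhds]
  rintro _ ⟨u, hu, rfl⟩
  rw [← hs.map_nhds (hWS hu)]
  exact image_mem_map (hW.mem_nhds hu)

/-- An injective patch has a smooth inverse. -/
theorem IsPatch.exists_inverse (hs : g.IsPatch s S) (hinj : InjOn s S) :
    ∃ e : OpenPartialHomeomorph E M, e.source = S ∧ (∀ u, e u = s u) ∧
      ContMDiffOn 𝓘(ℝ, E) 𝓘(ℝ, E) ∞ e.symm e.target := by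
  have ho : IsOpenMap (S.domRestrict s) := by
    intro W hW
    have : S.domRestrict s '' W = s '' (Subtype.val '' W) := by
      rw [image_image]
      rfl
    rw [this]
    exact hs.isOpen_image (hs.isOpen.isOpenMap_subtype_val W hW) (by simp)
  let e := OpenPartialHomeomorph.ofContinuousOpenRestrict (hinj.toPartialEquiv s S)
    hs.contMDiffOn.continuousOn ho hs.isOpen
  refine ⟨e, rfl, fun _ => rfl, fun x hx => ContMDiffAt.contMDiffWithinAt ?_⟩
  set u := e.symm x with hu
  have huS : u ∈ S := e.map_target hx
  have hsu : s u = x := e.right_inv hx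
  have hxs : x ∈ (chartAt E x).source := mem_chart_source E x
  let e' := e.trans (chartAt E x)
  have he' : chartAt E x x ∈ e'.target := by
    simp [e', hx]
  have hsymm : e'.symm (chartAt E x x) = u := by simp [e', hu]
  obtain ⟨D, hD⟩ := hs.exists_hasFDerivAt_equiv huS (x := x) (by rwa [hsu])
  have h1 : ContDiffAt ℝ ∞ e'.symm (chartAt E x x) := by
    refine e'.contDiffAt_symm (f₀' := D) he' ?_ ?_
    · rw [hsymm]
      exact hD
    · rw [hsymm]
      exact hs.contDiffAt_chart_comp huS (by rwa [hsu])
  have h2 : e.symm =ᶠ[𝓝 x] e'.symm ∘ chartAt E x := by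
    filter_upwards [(chartAt E x).open_source.mem_nhds hxs] with y hy
    simp [e', (chartAt E x).left_inv hy]
  refine ContMDiffAt.congr_of_eventuallyEq ?_ h2
  exact h1.contMDiffAt.comp x
    ((contMDiffOn_chart (I := 𝓘(ℝ, E)) (n := ∞)).contMDiffAt ((chartAt E x).open_source.mem_nhds hxs))

/-- Lifts of paths to an injective patch. -/
theorem IsPatch.exists_lift (hs : g.IsPatch s S) (hinj : InjOn s S) (c : ℝ → M) :
    ∃ η : ℝ → E, ∀ t, c t ∈ s '' S → η t ∈ S ∧ s (η t) = c t ∧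
      (ContinuousAt c t → c =ᶠ[𝓝 t] s ∘ η) ∧
      ∀ k : ℕ∞, ContMDiffAt 𝓘(ℝ, ℝ) 𝓘(ℝ, E) k c t → ContDiffAt ℝ k η t := by
  obtain ⟨e, he, hes, hsm⟩ := hs.exists_inverse hinj
  have htar : s '' S = e.target := by
    rw [← he, ← e.image_source_eq_target]
    exact image_congr fun u _ => (hes u).symm
  refine ⟨fun t => e.symm (c t), fun t ht => ?_⟩
  rw [htar] at ht
  refine ⟨he ▸ e.map_target ht, by rw [← hes, e.right_inv ht], fun hc => ?_, fun k hk => ?_⟩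
  · filter_upwards [hc.preimage_mem_nhds (e.open_target.mem_nhds ht)] with τ hτ
    rw [Function.comp_apply, ← hes, e.right_inv hτ]
  · rw [← contMDiffAt_iff_contDiffAt]
    exact ((hsm.contMDiffAt (e.open_target.mem_nhds ht)).of_le (by exact_mod_cast le_top)).comp t hk

omit [FiniteDimensional ℝ E] in
theorem IsPatch.speed_eq (hs : g.IsPatch s S) {c : ℝ → M} {η : ℝ → E} {η' : E} {t : ℝ}
    (hη : HasDerivAt η η' t) (hηS : η t ∈ S) (hc : c =ᶠ[𝓝 t] s ∘ η) :
    g.speed c t = √(g.pullback s (η t) η' η') := by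
  let B : M → E →L[ℝ] E →L[ℝ] ℝ := fun x => g.inner x
  let D : ℝ →L[ℝ] E := mfderiv 𝓘(ℝ, ℝ) 𝓘(ℝ, E) c t
  let Ds : E →L[ℝ] E := mfderiv 𝓘(ℝ, E) 𝓘(ℝ, E) s (η t)
  have h1 : D = Ds ∘L (fderiv ℝ η t) := by
    change mfderiv 𝓘(ℝ, ℝ) 𝓘(ℝ, E) c t = _
    rw [hc.mfderiv_eq, mfderiv_comp t (hs.mdifferentiableAt hηS)
      hη.differentiableAt.mdifferentiableAt, mfderiv_eq_fderiv]
    rfl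
  have h2 : c t = s (η t) := hc.self_of_nhds
  change √(B (c t) (D 1) (D 1)) = _
  rw [h2, h1, ContinuousLinearMap.comp_apply, fderiv_eq_smul_deriv, one_smul,
    hη.deriv]
  rfl

/-- A lift of a `C^1` path whose image lies in an injective patch, with its length. -/
theorem IsPatch.exists_lift_length (hs : g.IsPatch s S) (hinj : InjOn s S) {c : ℝ → M} {a b : ℝ}
    (hab : a ≤ b) (hc : ∀ t ∈ Icc a b, ContMDiffAt 𝓘(ℝ, ℝ) 𝓘(ℝ, E) 1 c t)
    (hcS : ∀ t ∈ Icc a b, c t ∈ s '' S) :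
    ∃ η η' : ℝ → E, (∀ t ∈ Icc a b, η t ∈ S ∧ s (η t) = c t ∧ HasDerivAt η (η' t) t) ∧
      ContinuousOn η' (Icc a b) ∧
      g.length c a b = ENNReal.ofReal (∫ t in a..b, √(g.pullback s (η t) (η' t) (η' t))) := by
  obtain ⟨η, hη⟩ := hs.exists_lift hinj c
  have hd : ∀ t ∈ Icc a b, ContDiffAt ℝ 1 η t := fun t ht => (hη t (hcS t ht)).2.2.2 1 (hc t ht)
  have hη' : ∀ t ∈ Icc a b, HasDerivAt η (deriv η t) t := fun t ht =>
    ((hd t ht).differentiableAt (by simp)).hasDerivAt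
  have hcont : ContinuousOn (deriv η) (Icc a b) := fun t ht => by
    have h1 := ((hd t ht).fderiv_right (m := 0) (by simp)).continuousAt
    exact (h1.clm_apply continuousAt_const).continuousWithinAt
  refine ⟨η, deriv η, fun t ht => ⟨(hη t (hcS t ht)).1, (hη t (hcS t ht)).2.1, hη' t ht⟩, hcont, ?_⟩
  have hsp : ContinuousOn (fun t => √(g.pullback s (η t) (deriv η t) (deriv η t))) (Icc a b) := by
    have h1 : ContinuousOn (fun t => g.pullback s (η t)) (Icc a b) :=
      hs.isMetricOn.contDiffOn.continuousOn.comp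
        (fun t ht => (hd t ht).continuousAt.continuousWithinAt) fun t ht => (hη t (hcS t ht)).1
    exact ((h1.clm_apply hcont).clm_apply hcont).sqrt
  rw [intervalIntegral.integral_of_le hab, ← integral_Icc_eq_integral_Ioc,
    ofReal_integral_eq_lintegral_ofReal (hsp.integrableOn_Icc)
      (Eventually.of_forall fun t => Real.sqrt_nonneg _), length]
  refine setLIntegral_congr_fun measurableSet_Icc fun t ht => ?_
  rw [hs.speed_eq (hη' t ht) (hη t (hcS t ht)).1 ((hη t (hcS t ht)).2.2.1 (hc t ht).continuousAt)]

/-- A path leaving a ball of radius `r` in an injective patch has length at least `√l r`. -/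
theorem IsPatch.length_ge_of_notMem [T2Space M] (hs : g.IsPatch s S) (hinj : InjOn s S) {l : ℝ}
    (hcoer : ∀ u ∈ S, ∀ v, l * ‖v‖ ^ 2 ≤ g.pullback s u v v) {u₀ : E} {r : ℝ} (hr : 0 < r)
    (hball : Metric.closedBall u₀ r ⊆ S) {c : ℝ → M} {b : ℝ}
    (hc : ∀ t ∈ Icc 0 b, ContMDiffAt 𝓘(ℝ, ℝ) 𝓘(ℝ, E) 1 c t) (h0 : c 0 = s u₀)
    (hout : ∃ t ∈ Icc 0 b, c t ∉ s '' Metric.ball u₀ r) :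
    ENNReal.ofReal (√l * r) ≤ g.length c 0 b := by
  have hcont : ContinuousOn c (Icc 0 b) := fun t ht => (hc t ht).continuousAt.continuousWithinAt
  have hopen : IsOpen (s '' Metric.ball u₀ r) :=
    hs.isOpen_image Metric.isOpen_ball (Metric.ball_subset_closedBall.trans hball)
  have hclosed : IsClosed (s '' Metric.closedBall u₀ r) :=
    ((isCompact_closedBall u₀ r).image_of_continuousOn
      (hs.contMDiffOn.continuousOn.mono hball)).isClosed
  have hZ : IsCompact (Icc 0 b ∩ c ⁻¹' (s '' Metric.ball u₀ r)ᶜ) :=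
    isCompact_Icc.of_isClosed_subset (hcont.preimage_isClosed_of_isClosed isClosed_Icc
      hopen.isClosed_compl) inter_subset_left
  -- The first exit time from the image of the open ball. Up to and including `τ` the path stays in
  -- the image of the closed ball, which is compact and hence closed, so it lifts on `[0, τ]`.
  obtain ⟨τ, ⟨hτ, hτout⟩, hmin⟩ := hZ.exists_isLeast (by
    obtain ⟨t, ht, ht'⟩ := hout
    exact ⟨t, ht, ht'⟩)
  have hτpos : 0 < τ := by
    refine lt_of_le_of_ne hτ.1 ?_
    rintro rfl
    exact hτout ⟨u₀, Metric.mem_ball_self hr, h0.symm⟩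
  have hin : ∀ t ∈ Ico 0 τ, c t ∈ s '' Metric.closedBall u₀ r := by
    intro t ht
    by_contra hcon
    have : τ ≤ t := hmin ⟨⟨ht.1, ht.2.le.trans hτ.2⟩, fun h =>
      hcon (image_mono Metric.ball_subset_closedBall h)⟩
    exact absurd ht.2 (not_lt.2 this)
  have hin' : ∀ t ∈ Icc 0 τ, c t ∈ s '' Metric.closedBall u₀ r := by
    intro t ht
    rcases ht.2.lt_or_eq with h | rfl
    · exact hin t ⟨ht.1, h⟩
    · have h1 : t ∈ closure (Ico 0 t) := by
        rw [closure_Ico hτpos.ne]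
        exact right_mem_Icc.2 hτpos.le
      have h2 : c t ∈ closure (s '' Metric.closedBall u₀ r) :=
        (hc t hτ).continuousAt.continuousWithinAt.mem_closure h1 hin
      rwa [hclosed.closure_eq] at h2
  obtain ⟨η, η', hη, hη', hlen⟩ := hs.exists_lift_length hinj hτ.1
    (fun t ht => hc t ⟨ht.1, ht.2.trans hτ.2⟩) fun t ht => image_mono hball (hin' t ht)
  refine le_trans ?_ (g.length_mono c le_rfl hτ.2)
  rw [hlen]
  refine ENNReal.ofReal_le_ofReal ?_
  have hη0 : η 0 = u₀ := hinj (hη 0 (left_mem_Icc.2 hτ.1)).1 (hball (Metric.mem_closedBall_self hr.le))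
    ((hη 0 (left_mem_Icc.2 hτ.1)).2.1.trans h0)
  have hητ : r ≤ ‖η τ - u₀‖ := by
    by_contra! hlt
    exact hτout ⟨η τ, by rwa [Metric.mem_ball, dist_eq_norm], (hη τ (right_mem_Icc.2 hτ.1)).2.1⟩
  have hηc : ContinuousOn η (Icc 0 τ) := fun t ht => (hη t ht).2.2.continuousAt.continuousWithinAt
  have hftc : ∫ t in (0 : ℝ)..τ, η' t = η τ - η 0 :=
    intervalIntegral.integral_eq_sub_of_hasDerivAt
      (fun t ht => (hη t (by rwa [uIcc_of_le hτ.1] at ht)).2.2)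
      (ContinuousOn.intervalIntegrable (by rwa [uIcc_of_le hτ.1]))
  have hsp : ContinuousOn (fun t => √(g.pullback s (η t) (η' t) (η' t))) (Icc 0 τ) := by
    have h1 : ContinuousOn (fun t => g.pullback s (η t)) (Icc 0 τ) :=
      hs.isMetricOn.contDiffOn.continuousOn.comp hηc fun t ht => (hη t ht).1
    exact ((h1.clm_apply hη').clm_apply hη').sqrt
  calc √l * r ≤ √l * ‖∫ t in (0 : ℝ)..τ, η' t‖ := by
        rw [hftc, hη0]
        gcongr
    _ ≤ √l * ∫ t in (0 : ℝ)..τ, ‖η' t‖ := by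
        gcongr
        exact intervalIntegral.norm_integral_le_integral_norm hτ.1
    _ = ∫ t in (0 : ℝ)..τ, √l * ‖η' t‖ := by rw [intervalIntegral.integral_const_mul]
    _ ≤ _ := by
        refine intervalIntegral.integral_mono_on hτ.1
          (ContinuousOn.intervalIntegrable (by rw [uIcc_of_le hτ.1]; fun_prop))
          (ContinuousOn.intervalIntegrable (by rwa [uIcc_of_le hτ.1])) fun t ht => ?_
        rw [← Real.sqrt_sq (norm_nonneg (η' t)), ← Real.sqrt_mul' _ (sq_nonneg _)]
        exact Real.sqrt_le_sqrt (hcoer _ (hη t ht).1 _)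

theorem IsPatch.mem_image_ball_of_edist_lt [T2Space M] (hs : g.IsPatch s S) (hinj : InjOn s S)
    {l : ℝ} (hcoer : ∀ u ∈ S, ∀ v, l * ‖v‖ ^ 2 ≤ g.pullback s u v v) {u₀ : E} {r : ℝ} (hr : 0 < r)
    (hball : Metric.closedBall u₀ r ⊆ S) {y : M} (hy : g.edist (s u₀) y < ENNReal.ofReal (√l * r)) :
    y ∈ s '' Metric.ball u₀ r := by
  obtain ⟨c, h0, h1, hc, hlen⟩ := g.exists_length_lt hy
  by_contra hcon
  refine absurd hlen (not_lt.2 ?_)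
  exact hs.length_ge_of_notMem hinj hcoer hr hball (fun t _ => hc.contMDiffAt) h0
    ⟨1, by simp, by rwa [h1]⟩

omit [FiniteDimensional ℝ E] in
/-- Topologically close points are metrically close. -/
theorem eventually_edist_lt (g : SmoothMetric E M) (x : M) {r : ℝ≥0∞} (hr : 0 < r) :
    ∀ᶠ y in 𝓝 x, g.edist x y < r := by
  have : IsManifold 𝓘(ℝ, E) 1 M := IsManifold.of_le (n := ∞) (by norm_cast)
  let _ : RiemannianBundle (fun x : M => TangentSpace 𝓘(ℝ, E) x) := ⟨g.toRiemannianMetric⟩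
  have : IsContinuousRiemannianBundle E (fun x : M => TangentSpace 𝓘(ℝ, E) x) :=
    ⟨⟨g.inner, g.contMDiff.continuous, fun _ _ _ => rfl⟩⟩
  exact eventually_riemannianEDist_lt 𝓘(ℝ, E) x hr

/-- Metrically close points are topologically close. -/
theorem exists_edist_lt_subset [T2Space M] (g : SmoothMetric E M) {x : M} {W : Set M}
    (hW : W ∈ 𝓝 x) : ∃ r > 0, {y | g.edist x y < r} ⊆ W := by
  have : IsManifold 𝓘(ℝ, E) 1 M := IsManifold.of_le (n := ∞) (by norm_cast)
  have : LocallyCompactSpace M := ChartedSpace.locallyCompactSpace E M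
  let _ : RiemannianBundle (fun x : M => TangentSpace 𝓘(ℝ, E) x) := ⟨g.toRiemannianMetric⟩
  have : IsContinuousRiemannianBundle E (fun x : M => TangentSpace 𝓘(ℝ, E) x) :=
    ⟨⟨g.inner, g.contMDiff.continuous, fun _ _ _ => rfl⟩⟩
  exact setOfPred_riemannianEDist_lt_subset_nhds' 𝓘(ℝ, E) hW

end SmoothMetric

end Lifts

/-! ### Bounded geometry from finitely many uniform patches -/

section BoundedGeometry

open MeasureTheory

variable {E : Type*} [NormedAddCommGroup E] [NormedSpace ℝ E] [FiniteDimensional ℝ E]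
  {M : Type*} [TopologicalSpace M] [ChartedSpace E M] [IsManifold 𝓘(ℝ, E) ∞ M]

namespace SmoothMetric

variable {g : SmoothMetric E M} {s : E → M} {S : Set E}

omit [FiniteDimensional ℝ E] in
theorem IsUnitSpeedGeodesic.speed_eq {γ : ℝ → M} {ℓ : ℝ} (hγ : g.IsUnitSpeedGeodesic γ ℓ) {t : ℝ}
    (ht : t ∈ Icc 0 ℓ) : g.speed γ t = 1 := by
  obtain ⟨h1, -, h3⟩ := hγ t ht
  have h4 : ContMDiffAt 𝓘(ℝ, ℝ) 𝓘(ℝ, E) ∞ (fun τ => chartAt E (γ t) (γ τ)) t :=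
    ((contMDiffOn_chart (I := 𝓘(ℝ, E)) (n := ∞)).contMDiffAt
      ((chartAt E (γ t)).open_source.mem_nhds (mem_chart_source E (γ t)))).comp t h1
  have h5 := ((contMDiffAt_iff_contDiffAt.1 h4).differentiableAt (by simp)).hasDerivAt
  rw [(g.isPatch_chart (γ t)).speed_eq h5 (mem_chart_target E (γ t))]
  · exact (congrArg _ h3).trans Real.sqrt_one
  · filter_upwards [h1.continuousAt.preimage_mem_nhds
      ((chartAt E (γ t)).open_source.mem_nhds (mem_chart_source E (γ t)))] with τ hτ
    exact ((chartAt E (γ t)).left_inv hτ).symm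

omit [FiniteDimensional ℝ E] in
theorem IsUnitSpeedGeodesic.length_eq {γ : ℝ → M} {ℓ : ℝ} (hγ : g.IsUnitSpeedGeodesic γ ℓ) :
    g.length γ 0 ℓ = ENNReal.ofReal ℓ := by
  rw [length, setLIntegral_congr_fun measurableSet_Icc (g := fun _ => 1)
    fun t ht => by rw [hγ.speed_eq ht, ENNReal.ofReal_one]]
  simp

/-- The geodesic equation holds in every patch. -/
theorem IsPatch.geodesic_equation (hs : g.IsPatch s S) {γ : ℝ → M} {ℓ : ℝ}
    (hγ : g.IsUnitSpeedGeodesic γ ℓ) {t : ℝ} (ht : t ∈ Icc 0 ℓ) {η : ℝ → E}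
    (hη : ContDiffAt ℝ ∞ η t) (hηS : η t ∈ S) (hc : γ =ᶠ[𝓝 t] s ∘ η) :
    deriv (deriv η) t + christoffel (g.pullback s) (η t) (deriv η t) (deriv η t) = 0 := by
  obtain ⟨-, h2, -⟩ := hγ t ht
  have hγt : s (η t) = γ t := hc.self_of_nhds.symm
  set x := γ t with hx
  let φ : E → E := chartAt E x ∘ s
  have hu : η t ∈ S ∩ s ⁻¹' (chartAt E x).source := ⟨hηS, by simp [hγt]⟩
  have hφ := hs.isPullbackOn_chart x
  have hm := (g.isPatch_chart x).isMetricOn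
  have hm' := (hs.inter_chart x).isMetricOn
  have hd : ∀ᶠ τ in 𝓝 t, DifferentiableAt ℝ η τ := by
    filter_upwards [(hη.of_le (m := 1) (by norm_cast)).eventually (by simp)] with τ hτ
    exact hτ.differentiableAt (by simp)
  have hηin : ∀ᶠ τ in 𝓝 t, η τ ∈ S ∩ s ⁻¹' (chartAt E x).source :=
    hη.continuousAt.preimage_mem_nhds (hm'.isOpen.mem_nhds hu)
  have hd2 : HasDerivAt (deriv η) (deriv (deriv η) t) t := by
    have h3 : ContDiffAt ℝ 1 (deriv η) t := (hη.fderiv_right (m := 1) (by norm_cast)).clm_apply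
      contDiffAt_const
    exact (h3.differentiableAt (by simp)).hasDerivAt
  have e1 : (fun τ => chartAt E x (γ τ)) =ᶠ[𝓝 t] φ ∘ η := by
    filter_upwards [hc] with τ hτ
    rw [hτ]
    rfl
  have e2 : deriv (fun τ => chartAt E x (γ τ)) =ᶠ[𝓝 t] fun τ => fderiv ℝ φ (η τ) (deriv η τ) := by
    filter_upwards [e1.eventuallyEq_nhds, hd, hηin] with τ h3 h4 h5
    rw [h3.deriv_eq]
    exact ((hφ.hasFDerivAt hm'.isOpen h5).comp_hasDerivAt τ h4.hasDerivAt).deriv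
  have e3 : deriv (deriv fun τ => chartAt E x (γ τ)) t =
      fderiv ℝ (fderiv ℝ φ) (η t) (deriv η t) (deriv η t) +
        fderiv ℝ φ (η t) (deriv (deriv η) t) := by
    rw [e2.deriv_eq]
    have h3 := (hφ.hasFDerivAt_fderiv hm'.isOpen hu).comp_hasDerivAt t hd.self_of_nhds.hasDerivAt
    exact (h3.clm_apply hd2).deriv
  have e4 := e1.self_of_nhds
  simp only [Function.comp_apply] at e4
  rw [e3, e2.self_of_nhds] at h2
  simp only [e4] at h2
  -- The term `D²φ(η', η')` from the chain rule is the inhomogeneous term of this law, so the chart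
  -- equation is `Dφ` applied to the patch equation, and `Dφ` is injective.
  have h3 := hφ.christoffel hm hm' hu (deriv η t) (deriv η t)
  apply (hφ.bijective hm' hu).1
  rw [map_zero, map_add, h3, ← h2]
  simp only [inChart, φ, Function.comp_def]
  abel

/-- A geodesic of an injective patch that is short is minimizing. -/
theorem IsPatch.edist_eq_of_geodesic [T2Space M] {u₀ : E} {ρ : ℝ}
    (hs : g.IsPatch s (Metric.ball u₀ ρ)) (hinj : InjOn s (Metric.ball u₀ ρ)) {l K : ℝ}
    (hl : 0 < l) (hcoer : ∀ u ∈ Metric.ball u₀ ρ, ∀ v, l * ‖v‖ ^ 2 ≤ g.pullback s u v v)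
    (hK : ∀ u ∈ Metric.ball u₀ ρ, ‖fderiv ℝ (g.pullback s) u‖ ≤ K)
    (hK' : ∀ u ∈ Metric.ball u₀ ρ, ‖fderiv ℝ (fderiv ℝ (g.pullback s)) u‖ ≤ K)
    {r : ℝ} (hr : 0 < r) (hrρ : r < ρ) {ℓ : ℝ} (hℓ : 0 ≤ ℓ) (hℓr : ℓ < √l * r)
    (hsmall : 2 * K * √l⁻¹ * ℓ + K * l⁻¹ * ℓ ^ 2 ≤ l) {γ : ℝ → M} (h0 : γ 0 = s u₀)
    (hγ : g.IsUnitSpeedGeodesic γ ℓ) : g.edist (s u₀) (γ ℓ) = ENNReal.ofReal ℓ := by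
  rcases hℓ.eq_or_lt with rfl | hℓ
  · rw [h0, edist_self, ENNReal.ofReal_zero]
  have hball : Metric.closedBall u₀ r ⊆ Metric.ball u₀ ρ := Metric.closedBall_subset_ball hrρ
  have hγ1 : ∀ t ∈ Icc 0 ℓ, ContMDiffAt 𝓘(ℝ, ℝ) 𝓘(ℝ, E) 1 γ t := fun t ht =>
    (hγ t ht).1.of_le (by norm_cast)
  have hlt : ENNReal.ofReal ℓ < ENNReal.ofReal (√l * r) := by
    rwa [ENNReal.ofReal_lt_ofReal_iff (hℓ.trans hℓr)]
  -- Neither the geodesic nor a shorter competitor is long enough to leave the ball, so both can be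
  -- compared within the patch.
  have hmem : ∀ t ∈ Icc 0 ℓ, γ t ∈ s '' Metric.ball u₀ r := by
    by_contra! hcon
    have h1 := hs.length_ge_of_notMem hinj hcoer hr hball hγ1 h0 hcon
    rw [hγ.length_eq] at h1
    exact absurd h1 (not_le.2 hlt)
  refine le_antisymm ?_ (le_of_not_gt fun hcon => ?_)
  · rw [← hγ.length_eq, ← h0]
    exact g.edist_le_length hℓ.le fun t ht => (hγ1 t ht).contMDiffWithinAt
  obtain ⟨c, c0, c1, hc, hlen⟩ := g.exists_length_lt hcon
  have cmem : ∀ t ∈ Icc (0 : ℝ) 1, c t ∈ s '' Metric.ball u₀ r := by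
    by_contra! hcon
    have h1 := hs.length_ge_of_notMem hinj hcoer hr hball (fun t _ => hc.contMDiffAt) c0 hcon
    exact absurd (h1.trans_lt (hlen.trans hlt)) (lt_irrefl _)
  have hsub : s '' Metric.ball u₀ r ⊆ s '' Metric.ball u₀ ρ :=
    image_mono (Metric.ball_subset_ball hrρ.le)
  obtain ⟨ξ, ξ', hξ, hξ', hξlen⟩ := hs.exists_lift_length hinj zero_le_one
    (fun t _ => hc.contMDiffAt) fun t ht => hsub (cmem t ht)
  obtain ⟨η, hη⟩ := hs.exists_lift hinj γ
  have hη2 : ∀ t ∈ Icc 0 ℓ, ContDiffAt ℝ ∞ η t := fun t ht =>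
    (hη t (hsub (hmem t ht))).2.2.2 ⊤ (hγ t ht).1
  have hηd : ∀ t ∈ Icc 0 ℓ, HasDerivAt η (deriv η t) t := fun t ht =>
    ((hη2 t ht).differentiableAt (by simp)).hasDerivAt
  have hηd2 : ∀ t ∈ Icc 0 ℓ, HasDerivAt (deriv η) (deriv (deriv η) t) t := fun t ht => by
    have h3 : ContDiffAt ℝ 1 (deriv η) t :=
      ((hη2 t ht).fderiv_right (m := 1) (by norm_cast)).clm_apply contDiffAt_const
    exact (h3.differentiableAt (by simp)).hasDerivAt
  have hev : ∀ t ∈ Icc 0 ℓ, γ =ᶠ[𝓝 t] s ∘ η := fun t ht =>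
    (hη t (hsub (hmem t ht))).2.2.1 (hγ1 t ht).continuousAt
  have hηS : ∀ t ∈ Icc 0 ℓ, η t ∈ Metric.ball u₀ ρ := fun t ht => (hη t (hsub (hmem t ht))).1
  have hηs : ∀ t ∈ Icc 0 ℓ, s (η t) = γ t := fun t ht => (hη t (hsub (hmem t ht))).2.1
  have m0 : (0 : ℝ) ∈ Icc 0 ℓ := left_mem_Icc.2 hℓ.le
  have mℓ : ℓ ∈ Icc 0 ℓ := right_mem_Icc.2 hℓ.le
  have n0 : (0 : ℝ) ∈ Icc (0 : ℝ) 1 := by simp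
  have n1 : (1 : ℝ) ∈ Icc (0 : ℝ) 1 := by simp
  have key := hs.isMetricOn.length_ge_of_geodesic (convex_ball u₀ ρ) hl hcoer hK hK' hℓ hsmall
    hηS hηd hηd2 (fun t ht => hs.geodesic_equation hγ ht (hη2 t ht) (hηS t ht) (hev t ht))
    (fun t ht => by
      have h1 := hγ.speed_eq ht
      rw [hs.speed_eq (hηd t ht) (hηS t ht) (hev t ht)] at h1
      exact (Real.sqrt_eq_one).1 h1)
    (fun t ht => (hξ t ht).1) (fun t ht => (hξ t ht).2.2) hξ'
    (hinj (hξ 0 n0).1 (hηS 0 m0) (by rw [(hξ 0 n0).2.1, hηs 0 m0, c0, h0]))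
    (hinj (hξ 1 n1).1 (hηS ℓ mℓ) (by rw [(hξ 1 n1).2.1, hηs ℓ mℓ, c1]))
  rw [hξlen] at hlen
  exact absurd hlen (not_lt.2 (ENNReal.ofReal_le_ofReal key))

variable (g) in
/-- `s` is a patch with uniform bounds on `S`, and injective on balls of a fixed radius around the
points of `S'`. -/
structure IsUniformPatch (s : E → M) (S S' : Set E) : Prop extends g.IsPatch s S where
  coercive : ∃ l : ℝ, 0 < l ∧ ∀ u ∈ S, ∀ v, l * ‖v‖ ^ 2 ≤ g.pullback s u v v
  hasBoundedDerivs : HasBoundedDerivs S (fun _ => 1) (g.pullback s)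
  injOn : ∃ ρ : ℝ, 0 < ρ ∧ ∀ u ∈ S', Metric.ball u ρ ⊆ S ∧ InjOn s (Metric.ball u ρ)

variable {S' : Set E}

omit [FiniteDimensional ℝ E] in
theorem IsUniformPatch.subset (hs : g.IsUniformPatch s S S') : S' ⊆ S := fun _ hu => by
  obtain ⟨ρ, hρ, h⟩ := hs.injOn
  exact (h _ hu).1 (Metric.mem_ball_self hρ)

theorem IsUniformPatch.curvature_bounded (hs : g.IsUniformPatch s S S') (k : ℕ) :
    ∃ C : ℝ, ∀ u ∈ S', g.normCovDerivCurvature k (s u) ≤ C := by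
  obtain ⟨l, hl, hcoer⟩ := hs.coercive
  obtain ⟨C, hC⟩ := (HasBoundedDerivs.iterNabla hs.isMetricOn hs.hasBoundedDerivs hl hcoer
    (HasBoundedDerivs.curvatureTensorL hs.isMetricOn hs.hasBoundedDerivs hl hcoer) k).bound 0
  refine ⟨√(Fintype.card (Fin (4 + k) → Fin (Module.finrank ℝ E))) * √l⁻¹ ^ (4 + k) * C,
    fun u hu => ?_⟩
  rw [hs.normCovDerivCurvature_eq (hs.subset hu)]
  refine (tensorNorm_le hl (hcoer u (hs.subset hu)) _).trans ?_
  gcongr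
  simpa using hC u (hs.subset hu)

/-- For completeness: the radius does not depend on the point, so a tail of a Cauchy sequence lies
in one compact set. -/
theorem IsUniformPatch.exists_compact [T2Space M] (hs : g.IsUniformPatch s S S') :
    ∃ r : ℝ≥0∞, 0 < r ∧ ∀ u ∈ S', ∃ K : Set M, IsCompact K ∧ {y | g.edist (s u) y < r} ⊆ K := by
  obtain ⟨l, hl, hcoer⟩ := hs.coercive
  obtain ⟨ρ, hρ, hinj⟩ := hs.injOn
  refine ⟨ENNReal.ofReal (√l * (ρ / 2)), by positivity, fun u hu => ?_⟩
  have hb : Metric.closedBall u (ρ / 2) ⊆ Metric.ball u ρ :=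
    Metric.closedBall_subset_ball (by linarith)
  refine ⟨s '' Metric.closedBall u (ρ / 2), (isCompact_closedBall _ _).image_of_continuousOn
    (hs.contMDiffOn.continuousOn.mono (hb.trans (hinj u hu).1)), fun y hy => ?_⟩
  exact image_mono Metric.ball_subset_closedBall
    ((hs.toIsPatch.mono Metric.isOpen_ball (hinj u hu).1).mem_image_ball_of_edist_lt (hinj u hu).2
      (fun v hv => hcoer v ((hinj u hu).1 hv)) (by positivity) hb hy)

theorem IsUniformPatch.exists_le_injectivityRadiusAt [T2Space M] (hs : g.IsUniformPatch s S S') :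
    ∃ r : ℝ≥0∞, 0 < r ∧ ∀ u ∈ S', r ≤ g.injectivityRadiusAt (s u) := by
  obtain ⟨l, hl, hcoer⟩ := hs.coercive
  obtain ⟨ρ, hρ, hinj⟩ := hs.injOn
  have hb1 := hs.hasBoundedDerivs.fderiv hs.isOpen
  obtain ⟨K₁, hK₁⟩ := hb1.bound 0
  obtain ⟨K₂, hK₂⟩ := (hb1.fderiv hs.isOpen).bound 0
  set K := max 0 (max K₁ K₂)
  have hK0 : 0 ≤ K := le_max_left _ _
  -- The smallness condition on `ℓ` holds near `0`, with a threshold depending only on `K` and `l`.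
  have hlim : Tendsto (fun t : ℝ => 2 * K * √l⁻¹ * t + K * l⁻¹ * t ^ 2) (𝓝 0) (𝓝 0) := by
    have : ContinuousAt (fun t : ℝ => 2 * K * √l⁻¹ * t + K * l⁻¹ * t ^ 2) 0 := by fun_prop
    simpa [ContinuousAt] using this
  obtain ⟨ε, hε, hsmall⟩ := Metric.eventually_nhds_iff.1 (hlim.eventually (ge_mem_nhds hl))
  have hpos : 0 < min ε (√l * (ρ / 2)) := by positivity
  refine ⟨ENNReal.ofReal (min ε (√l * (ρ / 2))), by positivity, fun u hu => ?_⟩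
  refine le_sSup fun γ ℓ hℓ h0 hγ hlt => ?_
  rw [ENNReal.ofReal_lt_ofReal_iff hpos, lt_min_iff] at hlt
  obtain ⟨hbS, hbi⟩ := hinj u hu
  refine (hs.toIsPatch.mono Metric.isOpen_ball hbS).edist_eq_of_geodesic hbi hl
    (fun v hv => hcoer v (hbS hv)) (K := K) (fun v hv => ?_) (fun v hv => ?_)
    (r := ρ / 2) (by positivity) (by linarith) hℓ hlt.2 (hsmall ?_) h0 hγ
  · have := hK₁ v (hbS hv)
    rw [norm_iteratedFDeriv_zero, mul_one] at this
    exact this.trans ((le_max_left _ _).trans (le_max_right _ _))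
  · have := hK₂ v (hbS hv)
    rw [norm_iteratedFDeriv_zero, mul_one] at this
    exact this.trans ((le_max_right _ _).trans (le_max_right _ _))
  · rw [Real.dist_eq, sub_zero, abs_of_nonneg hℓ]
    exact hlt.1

/-- A manifold that is covered by finitely many uniform patches has bounded geometry. -/
theorem hasBoundedGeometry_of_isUniformPatch [T2Space M] {ι : Type*} [Finite ι] (s : ι → E → M)
    (S S' : ι → Set E) (hs : ∀ i, g.IsUniformPatch (s i) (S i) (S' i))
    (hcover : ∀ x, ∃ i, ∃ u ∈ S' i, s i u = x) : g.HasBoundedGeometry := by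
  have := Fintype.ofFinite ι
  have hmin : ∀ r : ι → ℝ≥0∞, (∀ i, 0 < r i) → ∃ r₀ > 0, ∀ i, r₀ ≤ r i := fun r hr =>
    ⟨Finset.univ.inf r, (Finset.lt_inf_iff ENNReal.coe_lt_top).2 fun i _ => hr i,
      fun i => Finset.inf_le (Finset.mem_univ i)⟩
  refine ⟨?_, ?_, fun k => ?_⟩
  · intro x hx
    choose r hr hK using fun i => (hs i).exists_compact
    obtain ⟨r₀, hr₀, hle⟩ := hmin r hr
    obtain ⟨N, hN⟩ := hx r₀ hr₀
    obtain ⟨i, u, hu, hux⟩ := hcover (x N)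
    obtain ⟨K, hKc, hKsub⟩ := hK i u hu
    have hxK : ∀ m ≥ N, x m ∈ K := fun m hm => hKsub (by
      rw [mem_ofPred_eq, hux]
      exact (hN N le_rfl m hm).trans_le (hle i))
    -- A cluster point for the topology of `M`; the Cauchy property for `g.edist` turns it into a
    -- limit, since metric and topological neighbourhoods agree.
    obtain ⟨y, -, hy⟩ := hKc.exists_mapClusterPt (f := atTop) (u := x)
      (tendsto_principal.2 (eventually_atTop.2 ⟨N, hxK⟩))
    refine ⟨y, fun W hW => ?_⟩
    obtain ⟨c, hc, hcW⟩ := g.exists_edist_lt_subset hW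
    have hc2 : 0 < c / 2 := ENNReal.half_pos hc.ne'
    obtain ⟨N', hN'⟩ := hx (c / 2) hc2
    obtain ⟨k, hk, hkN⟩ := ((hy.frequently (g.eventually_edist_lt y hc2)).and_eventually
      (eventually_ge_atTop N')).exists
    refine eventually_atTop.2 ⟨N', fun m hm => hcW ?_⟩
    calc g.edist y (x m) ≤ g.edist y (x k) + g.edist (x k) (x m) := g.edist_triangle _ _ _
      _ < c / 2 + c / 2 := ENNReal.add_lt_add hk (hN' k hkN m hm)
      _ = c := ENNReal.add_halves c
  · choose r hr hle using fun i => (hs i).exists_le_injectivityRadiusAt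
    obtain ⟨r₀, hr₀, hle'⟩ := hmin r hr
    refine lt_of_lt_of_le hr₀ (le_iInf fun x => ?_)
    obtain ⟨i, u, hu, rfl⟩ := hcover x
    exact (hle' i).trans (hle i u hu)
  · choose C hC using fun i => (hs i).curvature_bounded k
    obtain ⟨C₀, hC₀⟩ := (finite_range C).bddAbove
    refine ⟨C₀, fun x => ?_⟩
    obtain ⟨i, u, hu, rfl⟩ := hcover x
    exact (hC i u hu).trans (hC₀ ⟨i, rfl⟩)

end SmoothMetric

end BoundedGeometry

/-! ### Uniform patches around points, compact sets and finiteness of the distance -/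

section UniformCharts

variable {E : Type*} [NormedAddCommGroup E] [NormedSpace ℝ E] [FiniteDimensional ℝ E]

theorem IsMetricOn.exists_coercive {h : E → E →L[ℝ] E →L[ℝ] ℝ} {S K : Set E} (hh : IsMetricOn h S)
    (hK : IsCompact K) (hKS : K ⊆ S) : ∃ l : ℝ, 0 < l ∧ ∀ u ∈ K, ∀ v, l * ‖v‖ ^ 2 ≤ h u v v := by
  have hc : ContinuousOn (fun p : E × E => h p.1 p.2 p.2) (K ×ˢ Metric.sphere 0 1) := by
    have h1 : ContinuousOn (fun p : E × E => h p.1) (K ×ˢ Metric.sphere 0 1) :=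
      hh.contDiffOn.continuousOn.comp continuousOn_fst fun p hp => hKS hp.1
    exact (h1.clm_apply continuousOn_snd).clm_apply continuousOn_snd
  have hpos : ∀ p ∈ K ×ˢ Metric.sphere (0 : E) 1, 0 < h p.1 p.2 p.2 := fun p hp =>
    hh.pos _ (hKS hp.1) _ (ne_zero_of_mem_unit_sphere (⟨p.2, hp.2⟩ : Metric.sphere (0 : E) 1))
  obtain ⟨l, hl, hle⟩ := (hK.prod (isCompact_sphere (0 : E) 1)).exists_forall_le' hc hpos
  refine ⟨l, hl, fun u hu v => ?_⟩
  rcases eq_or_ne v 0 with rfl | hv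
  · simp
  have hv' : ‖v‖ ≠ 0 := norm_ne_zero_iff.2 hv
  have h1 := hle (u, ‖v‖⁻¹ • v) ⟨hu, by simp [norm_smul, hv']⟩
  simp only [map_smul, _root_.smul_apply, smul_eq_mul] at h1
  calc l * ‖v‖ ^ 2 ≤ (‖v‖⁻¹ * (‖v‖⁻¹ * h u v v)) * ‖v‖ ^ 2 := by gcongr
    _ = h u v v := by field_simp

variable {M : Type*} [TopologicalSpace M] [ChartedSpace E M] [IsManifold 𝓘(ℝ, E) ∞ M]

namespace SmoothMetric

theorem exists_isUniformPatch_nhds (g : SmoothMetric E M) (x : M) :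
    ∃ S S' : Set E, g.IsUniformPatch (chartAt E x).symm S S' ∧ (chartAt E x).symm '' S' ∈ 𝓝 x := by
  have hp := g.isPatch_chart x
  obtain ⟨ε, hε, hball⟩ := Metric.isOpen_iff.1 (chartAt E x).open_target _ (mem_chart_target E x)
  set u₀ := chartAt E x x
  have hcb : Metric.closedBall u₀ (ε / 2) ⊆ (chartAt E x).target :=
    (Metric.closedBall_subset_ball (by linarith)).trans hball
  have hsub : Metric.ball u₀ (ε / 2) ⊆ (chartAt E x).target :=
    Metric.ball_subset_closedBall.trans hcb
  -- Bounds hold on the `ε/2`-ball, whose closure is a compact part of the chart; `ε/4`-balls around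
  -- points of the `ε/4`-ball remain inside it.
  refine ⟨Metric.ball u₀ (ε / 2), Metric.ball u₀ (ε / 4),
    ⟨hp.mono Metric.isOpen_ball hsub, ?_, ?_, ε / 4, by positivity, fun u hu => ?_⟩, ?_⟩
  · obtain ⟨l, hl, h⟩ := hp.isMetricOn.exists_coercive (isCompact_closedBall u₀ (ε / 2)) hcb
    exact ⟨l, hl, fun u hu => h u (Metric.ball_subset_closedBall hu)⟩
  · exact .of_compact (chartAt E x).open_target (isCompact_closedBall u₀ (ε / 2)) hcb
      hp.isMetricOn.contDiffOn Metric.ball_subset_closedBall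
  · have h1 : Metric.ball u (ε / 4) ⊆ Metric.ball u₀ (ε / 2) :=
      Metric.ball_subset_ball' (by rw [Metric.mem_ball] at hu; linarith)
    exact ⟨h1, (chartAt E x).symm.injOn.mono (h1.trans hsub)⟩
  · have h2 : (chartAt E x).symm u₀ = x := (chartAt E x).left_inv (mem_chart_source E x)
    have h1 : (chartAt E x).symm '' Metric.ball u₀ (ε / 4) ∈ 𝓝 ((chartAt E x).symm u₀) :=
      (hp.isOpen_image Metric.isOpen_ball ((Metric.ball_subset_ball (by linarith)).trans hball)).mem_nhds
        ⟨u₀, Metric.mem_ball_self (by positivity), rfl⟩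
    rwa [h2] at h1

/-- A manifold with a uniform patch that covers the complement of a compact set has bounded
geometry. -/
theorem IsUniformPatch.hasBoundedGeometry [T2Space M] {g : SmoothMetric E M} {s : E → M}
    {S S' : Set E} (hs : g.IsUniformPatch s S S') {K : Set M} (hK : IsCompact K)
    (hcover : ∀ x ∉ K, ∃ u ∈ S', s u = x) : g.HasBoundedGeometry := by
  choose T T' hT hT' using g.exists_isUniformPatch_nhds
  obtain ⟨t, -, ht⟩ := hK.elim_nhds_subcover (fun x => (chartAt E x).symm '' T' x) fun x _ => hT' x
  -- `none` indexes the given patch, `some x` a coordinate ball near `x`.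
  refine hasBoundedGeometry_of_isUniformPatch (ι := Option t)
    (fun i => i.elim s fun x => (chartAt E (x : M)).symm) (fun i => i.elim S fun x => T x)
    (fun i => i.elim S' fun x => T' x) ?_ fun x => ?_
  · rintro (_ | x)
    exacts [hs, hT x]
  · by_cases hx : x ∈ K
    · obtain ⟨y, hy, u, hu, hux⟩ := mem_iUnion₂.1 (ht hx)
      exact ⟨some ⟨y, hy⟩, u, hu, hux⟩
    · exact ⟨none, hcover x hx⟩

omit [FiniteDimensional ℝ E] in
-- The points at finite distance from `x` form a nonempty clopen set.
theorem edist_lt_top [ConnectedSpace M] (g : SmoothMetric E M) (x y : M) : g.edist x y < ⊤ := by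
  have h1 : IsClopen {z | g.edist x z < ⊤} := by
    constructor
    · rw [← isOpen_compl_iff, isOpen_iff_mem_nhds]
      intro z hz
      filter_upwards [g.eventually_edist_lt z ENNReal.zero_lt_top] with w hw hw'
      refine hz ((g.edist_triangle x w z).trans_lt (ENNReal.add_lt_top.2 ⟨hw', ?_⟩))
      rwa [g.edist_comm]
    · rw [isOpen_iff_mem_nhds]
      intro z hz
      filter_upwards [g.eventually_edist_lt z ENNReal.zero_lt_top] with w hw
      exact (g.edist_triangle x z w).trans_lt (ENNReal.add_lt_top.2 ⟨hz, hw⟩)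
  have h2 := h1.eq_univ ⟨x, by simp [g.edist_self]⟩
  exact eq_univ_iff_forall.1 h2 y

omit [FiniteDimensional ℝ E] in
theorem exists_edist_le_of_isCompact [ConnectedSpace M] (g : SmoothMetric E M) {K : Set M}
    (hK : IsCompact K) (y : M) : ∃ D : ℝ, ∀ x ∈ K, g.edist x y ≤ ENNReal.ofReal D := by
  refine hK.induction_on (p := fun K => ∃ D : ℝ, ∀ x ∈ K, g.edist x y ≤ ENNReal.ofReal D)
    ⟨0, by simp⟩ (fun A B hAB ⟨D, hD⟩ => ⟨D, fun x hx => hD x (hAB hx)⟩)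
    (fun A B ⟨D, hD⟩ ⟨D', hD'⟩ => ⟨max D D', ?_⟩) fun x _ => ?_
  · rintro x (hx | hx)
    · exact (hD x hx).trans (ENNReal.ofReal_le_ofReal (le_max_left _ _))
    · exact (hD' x hx).trans (ENNReal.ofReal_le_ofReal (le_max_right _ _))
  · refine ⟨{z | g.edist x z < 1}, mem_nhdsWithin_of_mem_nhds (g.eventually_edist_lt x one_pos),
      (1 + g.edist x y).toReal, fun z hz => ?_⟩
    rw [ENNReal.ofReal_toReal (by simpa using (g.edist_lt_top x y).ne)]
    refine (g.edist_triangle z x y).trans ?_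
    gcongr
    rw [g.edist_comm]
    exact le_of_lt hz

end SmoothMetric

end UniformCharts

/-! ### From holomorphic to real smooth maps -/

section RestrictScalars

variable {E : Type*} [NormedAddCommGroup E] [NormedSpace ℝ E] [NormedSpace ℂ E]
  [IsScalarTower ℝ ℂ E] {F : Type*} [NormedAddCommGroup F] [NormedSpace ℝ F] [NormedSpace ℂ F]
  [IsScalarTower ℝ ℂ F] {M N : Type*} [TopologicalSpace M] [TopologicalSpace N] [ChartedSpace E M]
  [ChartedSpace F N]

theorem ContMDiffOn.restrict_scalars_real {f : M → N} {S : Set M}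
    (hf : ContMDiffOn 𝓘(ℂ, E) 𝓘(ℂ, F) ω f S) : ContMDiffOn 𝓘(ℝ, E) 𝓘(ℝ, F) ∞ f S := by
  intro x hx
  have h := contMDiffWithinAt_iff.1 (hf x hx)
  exact contMDiffWithinAt_iff.2 ⟨h.1, (h.2.restrict_scalars ℝ).of_le le_top⟩

end RestrictScalars

/-! ### The quotient map and separation of orbits -/

section Orbits

variable {n : ℕ} {G : Subgroup (Matrix.specialUnitaryGroup (Fin n) ℂ)}

theorem orbitMap_eq_iff {z w : CSpace n} : orbitMap G z = orbitMap G w ↔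
    ∃ A ∈ G, Matrix.toEuclideanLin (A : Matrix (Fin n) (Fin n) ℂ) z = w :=
  Quotient.eq (r := orbitSetoid G)

theorem continuous_orbitMap : Continuous (orbitMap G) := continuous_quotient_mk'

theorem orbitMap_surjective : Function.Surjective (orbitMap G) := Quotient.mk_surjective

theorem isOpenMap_orbitMap : IsOpenMap (orbitMap G) := by
  intro W hW
  refine isOpen_coinduced.2 ?_
  have h1 : orbitMap G ⁻¹' (orbitMap G '' W) =
      ⋃ A ∈ G, (Matrix.toEuclideanLin (A : Matrix (Fin n) (Fin n) ℂ)) ⁻¹' W := by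
    ext z
    simp only [mem_preimage, mem_image, mem_iUnion, exists_prop]
    constructor
    · rintro ⟨w, hw, hwz⟩
      obtain ⟨A, hA, h⟩ := orbitMap_eq_iff.1 hwz.symm
      exact ⟨A, hA, h ▸ hw⟩
    · rintro ⟨A, hA, h⟩
      exact ⟨_, h, (orbitMap_eq_iff.2 ⟨A, hA, rfl⟩).symm⟩
  change IsOpen (orbitMap G ⁻¹' (orbitMap G '' W))
  rw [h1]
  exact isOpen_biUnion fun A _ => hW.preimage (LinearMap.continuous_of_finiteDimensional _)

/-- For `A ≠ 1` freeness makes the linear map `1 - A` injective, hence bounded below; `δ` is the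
least of finitely many constants. -/
theorem exists_dist_ge_of_actsFreely [Finite G] (hfree : ActsFreelyOffZero G) :
    ∃ δ : ℝ, 0 < δ ∧ ∀ A ∈ G, A ≠ 1 → ∀ z : CSpace n,
      δ * ‖z‖ ≤ ‖z - Matrix.toEuclideanLin (A : Matrix (Fin n) (Fin n) ℂ) z‖ := by
  have h1 : ∀ A : G, ∃ δ : ℝ, 0 < δ ∧ ((A : Matrix.specialUnitaryGroup (Fin n) ℂ) ≠ 1 →
      ∀ z : CSpace n, δ * ‖z‖ ≤ ‖z - Matrix.toEuclideanLin
        ((A : Matrix.specialUnitaryGroup (Fin n) ℂ) : Matrix (Fin n) (Fin n) ℂ) z‖) := by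
    rintro ⟨A, hA⟩
    by_cases hA1 : A = 1
    · exact ⟨1, one_pos, fun h => absurd hA1 h⟩
    let L : CSpace n →ₗ[ℂ] CSpace n :=
      LinearMap.id - Matrix.toEuclideanLin (A : Matrix (Fin n) (Fin n) ℂ)
    have hker : LinearMap.ker L = ⊥ := by
      rw [LinearMap.ker_eq_bot']
      intro z hz
      by_contra hz0
      exact hA1 (hfree A hA z hz0 (sub_eq_zero.1 hz).symm)
    obtain ⟨K, hK, hL⟩ := L.exists_antilipschitzWith hker
    refine ⟨(K : ℝ)⁻¹, by positivity, fun _ z => ?_⟩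
    have h2 := hL.le_mul_dist z 0
    rw [map_zero, dist_zero_right, dist_zero_right] at h2
    rw [inv_mul_le_iff₀ (by positivity)]
    exact h2
  choose δ hδ h using h1
  have := Fintype.ofFinite G
  refine ⟨Finset.univ.inf' ⟨1, Finset.mem_univ _⟩ δ, (Finset.lt_inf'_iff _).2 fun A _ => hδ A,
    fun A hA hA1 z => le_trans ?_ (h ⟨A, hA⟩ hA1 z)⟩
  gcongr
  exact Finset.inf'_le _ (Finset.mem_univ _)

end Orbits

/-! ### The end of an ALE manifold as a uniform patch -/

section Ends

variable {n : ℕ} {G : Subgroup (Matrix.specialUnitaryGroup (Fin n) ℂ)}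
  {X : Type*} [TopologicalSpace X] [T2Space X] [ChartedSpace (CSpace n) X]

omit [T2Space X] [ChartedSpace (CSpace n) X] in
theorem isCompact_preimage_closedBall {p : X → OrbitSpace G} (hp : IsProperMap p) (r : ℝ) :
    IsCompact (p ⁻¹' (orbitMap G '' Metric.closedBall 0 r)) :=
  hp.isCompact_preimage ((isCompact_closedBall 0 r).image continuous_orbitMap)

/-- A holomorphic lift of the quotient map to a resolution is a local inverse of the resolution. -/
theorem IsResolution.lift_eq {p : X → OrbitSpace G} (hp : IsResolution G p) {V : Set (CSpace n)}
    (hV : IsOpen V) {s : CSpace n → X} (hs : IsHolomorphicLift G p V s) {x : X} {z : CSpace n}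
    (hz : z ∈ V) (hx : p x = orbitMap G z) : s z = x := by
  obtain ⟨U, -, -, hdense, t, -, ht⟩ := hp.bimeromorphic
  -- If `s z ≠ x`, separate them by disjoint `B` and `A`. As the quotient map is open, the points of
  -- `A` lying over the image of `V ∩ s⁻¹ B` form an open set containing `x`, so by density it has a
  -- point `y` over `U`. There the inverse `t` forces `y = s w` with `s w ∈ B`, against
  -- disjointness.
  by_contra hne
  obtain ⟨B, A, hB, hA, hsB, hxA, hBA⟩ := t2_separation hne
  have hW : IsOpen (V ∩ s ⁻¹' B) := hs.1.continuousOn.isOpen_inter_preimage hV hB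
  have hO : IsOpen (p ⁻¹' (orbitMap G '' (V ∩ s ⁻¹' B)) ∩ A) :=
    ((isOpenMap_orbitMap _ hW).preimage hp.holomorphic.1).inter hA
  obtain ⟨y, ⟨⟨w, ⟨hwV, hwB⟩, hw⟩, hyA⟩, hyU⟩ :=
    hdense.inter_open_nonempty _ hO ⟨x, ⟨z, ⟨hz, hsB⟩, hx.symm⟩, hxA⟩
  have h1 : t w = y := ht y w hyU hw
  have h2 : t w = s w := ht (s w) w (by rw [mem_preimage, ← hw] at hyU; rwa [hs.2 w hwV])
    (hs.2 w hwV).symm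
  exact disjoint_left.1 hBA hwB (h2 ▸ h1 ▸ hyA)

variable [IsManifold 𝓘(ℂ, CSpace n) ω X]

omit [T2Space X] in
/-- The lift of an ALE metric to the complement of a large ball in `ℂ^n` is a uniform patch. -/
theorem isUniformPatch_of_decays [Finite G] (hfree : ActsFreelyOffZero G) {p : X → OrbitSpace G}
    {g : SmoothMetric (CSpace n) X} {R : ℝ} (hR : 0 < R) {s : CSpace n → X}
    (hs : IsHolomorphicLift G p {z | R < ‖z‖} s)
    (hdecay : DecaysWithDerivatives (fun z => g.pullback s z - euclideanMetric n) R (2 * n)) :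
    ∃ R' : ℝ, R ≤ R' ∧ g.IsUniformPatch s {z | R' < ‖z‖} {z | R' + 1 < ‖z‖} := by
  obtain ⟨C₀, hC₀⟩ := hdecay 0
  -- For `|u| > R' ≥ 1` all positive powers of `|u|⁻¹` are at most `|u|⁻¹`, and `R' ≥ 2 C₀` makes
  -- the deviation from the Euclidean metric at most `1/2`, whence coercivity with constant `1/2`.
  set R' := max (max R 1) (2 * C₀) with hR'
  have hRR' : R ≤ R' := (le_max_left _ _).trans (le_max_left _ _)
  have h1R' : 1 ≤ R' := (le_max_right _ _).trans (le_max_left _ _)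
  have hC₀R' : 2 * C₀ ≤ R' := le_max_right _ _
  have hopen : ∀ r : ℝ, IsOpen {z : CSpace n | r < ‖z‖} := fun r =>
    isOpen_lt continuous_const continuous_norm
  have hsub : {z : CSpace n | R' < ‖z‖} ⊆ {z | R < ‖z‖} := fun z hz => hRR'.trans_lt hz
  have hsm : ContMDiffOn 𝓘(ℝ, CSpace n) 𝓘(ℝ, CSpace n) ∞ s {z | R' < ‖z‖} :=
    hs.1.restrict_scalars_real.mono hsub
  have hcoer : ∀ u ∈ {z : CSpace n | R' < ‖z‖}, ∀ v, 1 / 2 * ‖v‖ ^ 2 ≤ g.pullback s u v v := by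
    intro u hu v
    have hu' : R' < ‖u‖ := hu
    have hupos : 0 < ‖u‖ := by linarith
    have hn : 1 ≤ 2 * n + 0 := by
      rcases Nat.eq_zero_or_pos n with rfl | hn
      · simp [Subsingleton.elim u 0] at hupos
      · omega
    have h1 := hC₀ u (hsub hu)
    rw [norm_iteratedFDeriv_zero] at h1
    have hinv1 : ‖u‖⁻¹ ≤ 1 := inv_le_one_of_one_le₀ (by linarith)
    have h2 : ‖u‖⁻¹ ^ (2 * n + 0) ≤ ‖u‖⁻¹ := by
      simpa using pow_le_pow_of_le_one (by positivity) hinv1 hn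
    have hC₀nn : 0 ≤ C₀ := by
      have h3 : 0 < ‖u‖⁻¹ ^ (2 * n + 0) := by positivity
      exact nonneg_of_mul_nonneg_left ((norm_nonneg _).trans h1) h3
    have h3 : ‖g.pullback s u - euclideanMetric n‖ ≤ 1 / 2 := by
      refine h1.trans ((mul_le_mul_of_nonneg_left h2 hC₀nn).trans ?_)
      rw [← div_eq_mul_inv, div_le_iff₀ hupos]
      linarith
    have h4 : ‖(g.pullback s u - euclideanMetric n) v v‖ ≤ 1 / 2 * ‖v‖ ^ 2 := by
      refine ((g.pullback s u - euclideanMetric n).le_opNorm₂ v v).trans ?_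
      rw [mul_assoc, ← sq]
      gcongr
    have h5 : euclideanMetric n v v = ‖v‖ ^ 2 := real_inner_self_eq_norm_sq v
    have h6 : (g.pullback s u - euclideanMetric n) v v = g.pullback s u v v - ‖v‖ ^ 2 := by
      rw [← h5]
      rfl
    rw [h6, Real.norm_eq_abs] at h4
    have := (abs_le.1 h4).1
    linarith
  have hpatch : g.IsPatch s {z | R' < ‖z‖} :=
    ⟨hopen R', hsm, fun u hu v hv => lt_of_lt_of_le
      (by have := norm_pos_iff.2 hv; positivity) (hcoer u hu v)⟩
  refine ⟨R', hRR', hpatch, ⟨1 / 2, by norm_num, hcoer⟩, ?_, ?_⟩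
  · have h1 : HasBoundedDerivs {z : CSpace n | R' < ‖z‖} (fun _ => 1)
        (fun z => g.pullback s z - euclideanMetric n) := by
      refine ⟨hpatch.isMetricOn.contDiffOn.sub contDiffOn_const, fun k => ?_⟩
      obtain ⟨C, hC⟩ := hdecay k
      refine ⟨|C|, fun u hu => (hC u (hsub hu)).trans ?_⟩
      have hu' : R' < ‖u‖ := hu
      have hinv1 : ‖u‖⁻¹ ≤ 1 := inv_le_one_of_one_le₀ (by linarith)
      have h2 : ‖u‖⁻¹ ^ (2 * n + k) ≤ 1 := pow_le_one₀ (by positivity) hinv1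
      exact mul_le_mul (le_abs_self C) h2 (by positivity) (abs_nonneg C)
    have h2 := h1.add (hopen R') (HasBoundedDerivs.const (euclideanMetric n))
    simpa using h2
  · obtain ⟨δ, hδ, hδG⟩ := exists_dist_ge_of_actsFreely hfree
    have hR'pos : 0 < R' := by linarith
    -- Radius at most `1` keeps the ball in `{|z| > R'}`. Radius at most `δR'/2` makes any two of
    -- its points closer than `δR' < δ|z|`, so two of them in one orbit coincide.
    refine ⟨min 1 (δ * R' / 2), by positivity, fun u hu => ?_⟩
    have hball : Metric.ball u (min 1 (δ * R' / 2)) ⊆ {z | R' < ‖z‖} := by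
      intro z hz
      have h1 : ‖z - u‖ < 1 := (mem_ball_iff_norm.1 hz).trans_le (min_le_left _ _)
      have h2 : R' + 1 < ‖u‖ := hu
      have h3 := norm_sub_norm_le u z
      rw [norm_sub_rev] at h3
      change R' < ‖z‖
      linarith
    refine ⟨hball, fun z hz w hw hzw => ?_⟩
    have h1 : orbitMap G z = orbitMap G w := by
      rw [← hs.2 z (hsub (hball hz)), ← hs.2 w (hsub (hball hw)), hzw]
    obtain ⟨A, hA, hAz⟩ := orbitMap_eq_iff.1 h1
    by_cases hA1 : A = 1
    · subst hA1
      simpa using hAz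
    · have h2 := hδG A hA hA1 z
      rw [hAz, ← dist_eq_norm] at h2
      have h3 : dist z w < δ * R' / 2 + δ * R' / 2 := by
        refine (dist_triangle_right z w u).trans_lt (add_lt_add ?_ ?_)
        · exact (Metric.mem_ball.1 hz).trans_le (min_le_right _ _)
        · exact (Metric.mem_ball.1 hw).trans_le (min_le_right _ _)
      have h4 : δ * R' < δ * ‖z‖ := mul_lt_mul_of_pos_left (hball hz) hδ
      linarith

/-- The end of an ALE manifold is covered by a uniform patch. -/
theorem IsALEKaehlerMetric.exists_isUniformPatch [Finite G] (hfree : ActsFreelyOffZero G)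
    {p : X → OrbitSpace G} (hp : IsResolution G p) {g : SmoothMetric (CSpace n) X}
    (hg : IsALEKaehlerMetric G p g) : ∃ (R : ℝ) (s : CSpace n → X),
      g.IsUniformPatch s {z | R < ‖z‖} {z | R + 1 < ‖z‖} ∧
      (∀ z, R < ‖z‖ → p (s z) = orbitMap G z) ∧
      ∀ x z, R < ‖z‖ → p x = orbitMap G z → s z = x := by
  obtain ⟨R, hR, s, hs, hdecay⟩ := hg.asymptotics
  obtain ⟨R', hRR', h⟩ := isUniformPatch_of_decays hfree hR hs hdecay
  exact ⟨R', s, h, fun z hz => hs.2 z (hRR'.trans_lt hz), fun x z hz hx =>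
    hp.lift_eq (isOpen_lt continuous_const continuous_norm) hs (hRR'.trans_lt hz) hx⟩

theorem IsALEKaehlerMetric.hasBoundedGeometry [Finite G] (hfree : ActsFreelyOffZero G)
    {p : X → OrbitSpace G} (hp : IsResolution G p) {g : SmoothMetric (CSpace n) X}
    (hg : IsALEKaehlerMetric G p g) : g.HasBoundedGeometry := by
  obtain ⟨R, s, hs, -, hinv⟩ := hg.exists_isUniformPatch hfree hp
  refine hs.hasBoundedGeometry (isCompact_preimage_closedBall hp.proper (R + 1)) fun x hx => ?_
  obtain ⟨z, hz⟩ := orbitMap_surjective (p x)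
  have hzR : R + 1 < ‖z‖ := by
    by_contra! hle
    exact hx ⟨z, by simpa using hle, hz⟩
  exact ⟨z, hzR, hinv x z (by linarith) hz.symm⟩

end Ends

/-! ### Quasi-homogeneous functions -/

section QuasiHomogeneous

variable {n : ℕ}

/-- The map `z ↦ (t^{q₁} z₁, …, t^{q_n} z_n)`. -/
def weightedScale (q : Fin n → ℝ) (t : ℝ) : CSpace n →L[ℝ] CSpace n :=
  LinearMap.toContinuousLinearMap
    { toFun := fun z => WithLp.toLp 2 fun i => (t ^ q i) • z i
      map_add' := fun z w => by ext i; simp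
      map_smul' := fun c z => by ext i; simp [mul_left_comm] }

@[simp] theorem weightedScale_apply (q : Fin n → ℝ) (t : ℝ) (z : CSpace n) (i : Fin n) :
    weightedScale q t z i = (t ^ q i) • z i := rfl

theorem weightedScale_weightedScale {q : Fin n → ℝ} {t t' : ℝ} (ht : 0 < t) (ht' : 0 < t')
    (z : CSpace n) : weightedScale q t (weightedScale q t' z) = weightedScale q (t * t') z := by
  ext i
  simp only [weightedScale_apply, smul_smul, Real.mul_rpow ht.le ht'.le]

theorem weightedScale_one (q : Fin n → ℝ) (z : CSpace n) : weightedScale q 1 z = z := by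
  ext i
  simp

theorem norm_weightedScale_le {q : Fin n → ℝ} {t : ℝ} (ht : 0 < t) {M : ℝ} (hM : 0 ≤ M)
    (h : ∀ i, t ^ q i ≤ M) : ‖weightedScale q t‖ ≤ M := by
  refine ContinuousLinearMap.opNorm_le_bound _ hM fun z => ?_
  rw [EuclideanSpace.norm_eq, EuclideanSpace.norm_eq, ← Real.sqrt_sq hM, ← Real.sqrt_mul (sq_nonneg M)]
  refine Real.sqrt_le_sqrt ?_
  rw [Finset.mul_sum]
  refine Finset.sum_le_sum fun i _ => ?_
  rw [weightedScale_apply, norm_smul, mul_pow, Real.norm_of_nonneg (Real.rpow_nonneg ht.le _)]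
  gcongr
  exact h i

/-- The weighted norm `∑ |z_i|^{1/q_i}`. -/
def weightedNorm (q : Fin n → ℝ) (z : CSpace n) : ℝ := ∑ i, ‖z i‖ ^ (q i)⁻¹

variable {q : Fin n → ℝ}

theorem continuous_weightedNorm (hq : ∀ i, 0 < q i) : Continuous (weightedNorm q) :=
  continuous_finsetSum _ fun i _ => Continuous.rpow_const (by fun_prop)
    fun _ => Or.inr (inv_nonneg.2 (hq i).le)

theorem weightedNorm_weightedScale (hq : ∀ i, 0 < q i) {t : ℝ} (ht : 0 < t) (z : CSpace n) :
    weightedNorm q (weightedScale q t z) = t * weightedNorm q z := by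
  rw [weightedNorm, weightedNorm, Finset.mul_sum]
  refine Finset.sum_congr rfl fun i _ => ?_
  rw [weightedScale_apply, norm_smul, Real.norm_of_nonneg (Real.rpow_nonneg ht.le _),
    Real.mul_rpow (Real.rpow_nonneg ht.le _) (norm_nonneg _), Real.rpow_rpow_inv ht.le (hq i).ne']

/-- `|z_i| ≤ c^{q_i} ≤ c`, as `c ≥ 1` and `q_i ≤ 1`. Hence the unit set is compact, and the weighted
norm tends to infinity with `‖z‖`. -/
theorem norm_le_of_weightedNorm_le (hq : ∀ i, 0 < q i ∧ q i ≤ 1 / 2) {c : ℝ} (hc : 1 ≤ c)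
    {z : CSpace n} (hz : weightedNorm q z ≤ c) : ‖z‖ ≤ √n * c := by
  have h0 : 0 ≤ c := by linarith
  have h1 : ∀ i, ‖z i‖ ≤ c := by
    intro i
    have h2 : ‖z i‖ ^ (q i)⁻¹ ≤ c := (Finset.single_le_sum (f := fun i => ‖z i‖ ^ (q i)⁻¹)
      (fun j _ => Real.rpow_nonneg (norm_nonneg _) _) (Finset.mem_univ i)).trans hz
    have h3 : ‖z i‖ ≤ c ^ q i := by
      rw [← Real.rpow_inv_rpow (norm_nonneg (z i)) (hq i).1.ne']
      exact Real.rpow_le_rpow (Real.rpow_nonneg (norm_nonneg _) _) h2 (hq i).1.le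
    exact h3.trans (Real.rpow_le_self_of_one_le hc (by linarith [(hq i).2]))
  rw [EuclideanSpace.norm_eq, ← Real.sqrt_sq h0, ← Real.sqrt_mul (Nat.cast_nonneg n)]
  refine Real.sqrt_le_sqrt ((Finset.sum_le_sum fun i _ => pow_le_pow_left₀ (norm_nonneg _) (h1 i) 2).trans ?_)
  simp

theorem isCompact_weightedNorm_eq_one (hq : ∀ i, 0 < q i ∧ q i ≤ 1 / 2) :
    IsCompact {z : CSpace n | weightedNorm q z = 1} := by
  refine Metric.isCompact_of_isClosed_isBounded
    (isClosed_eq (continuous_weightedNorm fun i => (hq i).1) continuous_const) ?_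
  refine (Metric.isBounded_closedBall (x := (0 : CSpace n)) (r := √n * 1)).subset fun z hz => ?_
  rw [mem_closedBall_zero_iff]
  exact norm_le_of_weightedNorm_le hq le_rfl (le_of_eq hz)

theorem ne_zero_of_weightedNorm_eq_one (hq : ∀ i, 0 < q i) {z : CSpace n}
    (hz : weightedNorm q z = 1) : z ≠ 0 := by
  rintro rfl
  have h1 : weightedNorm q (0 : CSpace n) = 0 :=
    Finset.sum_eq_zero fun i _ => by simp [Real.zero_rpow (inv_ne_zero (hq i).ne')]
  linarith

theorem tendsto_weightedScale_zero (hq : ∀ i, 0 < q i) (z : CSpace n) :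
    Tendsto (fun t => weightedScale q t z) (𝓝[>] 0) (𝓝 0) := by
  have h1 : Tendsto (fun t : ℝ => WithLp.toLp 2 fun i => (t ^ q i) • z i) (𝓝[>] 0)
      (𝓝 (WithLp.toLp 2 (0 : Fin n → ℂ))) := by
    refine ((PiLp.continuous_toLp 2 _).tendsto _).comp (tendsto_pi_nhds.2 fun i => ?_)
    have h2 : Tendsto (fun t : ℝ => t ^ q i) (𝓝[>] 0) (𝓝 0) := by
      have h3 := (Real.continuousAt_rpow_const 0 (q i) (Or.inr (hq i).le)).tendsto
      rw [Real.zero_rpow (hq i).ne'] at h3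
      exact h3.mono_left nhdsWithin_le_nhds
    simpa using h2.smul_const (z i)
  exact h1

/-- `F` is quasi-homogeneous: `F(t^{q₁} z₁, …, t^{q_n} z_n) = t F(z)`. -/
def IsQuasiHomogeneous (q : Fin n → ℝ) (F : CSpace n → ℂ) : Prop :=
  ∀ t : ℝ, 0 < t → ∀ z, F (weightedScale q t z) = t • F z

variable {F : CSpace n → ℂ}

theorem IsQuasiHomogeneous.iteratedFDeriv_comp (hF : IsQuasiHomogeneous q F)
    (hsm : ContDiff ℝ ∞ F) {t : ℝ} (ht : 0 < t) (j : ℕ) (z : CSpace n) :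
    (iteratedFDeriv ℝ j F (weightedScale q t z)).compContinuousLinearMap
      (fun _ => weightedScale q t) = t • iteratedFDeriv ℝ j F z := by
  have hj : ContDiff ℝ j F := hsm.of_le (by exact_mod_cast le_top)
  rw [← ContinuousLinearMap.iteratedFDeriv_comp_right _ hj z le_rfl,
    ← iteratedFDeriv_const_smul_apply hj.contDiffAt]
  congr 1
  ext z
  exact hF t ht z

/-- Each `z` with positive weighted norm is a rescaling of a unit vector. -/
theorem exists_weightedScale_eq (hq : ∀ i, 0 < q i) {z : CSpace n} (hz : 0 < weightedNorm q z) :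
    ∃ y, weightedNorm q y = 1 ∧ weightedScale q (weightedNorm q z) y = z ∧
      weightedScale q (weightedNorm q z)⁻¹ z = y := by
  refine ⟨weightedScale q (weightedNorm q z)⁻¹ z, ?_, ?_, rfl⟩
  · rw [weightedNorm_weightedScale hq (inv_pos.2 hz), inv_mul_cancel₀ hz.ne']
  · rw [weightedScale_weightedScale hz (inv_pos.2 hz), mul_inv_cancel₀ hz.ne', weightedScale_one]

/-- Write `z` as the rescaling by `t = N(z)` of a unit point `y`. Then `t⁻¹ D^{j+1}F(z)` is
`D^{j+1}F(y)` composed with the scaling by `t⁻¹`, whose norm is at most `t^{-a}`. -/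
theorem IsQuasiHomogeneous.norm_iteratedFDeriv_le (hF : IsQuasiHomogeneous q F)
    (hsm : ContDiff ℝ ∞ F) (hq : ∀ i, 0 < q i ∧ q i ≤ 1 / 2) {a : ℝ} (ha : 0 < a)
    (haq : ∀ i, a ≤ q i) (j : ℕ) : ∃ C : ℝ, ∀ z, 1 < weightedNorm q z →
      ‖iteratedFDeriv ℝ (j + 1) F z‖ ≤ C * weightedNorm q z ^ (1 - a) := by
  have hcont : Continuous (iteratedFDeriv ℝ (j + 1) F) :=
    hsm.continuous_iteratedFDeriv (by exact_mod_cast le_top)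
  obtain ⟨C, hC⟩ := (isCompact_weightedNorm_eq_one hq).exists_bound_of_continuousOn hcont.continuousOn
  refine ⟨C, fun z hz => ?_⟩
  have hq' : ∀ i, 0 < q i := fun i => (hq i).1
  have ht0 : 0 < weightedNorm q z := by linarith
  obtain ⟨y, hy, -, hyz⟩ := exists_weightedScale_eq hq' ht0
  set t := weightedNorm q z with ht
  have hkey := hF.iteratedFDeriv_comp hsm (inv_pos.2 ht0) (j + 1) z
  rw [hyz] at hkey
  have hL : ‖weightedScale q t⁻¹‖ ≤ t ^ (-a) := by
    refine norm_weightedScale_le (inv_pos.2 ht0) (by positivity) fun i => ?_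
    rw [Real.inv_rpow ht0.le, ← Real.rpow_neg ht0.le]
    exact Real.rpow_le_rpow_of_exponent_le hz.le (neg_le_neg (haq i))
  have hL1 : t ^ (-a) ≤ 1 := Real.rpow_le_one_of_one_le_of_nonpos hz.le (by linarith)
  have h1 : t⁻¹ * ‖iteratedFDeriv ℝ (j + 1) F z‖ ≤ C * t ^ (-a) := by
    calc t⁻¹ * ‖iteratedFDeriv ℝ (j + 1) F z‖ = ‖t⁻¹ • iteratedFDeriv ℝ (j + 1) F z‖ := by
          rw [norm_smul, Real.norm_of_nonneg (by positivity)]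
      _ ≤ ‖iteratedFDeriv ℝ (j + 1) F y‖ * ∏ _i : Fin (j + 1), ‖weightedScale q t⁻¹‖ := by
          rw [← hkey]
          exact ContinuousMultilinearMap.norm_compContinuousLinearMap_le _ _
      _ ≤ C * t ^ (-a) := by
          have h2 := hC y hy
          -- Only one of the `j + 1 ≥ 1` factors is kept; the others are at most `1`. This gives the
          -- same exponent for all orders.
          have h3 : ‖weightedScale q t⁻¹‖ ^ (j + 1) ≤ t ^ (-a) := by
            calc ‖weightedScale q t⁻¹‖ ^ (j + 1) ≤ ‖weightedScale q t⁻¹‖ :=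
                  pow_le_of_le_one (norm_nonneg _) (hL.trans hL1) (Nat.succ_ne_zero j)
              _ ≤ _ := hL
          rw [Finset.prod_const, Finset.card_univ, Fintype.card_fin]
          exact mul_le_mul h2 h3 (by positivity) ((norm_nonneg _).trans h2)
  rw [inv_mul_le_iff₀ ht0] at h1
  refine h1.trans (le_of_eq ?_)
  rw [sub_eq_add_neg, Real.rpow_add ht0, Real.rpow_one]
  ring

/-- `t dF(y)` is `dF(z)` composed with the scaling by `t`, whose norm is at most `t^{1/2}` because
`q_i ≤ 1/2`; on the compact unit set `|dF(y)|` is bounded below. -/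
theorem IsQuasiHomogeneous.le_norm_fderiv (hF : IsQuasiHomogeneous q F)
    (hsm : ContDiff ℝ ∞ F) (hq : ∀ i, 0 < q i ∧ q i ≤ 1 / 2) (hcrit : ∀ z ≠ 0, fderiv ℝ F z ≠ 0) :
    ∃ c : ℝ, 0 < c ∧ ∀ z, 1 < weightedNorm q z →
      c * weightedNorm q z ^ (1 / 2 : ℝ) ≤ ‖fderiv ℝ F z‖ := by
  have hq' : ∀ i, 0 < q i := fun i => (hq i).1
  have hcont : Continuous (fderiv ℝ F) := hsm.continuous_fderiv (by simp)
  obtain ⟨c, hc, hle⟩ := (isCompact_weightedNorm_eq_one hq).exists_forall_le' (a := 0)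
    hcont.norm.continuousOn
    fun z hz => norm_pos_iff.2 (hcrit z (ne_zero_of_weightedNorm_eq_one hq' hz))
  refine ⟨c, hc, fun z hz => ?_⟩
  have ht0 : 0 < weightedNorm q z := by linarith
  obtain ⟨y, hy, hyz, -⟩ := exists_weightedScale_eq hq' ht0
  set t := weightedNorm q z with ht
  have hkey := hF.iteratedFDeriv_comp hsm ht0 1 y
  rw [hyz] at hkey
  have hL : ‖weightedScale q t‖ ≤ t ^ (1 / 2 : ℝ) :=
    norm_weightedScale_le ht0 (by positivity) fun i =>
      Real.rpow_le_rpow_of_exponent_le hz.le (hq i).2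
  have h1 : t * ‖fderiv ℝ F y‖ ≤ ‖fderiv ℝ F z‖ * t ^ (1 / 2 : ℝ) := by
    calc t * ‖fderiv ℝ F y‖ = ‖t • iteratedFDeriv ℝ 1 F y‖ := by
          rw [norm_smul, Real.norm_of_nonneg ht0.le, norm_iteratedFDeriv_one]
      _ ≤ ‖iteratedFDeriv ℝ 1 F z‖ * ∏ _i : Fin 1, ‖weightedScale q t‖ := by
          rw [← hkey]
          exact ContinuousMultilinearMap.norm_compContinuousLinearMap_le _ _
      _ ≤ _ := by
          rw [norm_iteratedFDeriv_one, Fin.prod_univ_one]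
          gcongr
  have h2 : t = t ^ (1 / 2 : ℝ) * t ^ (1 / 2 : ℝ) := by
    rw [← Real.rpow_add ht0]
    norm_num
  have h3 : c * t ≤ ‖fderiv ℝ F z‖ * t ^ (1 / 2 : ℝ) := by
    refine le_trans ?_ h1
    rw [mul_comm]
    exact mul_le_mul_of_nonneg_left (hle y hy) ht0.le
  have h4 : 0 < t ^ (1 / 2 : ℝ) := by positivity
  refine le_of_mul_le_mul_right ?_ h4
  rw [mul_assoc, ← h2]
  exact h3

/-- Critical points are preserved by the scalings, which contract any point to the origin, so a
nonzero one would contradict isolation. -/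
theorem IsQuasiHomogeneous.fderiv_ne_zero (hF : IsQuasiHomogeneous q F) (hsm : ContDiff ℝ ∞ F)
    (hq : ∀ i, 0 < q i) (hcrit : ∀ᶠ z in 𝓝[≠] 0, fderiv ℝ F z ≠ 0) {z : CSpace n} (hz : z ≠ 0) :
    fderiv ℝ F z ≠ 0 := by
  intro h0
  have hinv : ∀ t : ℝ, 0 < t → ∀ w, weightedScale q t (weightedScale q t⁻¹ w) = w := fun t ht w => by
    rw [weightedScale_weightedScale ht (inv_pos.2 ht), mul_inv_cancel₀ ht.ne', weightedScale_one]
  have h1 : ∀ t : ℝ, 0 < t → fderiv ℝ F (weightedScale q t z) = 0 := by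
    intro t ht
    have h2 := hF.iteratedFDeriv_comp hsm ht 1 z
    ext w
    have h3 := DFunLike.congr_fun h2 fun _ => weightedScale q t⁻¹ w
    rw [ContinuousMultilinearMap.compContinuousLinearMap_apply, _root_.smul_apply,
      iteratedFDeriv_one_apply, iteratedFDeriv_one_apply, hinv t ht, h0] at h3
    simpa using h3
  have h2 : Tendsto (fun t => weightedScale q t z) (𝓝[>] 0) (𝓝[≠] 0) := by
    refine tendsto_nhdsWithin_iff.2 ⟨tendsto_weightedScale_zero hq z, ?_⟩
    filter_upwards [self_mem_nhdsWithin] with t ht h3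
    refine hz ?_
    have h4 := weightedScale_weightedScale (inv_pos.2 ht) ht z (q := q)
    rw [inv_mul_cancel₀ (ne_of_gt ht), weightedScale_one] at h4
    rw [← h4, show weightedScale q t z = 0 from h3, map_zero]
  obtain ⟨t, ht, ht'⟩ := ((h2.eventually hcrit).and self_mem_nhdsWithin).exists
  exact ht (h1 t ht')

end QuasiHomogeneous

/-! ### Polynomials as functions on `ℂ^n` -/

section Polynomials

variable {n : ℕ}

theorem hasFDerivAt_eval_mvPolynomial (f : MvPolynomial (Fin n) ℂ) (z : CSpace n) :
    HasFDerivAt (fun z : CSpace n => f.eval z.ofLp)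
      (∑ i, (f.pderiv i).eval z.ofLp • (EuclideanSpace.proj i : CSpace n →L[ℂ] ℂ)) z := by
  induction f using MvPolynomial.induction_on with
  | C a => simpa using hasFDerivAt_const a z
  | add p q hp hq =>
    simp only [map_add, add_smul, Finset.sum_add_distrib]
    exact hp.add hq
  | mul_X p i hp =>
    have h1 := hp.mul (EuclideanSpace.proj i : CSpace n →L[ℂ] ℂ).hasFDerivAt
    simp only [map_mul, MvPolynomial.eval_X]
    refine h1.congr_fderiv ?_
    ext v
    simp only [Derivation.leibniz, MvPolynomial.pderiv_X, map_add, map_mul, smul_eq_mul,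
      MvPolynomial.eval_X, add_smul, Finset.sum_add_distrib, Pi.single_apply]
    simp [Finset.mul_sum, mul_assoc, apply_ite]

theorem analyticOnNhd_eval_mvPolynomial (f : MvPolynomial (Fin n) ℂ) (S : Set (CSpace n)) :
    AnalyticOnNhd ℂ (fun z : CSpace n => f.eval z.ofLp) S :=
  (AnalyticOnNhd.eval_continuousLinearMap' (fun i => (EuclideanSpace.proj i : CSpace n →L[ℂ] ℂ))
    f).mono (subset_univ S)

theorem contDiff_eval_mvPolynomial (f : MvPolynomial (Fin n) ℂ) :
    ContDiff ℝ ∞ (fun z : CSpace n => f.eval z.ofLp) := by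
  have h := (analyticOnNhd_eval_mvPolynomial f univ).contDiffOn (n := ∞) uniqueDiffOn_univ
  exact (contDiffOn_univ.1 h).restrict_scalars ℝ

theorem isQuasiHomogeneous_eval {f : MvPolynomial (Fin n) ℂ} {q : Fin n → ℚ}
    (hf : f.IsWeightedHomogeneous q 1) :
    IsQuasiHomogeneous (fun i => (q i : ℝ)) (fun z : CSpace n => f.eval z.ofLp) := by
  intro t ht z
  simp only [MvPolynomial.eval_eq']
  rw [Finset.smul_sum]
  refine Finset.sum_congr rfl fun d hd => ?_
  have h1 := hf (MvPolynomial.mem_support_iff.1 hd)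
  rw [Finsupp.weight_apply, Finsupp.sum_fintype _ _ (by simp)] at h1
  have h2 : ∏ i, (((t ^ (q i : ℝ) : ℝ) : ℂ)) ^ d i = (t : ℂ) := by
    have h3 : ∏ i, (t ^ (q i : ℝ)) ^ d i = t := by
      have h4 : ∀ i, (t ^ (q i : ℝ)) ^ d i = t ^ ((d i • q i : ℚ) : ℝ) := by
        intro i
        rw [← Real.rpow_natCast, ← Real.rpow_mul ht.le]
        congr 1
        push_cast [nsmul_eq_mul]
        ring
      simp only [h4]
      rw [← Real.rpow_sum_of_pos ht, ← Rat.cast_sum, h1]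
      simp
    exact_mod_cast congrArg (fun x : ℝ => (x : ℂ)) h3
  simp only [weightedScale_apply, Complex.real_smul, mul_pow, Finset.prod_mul_distrib]
  rw [h2]
  ring

theorem eventually_fderiv_ne_zero {f : MvPolynomial (Fin n) ℂ}
    (hf : HasIsolatedCriticalPointAtZero f) :
    ∀ᶠ z in 𝓝[≠] (0 : CSpace n), fderiv ℝ (fun z : CSpace n => f.eval z.ofLp) z ≠ 0 := by
  filter_upwards [hf.2] with z ⟨i, hi⟩ h0
  refine hi ?_
  have h1 := ((hasFDerivAt_eval_mvPolynomial f z).restrictScalars ℝ).fderiv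
  rw [h0] at h1
  have h2 := DFunLike.congr_fun h1 (EuclideanSpace.single i (1 : ℂ))
  simpa [_root_.sum_apply, Pi.single_apply] using h2.symm

end Polynomials

/-! ### Covariant derivatives of functions -/

section FunctionDerivatives

variable {E : Type*} [NormedAddCommGroup E] [NormedSpace ℝ E]

theorem nabla_uncurry0 {h : E → E →L[ℝ] E →L[ℝ] ℝ} {F : E → ℂ} {u : E}
    (hF : DifferentiableAt ℝ F u) :
    nabla h (fun y => ContinuousMultilinearMap.uncurry0 ℝ E (F y)) u =
      (continuousMultilinearCurryFin1 ℝ E ℂ).symm (fderiv ℝ F u) := by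
  ext v
  have h1 : HasFDerivAt (fun y => ContinuousMultilinearMap.uncurry0 ℝ E (F y))
      (((continuousMultilinearCurryFin0 ℝ E ℂ).symm.toContinuousLinearEquiv : ℂ →L[ℝ] _) ∘L
        fderiv ℝ F u) u :=
    (continuousMultilinearCurryFin0 ℝ E ℂ).symm.toContinuousLinearEquiv.hasFDerivAt.comp u
      hF.hasFDerivAt
  rw [nabla_apply, h1.fderiv]
  simp

variable [FiniteDimensional ℝ E]

/-- The weight is asked of `dF` only, because `F` grows faster than its derivatives. The induction
can start at `∇F = dF`, where no Christoffel symbol enters. -/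
theorem HasBoundedDerivs.iterNabla_uncurry0 {h : E → E →L[ℝ] E →L[ℝ] ℝ} {S : Set E} {w : E → ℝ}
    (hh : IsMetricOn h S) (hb : HasBoundedDerivs S (fun _ => 1) h) {c : ℝ} (hc : 0 < c)
    (hcoer : ∀ u ∈ S, ∀ v, c * ‖v‖ ^ 2 ≤ h u v v) {F : E → ℂ} (hF : ContDiffOn ℝ ∞ F S)
    (hw : HasBoundedDerivs S w (_root_.fderiv ℝ F)) (k : ℕ) :
    HasBoundedDerivs S w
      (_root_.iterNabla h (fun y => ContinuousMultilinearMap.uncurry0 ℝ E (F y)) (k + 1)) := by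
  induction k with
  | zero =>
    refine (hw.clm_comp hh.isOpen ((continuousMultilinearCurryFin1 ℝ E
      ℂ).symm.toContinuousLinearEquiv : (E →L[ℝ] ℂ) →L[ℝ] _)).congr hh.isOpen fun u hu => ?_
    exact nabla_uncurry0 ((hF.contDiffAt (hh.isOpen.mem_nhds hu)).differentiableAt (by simp))
  | succ k ih => exact HasBoundedDerivs.nabla hh hb hc hcoer ih

variable {M : Type*} [TopologicalSpace M] [ChartedSpace E M] [IsManifold 𝓘(ℝ, E) ∞ M]

namespace SmoothMetric

variable {g : SmoothMetric E M} {s : E → M} {S S' : Set E}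

theorem IsUniformPatch.normCovDeriv_le (hs : g.IsUniformPatch s S S') {f : M → ℂ}
    (hf : ContMDiff 𝓘(ℝ, E) 𝓘(ℝ, ℂ) ∞ f) {S₁ : Set E} (hS₁ : IsOpen S₁) (hsub : S₁ ⊆ S) {w : E → ℝ}
    (hw : HasBoundedDerivs S₁ w (fderiv ℝ (f ∘ s))) (k : ℕ) :
    ∃ C : ℝ, ∀ u ∈ S₁, g.normCovDeriv f (k + 1) (s u) ≤ C * w u := by
  obtain ⟨l, hl, hcoer⟩ := hs.coercive
  have hs₁ := hs.toIsPatch.mono hS₁ hsub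
  have hF : ContDiffOn ℝ ∞ (f ∘ s) S₁ :=
    contMDiffOn_iff_contDiffOn.1 (hf.comp_contMDiffOn hs₁.contMDiffOn)
  obtain ⟨C, hC⟩ := (HasBoundedDerivs.iterNabla_uncurry0 hs₁.isMetricOn
    (hs.hasBoundedDerivs.mono hsub) hl (fun u hu => hcoer u (hsub hu)) hF hw k).bound 0
  refine ⟨√(Fintype.card (Fin (0 + (k + 1)) → Fin (Module.finrank ℝ E))) *
    √l⁻¹ ^ (0 + (k + 1)) * C, fun u hu => ?_⟩
  rw [hs₁.normCovDeriv_eq hf hu]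
  refine (tensorNorm_le hl (hcoer u (hsub hu)) _).trans ?_
  refine (mul_le_mul_of_nonneg_left ?_ (by positivity)).trans_eq (mul_assoc _ C (w u)).symm
  have := hC u hu
  rwa [norm_iteratedFDeriv_zero] at this

/-- For the lower bound on `|∇f|` the metric must be bounded above: a Euclidean unit vector has
`g`-length at most `√(max Λ 1)`. -/
theorem IsUniformPatch.norm_fderiv_le (hs : g.IsUniformPatch s S S') {f : M → ℂ}
    (hf : ContMDiff 𝓘(ℝ, E) 𝓘(ℝ, ℂ) ∞ f) :
    ∃ C : ℝ, 0 < C ∧ ∀ u ∈ S, ‖fderiv ℝ (f ∘ s) u‖ ≤ C * g.normCovDeriv f 1 (s u) := by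
  obtain ⟨l, hl, hcoer⟩ := hs.coercive
  obtain ⟨Λ, hΛ⟩ := hs.hasBoundedDerivs.bound 0
  have hF : ContDiffOn ℝ ∞ (f ∘ s) S :=
    contMDiffOn_iff_contDiffOn.1 (hf.comp_contMDiffOn hs.contMDiffOn)
  refine ⟨√(max Λ 1), by positivity, fun u hu => ?_⟩
  have hm := hs.isMetricOn
  have hnn : 0 ≤ g.normCovDeriv f 1 (s u) := Real.iSup_nonneg fun _ => Real.sqrt_nonneg _
  refine ContinuousLinearMap.opNorm_le_bound _ (by positivity) fun v => ?_
  have h1 := norm_apply_le_tensorNorm (B := g.pullback s u) (hm.symm u hu) hl (hcoer u hu)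
    (nabla (g.pullback s) (fun y => ContinuousMultilinearMap.uncurry0 ℝ E (f (s y))) u) v
  have h2 := hs.normCovDeriv_eq hf hu 1
  have h3 : ‖g.pullback s u‖ ≤ max Λ 1 := by
    have := hΛ u hu
    rw [norm_iteratedFDeriv_zero, mul_one] at this
    exact this.trans (le_max_left _ _)
  have h4 : √(g.pullback s u v v) ≤ √(max Λ 1) * ‖v‖ := by
    rw [← Real.sqrt_sq (norm_nonneg v), ← Real.sqrt_mul' _ (sq_nonneg _)]
    refine Real.sqrt_le_sqrt (((le_abs_self _).trans ((g.pullback s u).le_opNorm₂ v v)).trans ?_)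
    rw [mul_assoc, ← sq]
    gcongr
  have h5 : nabla (g.pullback s) (fun y => ContinuousMultilinearMap.uncurry0 ℝ E (f (s y))) u
      (fun _ => v) = fderiv ℝ (f ∘ s) u v := by
    have := nabla_uncurry0 (h := g.pullback s)
      ((hF.contDiffAt (hs.isOpen.mem_nhds hu)).differentiableAt (by simp))
    exact DFunLike.congr_fun this fun _ => v
  rw [← h5]
  calc _ ≤ g.normCovDeriv f 1 (s u) * √(g.pullback s u v v) := by
        rw [h2]
        exact h1
    _ ≤ g.normCovDeriv f 1 (s u) * (√(max Λ 1) * ‖v‖) := by gcongr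
    _ = _ := by ring

end SmoothMetric

end FunctionDerivatives

/-! ### Strong ellipticity -/

section StrongEllipticity

variable {n : ℕ} {G : Subgroup (Matrix.specialUnitaryGroup (Fin n) ℂ)}
  {X : Type*} [TopologicalSpace X] [ChartedSpace (CSpace n) X]

theorem IsInvariantPolynomial.contMDiff_descend {p : X → OrbitSpace G}
    (hp : IsHolomorphicToOrbitSpace G p) {f : MvPolynomial (Fin n) ℂ}
    (hinv : IsInvariantPolynomial G f) :
    ContMDiff 𝓘(ℂ, CSpace n) 𝓘(ℂ, ℂ) ω (hinv.descend ∘ p) := by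
  have h := hp.2 univ hinv.descend isOpen_univ (analyticOnNhd_eval_mvPolynomial f _)
  rwa [preimage_univ, contMDiffOn_univ] at h

theorem tendsto_mul_sub_rpow {a b : ℝ} (ha : 0 < a) (C : ℝ) (hb : 0 < b) :
    Tendsto (fun t : ℝ => a * t - C * t ^ (1 - b)) atTop atTop := by
  have h1 : Tendsto (fun t : ℝ => a - C * t ^ (-b)) atTop (𝓝 a) := by
    simpa using tendsto_const_nhds.sub ((tendsto_rpow_neg_atTop hb).const_mul C)
  refine (tendsto_id.atTop_mul_pos ha h1).congr' ?_
  filter_upwards [eventually_gt_atTop 0] with t ht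
  rw [sub_eq_add_neg 1 b, Real.rpow_add ht, Real.rpow_one, id]
  ring

variable [T2Space X] [ConnectedSpace X] [IsManifold 𝓘(ℂ, CSpace n) ω X]

theorem IsALEKaehlerMetric.conditionT [Finite G] (hfree : ActsFreelyOffZero G)
    {p : X → OrbitSpace G} (hp : IsResolution G p) {f : MvPolynomial (Fin n) ℂ}
    (hinv : IsInvariantPolynomial G f) (hquasi : IsQuasiHomogeneousWeightsLeHalf f)
    (hcrit : HasIsolatedCriticalPointAtZero f) {g : SmoothMetric (CSpace n) X}
    (hg : IsALEKaehlerMetric G p g) : g.ConditionT (hinv.descend ∘ p) := by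
  obtain ⟨R, s, hs, hps, hsp⟩ := hg.exists_isUniformPatch hfree hp
  obtain ⟨r, hr, hhom⟩ := hquasi
  set q : Fin n → ℝ := fun i => (r i : ℝ) with hq
  have hq2 : ∀ i, 0 < q i ∧ q i ≤ 1 / 2 := fun i =>
    ⟨Rat.cast_pos.2 (hr i).1, by
      have h : (r i : ℝ) ≤ ((1 / 2 : ℚ) : ℝ) := Rat.cast_le.2 (hr i).2
      simpa [hq] using h⟩
  have hq' : ∀ i, 0 < q i := fun i => (hq2 i).1
  obtain ⟨a, ha, haq⟩ : ∃ a : ℝ, 0 < a ∧ ∀ i, a ≤ q i := by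
    rcases isEmpty_or_nonempty (Fin n) with h | h
    · exact ⟨1, one_pos, fun i => h.elim i⟩
    · obtain ⟨i, hi⟩ := Finite.exists_min q
      exact ⟨q i, hq' i, hi⟩
  set F : CSpace n → ℂ := fun z => f.eval z.ofLp with hFdef
  have hF : IsQuasiHomogeneous q F := isQuasiHomogeneous_eval hhom
  have hsm : ContDiff ℝ ∞ F := contDiff_eval_mvPolynomial f
  have hcr : ∀ z ≠ 0, fderiv ℝ F z ≠ 0 := fun z hz =>
    hF.fderiv_ne_zero hsm hq' (eventually_fderiv_ne_zero hcrit) hz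
  have hfX : ContMDiff 𝓘(ℝ, CSpace n) 𝓘(ℝ, ℂ) ∞ (hinv.descend ∘ p) :=
    contMDiffOn_univ.1 (hinv.contMDiff_descend hp.holomorphic).contMDiffOn.restrict_scalars_real
  have hopen : IsOpen {z : CSpace n | R < ‖z‖} := isOpen_lt continuous_const continuous_norm
  set S₁ : Set (CSpace n) := {z | R < ‖z‖} ∩ {z | 1 < weightedNorm q z} with hS₁
  have hS₁o : IsOpen S₁ := hopen.inter (isOpen_lt continuous_const (continuous_weightedNorm hq'))
  have hFs : EqOn ((hinv.descend ∘ p) ∘ s) F {z | R < ‖z‖} := fun z hz => by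
    change hinv.descend (p (s z)) = F z
    rw [hps z hz]
    rfl
  have hdF : EqOn (fderiv ℝ ((hinv.descend ∘ p) ∘ s)) (fderiv ℝ F) {z | R < ‖z‖} := fun z hz =>
    (hFs.eventuallyEq_of_mem (hopen.mem_nhds hz)).fderiv_eq
  have hw : HasBoundedDerivs S₁ (fun z => weightedNorm q z ^ (1 - a))
      (fderiv ℝ ((hinv.descend ∘ p) ∘ s)) := by
    have h1 : HasBoundedDerivs S₁ (fun z => weightedNorm q z ^ (1 - a)) (fderiv ℝ F) := by
      refine ⟨(hsm.fderiv_right (m := ∞) (by simp)).contDiffOn, fun k => ?_⟩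
      obtain ⟨C, hC⟩ := hF.norm_iteratedFDeriv_le hsm hq2 ha haq k
      exact ⟨C, fun u hu => by
        rw [norm_iteratedFDeriv_fderiv]
        exact hC u hu.2⟩
    exact h1.congr hS₁o (hdF.mono inter_subset_left)
  obtain ⟨c, hc, hlow⟩ := hF.le_norm_fderiv hsm hq2 hcr
  obtain ⟨Λ, hΛ, hgrad⟩ := hs.norm_fderiv_le hfX
  intro ε hε k hk z₀ C
  obtain ⟨m, rfl⟩ : ∃ m, k = m + 1 := ⟨k - 1, by omega⟩
  obtain ⟨B, hB⟩ := hs.normCovDeriv_le hfX hS₁o inter_subset_left hw m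
  have hpos : 0 < ε * (Λ⁻¹ * c) ^ (m + 1) := by positivity
  obtain ⟨t₀, ht₀⟩ := eventually_atTop.1
    ((tendsto_mul_sub_rpow hpos B ha).eventually (eventually_gt_atTop C))
  set t₁ := max t₀ 1 with ht₁
  -- Outside the ball of radius `√n t₁` the weighted norm exceeds `t₁`. The part of `X` over the
  -- ball of radius `R₁` is compact, hence at bounded distance `D` from `z₀`.
  set R₁ := max R (√n * t₁) with hR₁
  obtain ⟨D, hD⟩ := g.exists_edist_le_of_isCompact
    (isCompact_preimage_closedBall hp.proper R₁) z₀
  refine ⟨D, fun x hx => ?_⟩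
  obtain ⟨u, hu⟩ := orbitMap_surjective (p x)
  have huR₁ : R₁ < ‖u‖ := by
    by_contra! hle
    exact absurd (hD x ⟨u, by simpa using hle, hu⟩) (not_le.2 hx)
  have huR : R < ‖u‖ := (le_max_left _ _).trans_lt huR₁
  have hut : t₁ < weightedNorm q u := by
    by_contra! hle
    exact absurd ((norm_le_of_weightedNorm_le hq2 (le_max_right _ _) hle).trans (le_max_right _ _))
      (not_le.2 huR₁)
  have hu1 : 1 < weightedNorm q u := (le_max_right _ _).trans_lt hut
  obtain rfl := hsp x u huR hu.symm
  set t := weightedNorm q u with ht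
  have e1 := hB u ⟨huR, hu1⟩
  have e2 : Λ⁻¹ * c * t ^ (1 / 2 : ℝ) ≤ g.normCovDeriv (hinv.descend ∘ p) 1 (s u) := by
    rw [mul_assoc, inv_mul_le_iff₀ hΛ]
    refine (hlow u hu1).trans ?_
    rw [← hdF huR]
    exact hgrad u huR
  -- Here `k = m + 1 ≥ 2` is used, together with `t > 1`.
  have e3 : t ≤ (t ^ (1 / 2 : ℝ)) ^ (m + 1) := by
    rw [← Real.rpow_mul_natCast (by linarith)]
    calc t = t ^ (1 : ℝ) := (Real.rpow_one t).symm
      _ ≤ _ := Real.rpow_le_rpow_of_exponent_le hu1.le (by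
        have : (2 : ℝ) ≤ (m + 1 : ℕ) := by exact_mod_cast hk
        linarith)
  calc C < ε * (Λ⁻¹ * c) ^ (m + 1) * t - B * t ^ (1 - a) :=
        ht₀ t ((le_max_left _ _).trans hut.le)
    _ ≤ ε * (Λ⁻¹ * c) ^ (m + 1) * (t ^ (1 / 2 : ℝ)) ^ (m + 1) - B * t ^ (1 - a) := by gcongr
    _ = ε * (Λ⁻¹ * c * t ^ (1 / 2 : ℝ)) ^ (m + 1) - B * t ^ (1 - a) := by
        rw [mul_pow (Λ⁻¹ * c), mul_assoc]
    _ ≤ _ := by gcongr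

end StrongEllipticity

end

theorem mainTheorem12 {n : ℕ} (G : Subgroup (Matrix.specialUnitaryGroup (Fin n) ℂ)) [Finite G]
    (hfree : ActsFreelyOffZero G)
    {X : Type*} [TopologicalSpace X] [T2Space X] [SecondCountableTopology X]
    [ConnectedSpace X] [ChartedSpace (CSpace n) X] [IsManifold 𝓘(ℂ, CSpace n) ω X]
    (p : X → OrbitSpace G) (hp : IsCrepantResolution G p)
    (f : MvPolynomial (Fin n) ℂ) (hinv : IsInvariantPolynomial G f)
    (hquasi : IsQuasiHomogeneousWeightsLeHalf f) (hcrit : HasIsolatedCriticalPointAtZero f)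
    (g : SmoothMetric (CSpace n) X) (hg : IsALEKaehlerMetric G p g) :
    g.HasBoundedGeometry ∧ g.IsStronglyElliptic (hinv.descend ∘ p) := by
  exact ⟨hg.hasBoundedGeometry hfree hp.toIsResolution, hinv.contMDiff_descend hp.holomorphic,
    hg.conditionT hfree hp.toIsResolution hinv hquasi hcrit⟩
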